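/- Let $(X,\mu)$ be a standard atomless probability space. Let $\mathrm{Aut}(X,\mu)$ be the group of $\mu$-preserving automorphisms of $X$, modulo $\mu$-a.e. equality, with the weak topology; this has as a basis the sets $\{\beta : \mu(\beta(A)\,\triangle\,\alpha(A))<\varepsilon \text{ for all } A\in\Omega\}$, where $\alpha\in\mathrm{Aut}(X,\mu)$, $\Omega$ is a finite collection of measurable sets and $\varepsilon>0$. Let $\mathrm{Act}(\mathbb R,X,\mu)$ be the space of continuous homomorphisms $\mathbb R\to\mathrm{Aut}(X,\mu)$, $s\mapsto\alpha_s$ (measure-preserving flows), with the topology which has as a basis the sets $\{\beta : \mu(\beta_s(A)\,\triangle\,\alpha_s(A))<\varepsilon \text{ for all } s\in K,\ A\in\Omega\}$, where $\alpha\in\mathrm{Act}(\mathbb R,X,\mu)$, $K\subseteq\mathbb R$ is compact, $\Omega$ is a finite collection of measurable sets and $\varepsilon>0$. Let $\mathrm{Erg}(\mathbb R,X,\mu)$ be the subspace of ergodic flows, i.e. of those $\alpha$ such that every measurable set $A$ with $\mu(\alpha_s(A)\,\triangle\,A)=0$ for all $s\in\mathbb R$ has measure $0$ or $1$. The group $\mathrm{Aut}(X,\mu)$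 acts on $\mathrm{Erg}(\mathbb R,X,\mu)$ by conjugation, $(\gamma\cdot\alpha)_s=\gamma\alpha_s\gamma^{-1}$. For a Polish group $G$ acting continuously on a Polish space $Y$, a point $x\in Y$, and open sets $U\ni x$ in $Y$ and $V\ni e$ in $G$, the local orbit $\mathcal O(x,U,V)$ is the set of all $y\in U$ for which there are $n\ge 1$ and $g_1,\dots,g_n\in V$ with $g_k\cdots g_1x\in U$ for $k=1,\dots,n-1$ and $g_n\cdots g_1x=y$. The point $x$ is turbulent if the closure of $\mathcal O(x,U,V)$ has nonempty interior for all such $U$ and $V$. The action is generically turbulent if some orbit is dense, every orbit is meager, and some point is turbulent. **Theorem.** $\mathrm{Aut}(X,\mu)$ is a Polish group acting continuously on the Polish space $\mathrm{Erg}(\mathbb R,X,\mu)$ by conjugation, and this action is generically turbulent. -/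

import Mathlib

open MeasureTheory Set
open scoped Topology symmDiff

/-! ## Turbulence for group actions -/

section Turbulence

variable {G : Type*} {X : Type*} [Group G] [MulAction G X]

/-- The local orbit `𝒪(x, U, V)`: all `y ∈ U` of the form `y = gₙ ⋯ g₁ x`, with `n ≥ 1`,
`g₁, …, gₙ ∈ V` and every intermediate point `gₖ ⋯ g₁ x` in `U`. In other words, `y` is reached
from `x` by finitely many (at least one) steps, each by an element of `V` and landing in `U`. -/
def localOrbit (x : X) (U : Set X) (V : Set G) : Set X :=
  {y | Relation.TransGen (fun a b => b ∈ U ∧ ∃ g ∈ V, g • a = b) x y}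

variable (G) in
/-- A point is turbulent if the closure of each of its local orbits has nonempty interior. -/
def IsTurbulentPoint [TopologicalSpace G] [TopologicalSpace X] (x : X) : Prop :=
  ∀ (U : Set X) (V : Set G), IsOpen U → x ∈ U → IsOpen V → (1 : G) ∈ V →
    (interior (closure (localOrbit x U V))).Nonempty

variable (G X) in
/-- `X` is a Polish `G`-space: a Polish space with a (jointly) continuous action of the
Polish group `G`. -/
structure IsPolishGSpace [TopologicalSpace G] [TopologicalSpace X] : Prop where
  isTopologicalGroup : IsTopologicalGroup G
  polish_group : PolishSpace G
  polish_space : PolishSpace X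
  continuous_smul : ContinuousSMul G X

variable (G X) in
/-- A continuous action of a Polish group `G` on a Polish space `X` is generically turbulent if
some orbit is dense, every orbit is meager and some point is turbulent. -/
structure IsGenericallyTurbulent [TopologicalSpace G] [TopologicalSpace X] : Prop where
  isPolishGSpace : IsPolishGSpace G X
  exists_dense_orbit : ∃ x : X, Dense (MulAction.orbit G x)
  isMeagre_orbit : ∀ x : X, IsMeagre (MulAction.orbit G x)
  exists_turbulent : ∃ x : X, IsTurbulentPoint G x

end Turbulence

/-! ## The group of automorphisms of a measure space -/

section Aut

variable {X : Type*} [MeasurableSpace X]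

/-- The group of measurable bijections of `X` with measurable inverse which preserve `μ`
(before identifying maps which agree almost everywhere). -/
def mpPerm (μ : Measure X) : Subgroup (Equiv.Perm X) where
  carrier := {f | MeasurePreserving f μ μ ∧ MeasurePreserving f.symm μ μ}
  mul_mem' := fun {_ _} hf hg => ⟨hf.1.comp hg.1, hg.2.comp hf.2⟩
  one_mem' := ⟨MeasurePreserving.id μ, MeasurePreserving.id μ⟩
  inv_mem' := fun {_} hf => ⟨hf.2, hf.1⟩

/-- The subgroup of those automorphisms which are the identity almost everywhere. -/
def mpPermNull (μ : Measure X) : Subgroup (mpPerm μ) where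
  carrier := {f | ∀ᵐ x ∂μ, (f : Equiv.Perm X) x = x}
  mul_mem' := fun {f g} hf hg => by
    change ∀ᵐ x ∂μ, ((f * g : mpPerm μ) : Equiv.Perm X) x = x
    filter_upwards [hf, hg] with x h1 h2
    simp [h1, h2]
  one_mem' := by simp
  inv_mem' := fun {f} hf => by
    change ∀ᵐ x ∂μ, ((f⁻¹ : mpPerm μ) : Equiv.Perm X) x = x
    filter_upwards [hf] with x h
    simp only [Subgroup.coe_inv]
    exact (Equiv.Perm.inv_eq_iff_eq).2 h.symm

instance mpPermNull_normal (μ : Measure X) : (mpPermNull μ).Normal where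
  conj_mem := fun n hn g => by
    have h := g.2.2.quasiMeasurePreserving.ae (p := fun x => (n : Equiv.Perm X) x = x) hn
    change ∀ᵐ x ∂μ, ((g * n * g⁻¹ : mpPerm μ) : Equiv.Perm X) x = x
    filter_upwards [h] with x hx
    change (g : Equiv.Perm X) ((n : Equiv.Perm X) ((g : Equiv.Perm X).symm x)) = x
    rw [hx, Equiv.apply_symm_apply]

/-- `Aut(X, μ)`: the `μ`-preserving automorphisms of `X`, modulo almost everywhere equality. -/
def AutMeas (μ : Measure X) : Type _ := mpPerm μ ⧸ mpPermNull μ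

instance (μ : Measure X) : Group (AutMeas μ) :=
  inferInstanceAs (Group (mpPerm μ ⧸ mpPermNull μ))

variable {μ : Measure X}

/-- The class in `Aut(X, μ)` of an automorphism. -/
def AutMeas.mk (f : mpPerm μ) : AutMeas μ := QuotientGroup.mk f

theorem AutMeas.exists_rep (S : AutMeas μ) : ∃ f : mpPerm μ, AutMeas.mk f = S :=
  QuotientGroup.mk_surjective S

theorem AutMeas.mk_mul (f g : mpPerm μ) :
    AutMeas.mk (f * g) = AutMeas.mk f * AutMeas.mk g := rfl

theorem AutMeas.mk_one : AutMeas.mk (1 : mpPerm μ) = 1 := rfl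

theorem mpPerm_image_ae_eq {f f' : mpPerm μ}
    (h : (QuotientGroup.leftRel (mpPermNull μ)) f f') (A : Set X) :
    ((f : Equiv.Perm X) '' A : Set X) =ᵐ[μ] ((f' : Equiv.Perm X) '' A : Set X) := by
  have h1 : ∀ᵐ x ∂μ, ((f⁻¹ * f' : mpPerm μ) : Equiv.Perm X) x = x :=
    QuotientGroup.leftRel_apply.1 h
  have h2 := f'.2.2.quasiMeasurePreserving.ae h1
  filter_upwards [h2] with x hx
  have hx' : (f : Equiv.Perm X).symm x = (f' : Equiv.Perm X).symm x := by
    have := hx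
    simp only [Subgroup.coe_mul, Subgroup.coe_inv, Equiv.Perm.mul_apply] at this
    rwa [Equiv.apply_symm_apply] at this
  simp only [Equiv.image_eq_preimage_symm]
  apply propext
  change (f : Equiv.Perm X).symm x ∈ A ↔ (f' : Equiv.Perm X).symm x ∈ A
  rw [hx']

/-- The distance `μ (S(A) ∆ T(A))` between the images of a set `A` under two elements of
`Aut(X, μ)`. It is the square of the distance in `L²(X, μ)` of the translates of `1_A`. -/
noncomputable def AutMeas.imageDist (A : Set X) (S T : AutMeas μ) : ℝ :=
  Quotient.liftOn₂ S T
    (fun f g => μ.real (((f : Equiv.Perm X) '' A) ∆ ((g : Equiv.Perm X) '' A)))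
    (fun _ _ _ _ h h' => measureReal_congr
      ((mpPerm_image_ae_eq h A).symmDiff (mpPerm_image_ae_eq h' A)))

theorem AutMeas.imageDist_mk (A : Set X) (f g : mpPerm μ) :
    AutMeas.imageDist A (AutMeas.mk f) (AutMeas.mk g) =
      μ.real (((f : Equiv.Perm X) '' A) ∆ ((g : Equiv.Perm X) '' A)) := rfl

theorem mpPerm_measurableSet_image (f : mpPerm μ) {A : Set X} (hA : MeasurableSet A) :
    MeasurableSet ((f : Equiv.Perm X) '' A) := by
  rw [Equiv.image_eq_preimage_symm]
  exact f.2.2.measurable hA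

theorem AutMeas.imageDist_mul_left (R S T : AutMeas μ) {A : Set X} (hA : MeasurableSet A) :
    AutMeas.imageDist A (R * S) (R * T) = AutMeas.imageDist A S T := by
  obtain ⟨r, rfl⟩ := R.exists_rep
  obtain ⟨s, rfl⟩ := S.exists_rep
  obtain ⟨t, rfl⟩ := T.exists_rep
  rw [← AutMeas.mk_mul, ← AutMeas.mk_mul, AutMeas.imageDist_mk, AutMeas.imageDist_mk]
  simp only [Subgroup.coe_mul, Equiv.Perm.coe_mul, image_comp]
  rw [← image_symmDiff (r : Equiv.Perm X).injective, Equiv.image_eq_preimage_symm]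
  exact r.2.2.measureReal_preimage
    ((mpPerm_measurableSet_image s hA).symmDiff
      (mpPerm_measurableSet_image t hA)).nullMeasurableSet

theorem AutMeas.imageDist_mul_right (S T : AutMeas μ) (r : mpPerm μ) (A : Set X) :
    AutMeas.imageDist A (S * AutMeas.mk r) (T * AutMeas.mk r) =
      AutMeas.imageDist ((r : Equiv.Perm X) '' A) S T := by
  obtain ⟨s, rfl⟩ := S.exists_rep
  obtain ⟨t, rfl⟩ := T.exists_rep
  rw [← AutMeas.mk_mul, ← AutMeas.mk_mul, AutMeas.imageDist_mk, AutMeas.imageDist_mk]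
  simp only [Subgroup.coe_mul, Equiv.Perm.coe_mul, image_comp]

/-- Conjugation moves to the test set: `R S R⁻¹` and `T` compare on `A` as `S` and `R⁻¹ T R`
compare on `R⁻¹(A)`. -/
theorem AutMeas.imageDist_conj (S T : AutMeas μ) (r : mpPerm μ) {A : Set X}
    (hA : MeasurableSet A) :
    AutMeas.imageDist A (AutMeas.mk r * S * (AutMeas.mk r)⁻¹) T =
      AutMeas.imageDist (((r⁻¹ : mpPerm μ) : Equiv.Perm X) '' A) S
        ((AutMeas.mk r)⁻¹ * T * AutMeas.mk r) := by
  rw [← AutMeas.imageDist_mul_right, show AutMeas.mk r⁻¹ = (AutMeas.mk r)⁻¹ from rfl,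
    ← AutMeas.imageDist_mul_left (AutMeas.mk r) (S * _) _ hA]
  congr 1 <;> group

/-- The sets `Z_{α, Ω, ε}`: automorphisms which are `ε`-close to `α` on all sets in `Ω`. -/
def AutMeas.basicNhd (α : AutMeas μ) (Ω : Set (Set X)) (ε : ℝ) : Set (AutMeas μ) :=
  {β | ∀ A ∈ Ω, AutMeas.imageDist A β α < ε}

/-- The weak topology on `Aut(X, μ)`, with basis the sets `Z_{α, Ω, ε}` where `Ω` is a finite
collection of measurable sets and `ε > 0`. -/
instance : TopologicalSpace (AutMeas μ) :=
  TopologicalSpace.generateFrom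
    {Z | ∃ (α : AutMeas μ) (Ω : Set (Set X)) (ε : ℝ), Ω.Finite ∧ (∀ A ∈ Ω, MeasurableSet A) ∧
      0 < ε ∧ Z = AutMeas.basicNhd α Ω ε}

theorem AutMeas.continuous_conj (γ : AutMeas μ) :
    Continuous (fun S : AutMeas μ => γ * S * γ⁻¹) := by
  obtain ⟨r, rfl⟩ := γ.exists_rep
  refine continuous_generateFrom_iff.2 ?_
  rintro _ ⟨α, Ω, ε, hΩ, hm, hε, rfl⟩
  refine TopologicalSpace.isOpen_generateFrom_of_mem
    ⟨(AutMeas.mk r)⁻¹ * α * AutMeas.mk r,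
      (fun A => ((r⁻¹ : mpPerm μ) : Equiv.Perm X) '' A) '' Ω, ε, hΩ.image _, ?_, hε, ?_⟩
  · rintro _ ⟨A, hA, rfl⟩
    exact mpPerm_measurableSet_image _ (hm A hA)
  · ext S
    simp only [AutMeas.basicNhd, mem_preimage, mem_ofPred_eq, forall_mem_image]
    refine forall₂_congr fun A hA => ?_
    rw [AutMeas.imageDist_conj _ _ _ (hm A hA)]

end Aut

/-! ## Spaces of measure-preserving actions -/

section Act

variable (G : Type*) [Group G] [TopologicalSpace G] {X : Type*} [MeasurableSpace X]

/-- `Act(G, X, μ)`: the continuous `μ`-preserving actions of `G` on `(X, μ)`, i.e. the continuous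
homomorphisms `s ↦ α s` from `G` to `Aut(X, μ)`. -/
structure MPAct (μ : Measure X) extends G →* AutMeas μ where
  continuous_toFun : Continuous toFun

variable {G} {μ : Measure X}

instance : FunLike (MPAct G μ) G (AutMeas μ) where
  coe α := α.toMonoidHom
  coe_injective α β h := by
    cases α; cases β; congr; exact DFunLike.coe_injective h

theorem MPAct.ext {α β : MPAct G μ} (h : ∀ s, α s = β s) : α = β := DFunLike.ext _ _ h

/-- The sets `Y_{α, K, Ω, ε}`: actions which are `ε`-close to `α` on all sets in `Ω` at all times
in `K`. -/
def MPAct.basicNhd (α : MPAct G μ) (K : Set G) (Ω : Set (Set X)) (ε : ℝ) : Set (MPAct G μ) :=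
  {β | ∀ s ∈ K, ∀ A ∈ Ω, AutMeas.imageDist A (β s) (α s) < ε}

/-- The topology on `Act(G, X, μ)`, with basis the sets `Y_{α, K, Ω, ε}` where `K ⊆ G` is compact,
`Ω` is a finite collection of measurable sets and `ε > 0`. -/
instance : TopologicalSpace (MPAct G μ) :=
  TopologicalSpace.generateFrom
    {Y | ∃ (α : MPAct G μ) (K : Set G) (Ω : Set (Set X)) (ε : ℝ), IsCompact K ∧ Ω.Finite ∧
      (∀ A ∈ Ω, MeasurableSet A) ∧ 0 < ε ∧ Y = MPAct.basicNhd α K Ω ε}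

/-- The conjugation action of `Aut(X, μ)` on `Act(G, X, μ)`: `(γ • α) s = γ * α s * γ⁻¹`. -/
instance : MulAction (AutMeas μ) (MPAct G μ) where
  smul γ α :=
    { toMonoidHom := (MulAut.conj γ).toMonoidHom.comp α.toMonoidHom
      continuous_toFun := (AutMeas.continuous_conj γ).comp α.continuous_toFun }
  one_smul α := MPAct.ext fun s => by
    change 1 * α s * 1⁻¹ = α s
    group
  mul_smul γ δ α := MPAct.ext fun s => by
    change γ * δ * α s * (γ * δ)⁻¹ = γ * (δ * α s * δ⁻¹) * γ⁻¹
    group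

theorem MPAct.smul_apply (γ : AutMeas μ) (α : MPAct G μ) (s : G) :
    (γ • α) s = γ * α s * γ⁻¹ := rfl

/-- An action is ergodic if each measurable set which every `α s` fixes up to a null set has
measure `0` or `1`. -/
def MPAct.IsErgodic (α : MPAct G μ) : Prop :=
  ∀ A : Set X, MeasurableSet A → (∀ s, AutMeas.imageDist A (α s) 1 = 0) → μ A = 0 ∨ μ A = 1

theorem MPAct.IsErgodic.smul {α : MPAct G μ} (hα : α.IsErgodic) (γ : AutMeas μ) :
    (γ • α).IsErgodic := by
  obtain ⟨r, rfl⟩ := γ.exists_rep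
  intro A hA h
  have hμ : μ (((r⁻¹ : mpPerm μ) : Equiv.Perm X) '' A) = μ A := by
    rw [Equiv.image_eq_preimage_symm]
    exact r.2.1.measure_preimage hA.nullMeasurableSet
  rw [← hμ]
  refine hα _ (mpPerm_measurableSet_image _ hA) fun s => ?_
  have := h s
  rw [MPAct.smul_apply, AutMeas.imageDist_conj _ _ _ hA] at this
  simpa using this

variable (G) in
/-- `Erg(G, X, μ)`: the subspace of ergodic actions in `Act(G, X, μ)`. -/
abbrev MPErg (μ : Measure X) : Type _ := {α : MPAct G μ // α.IsErgodic}

/-- The conjugation action of `Aut(X, μ)` on `Erg(G, X, μ)`. -/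
instance : MulAction (AutMeas μ) (MPErg G μ) where
  smul γ α := ⟨γ • α.1, α.2.smul γ⟩
  one_smul α := Subtype.ext (one_smul _ α.1)
  mul_smul γ δ α := Subtype.ext (mul_smul γ δ α.1)

end Act

/-! Polishness. Read in the unit interval, an automorphism `T` becomes an element of `L¹`, and the
weak topology is `L¹`-convergence of these functions. The pairs for `T` and `T⁻¹` form a closed
subset of `L¹ × L¹`, since limits of the two remain inverse to each other. The topology on actions
is the compact-open one, and homomorphisms are closed among continuous maps. Ergodicity is a `Gδ`
condition: `α` is ergodic iff, for each `C` in a countable dense family of sets, convex combinations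
of the translates of `1_C` come arbitrarily close in `L²` to the constant `μ(C)`.

Turbulence and meagreness rest on one construction, `exists_linearFlow_approx`. Given flows `α`, `β`
and a large `L`, identify the circle with `X × [0,1]` by `θ`, and send a torus point `(y, x)` with
`θ(x) = (p, u)` to `α_{yL}(p)` if `u > t` and to `β_{yL}(p)` if `u ≤ t` (the time is discretized in
the code). Consider the linear flow that moves `y` with speed `1/L` and `x` with a tiny speed `a`.
Except where `y` wraps around, this map nearly intertwines it with `α` above the level `t` and with
`β` below. The map preserves measure, so it can be imitated on finitely many sets by an automorphism
`γ_t`. Let `ξ` be the linear flow transferred to `X`; it is ergodic when `aL` is irrational.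

Three features are then used. The distance from `γ_t • ξ` to any fixed flow is, up to a small error,
at most the convex combination with weights `1 - t` and `t` of the distances from `α` and `β`; so
`γ_0 • ξ` is near `α`, `γ_1 • ξ` is near `β`, and the path between them stays in a ball containing
both. Raising `t` by `1/m` changes the map on a set of measure `1/m`, so the path consists of
conjugations by automorphisms near the identity. Finally `ξ` is nearly periodic with period `L`,
because at time `L` the coordinate `y` is back and `x` has barely moved.

The first two features say that local orbits join any two open subsets of a small ball
(`exists_mem_localOrbit`). A Baire category argument turns this into a turbulent point, and a cruder
one into a dense orbit. The third gives meagreness. By ergodicity some `A` satisfies `μ(α_s(A) ∆ A)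
≥ ε` for an unbounded set of times `s`, and each conjugate of `α` inherits this with `ε/2` for some
set of the countable dense family. For each such set this is a closed condition with empty interior,
since any flow is approximated by flows that nearly fix the set at one of these times. -/

/-! ## The pseudo-distance `μ (A ∆ B)` -/

section SetDist

variable {X Y : Type*} [MeasurableSpace X] [MeasurableSpace Y]

/-- The pseudo-distance `μ (A ∆ B)` between two sets. -/
noncomputable def setDist (μ : Measure X) (A B : Set X) : ℝ := μ.real (A ∆ B)

variable {μ : Measure X} {ν : Measure Y}

theorem ae_eq_of_set_eq {A B : Set X} (h : A = B) : A =ᵐ[μ] B := h ▸ .rfl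

theorem setDist_nonneg (A B : Set X) : 0 ≤ setDist μ A B := measureReal_nonneg

theorem setDist_self (A : Set X) : setDist μ A A = 0 := by simp [setDist]

theorem setDist_comm (A B : Set X) : setDist μ A B = setDist μ B A := by
  rw [setDist, setDist, symmDiff_comm]

theorem setDist_triangle [IsFiniteMeasure μ] (A B C : Set X) :
    setDist μ A C ≤ setDist μ A B + setDist μ B C :=
  measureReal_symmDiff_le (s := A) (t := B) C

theorem setDist_congr {A A' B B' : Set X} (h : A =ᵐ[μ] A') (h' : B =ᵐ[μ] B') :
    setDist μ A B = setDist μ A' B' :=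
  measureReal_congr (h.symmDiff h')

theorem setDist_congr_left {A A' B : Set X} (h : A =ᵐ[μ] A') : setDist μ A B = setDist μ A' B :=
  setDist_congr h .rfl

theorem setDist_congr_right {A B B' : Set X} (h : B =ᵐ[μ] B') : setDist μ A B = setDist μ A B' :=
  setDist_congr .rfl h

theorem setDist_eq_zero_iff [IsFiniteMeasure μ] {A B : Set X} :
    setDist μ A B = 0 ↔ A =ᵐ[μ] B := by
  rw [setDist, measureReal_eq_zero_iff, measure_symmDiff_eq_zero_iff]

theorem setDist_preimage {f : X → Y} (hf : MeasurePreserving f μ ν) {A B : Set Y}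
    (hA : MeasurableSet A) (hB : MeasurableSet B) :
    setDist μ (f ⁻¹' A) (f ⁻¹' B) = setDist ν A B := by
  rw [setDist, setDist, ← preimage_symmDiff]
  exact hf.measureReal_preimage (hA.symmDiff hB).nullMeasurableSet

theorem abs_setDist_sub_le [IsFiniteMeasure μ] (A B A' B' : Set X) :
    |setDist μ A B - setDist μ A' B'| ≤ setDist μ A A' + setDist μ B B' := by
  rw [abs_le]
  have h1 := setDist_triangle (μ := μ) A A' B
  have h2 := setDist_triangle (μ := μ) A' B' B
  have h3 := setDist_triangle (μ := μ) A' A B'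
  have h4 := setDist_triangle (μ := μ) A B B'
  rw [setDist_comm B' B] at h2
  rw [setDist_comm A' A] at h3
  constructor <;> linarith

theorem abs_measureReal_sub_le_setDist [IsFiniteMeasure μ] {A B : Set X}
    (hA : MeasurableSet A) (hB : MeasurableSet B) :
    |μ.real A - μ.real B| ≤ setDist μ A B :=
  abs_measureReal_sub_le_measureReal_symmDiff hA.nullMeasurableSet hB.nullMeasurableSet

theorem exists_countable_setDist_dense (μ : Measure X) [IsFiniteMeasure μ]
    [MeasurableSpace.CountablyGenerated X] :
    ∃ C : ℕ → Set X, (∀ n, MeasurableSet (C n)) ∧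
      ∀ A, MeasurableSet A → ∀ ε > 0, ∃ n, setDist μ A (C n) < ε := by
  obtain ⟨𝒜, hc, hd⟩ := exists_countable_measureDense (μ := μ)
  obtain ⟨C, hC⟩ := hc.exists_eq_range hd.nonempty
  refine ⟨C, fun n => hd.measurable _ (hC ▸ mem_range_self n), fun A hA ε hε => ?_⟩
  obtain ⟨t, ht, h⟩ := hd.approx A hA (measure_ne_top _ _) ε hε
  rw [hC] at ht
  obtain ⟨n, rfl⟩ := ht
  exact ⟨n, (ENNReal.lt_ofReal_iff_toReal_lt (measure_ne_top _ _)).1 h⟩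

end SetDist

/-! ## Representatives of elements of `Aut(X, μ)` -/

section Img

variable {X : Type*} [MeasurableSpace X] {μ : Measure X}

/-- A representative of an element of `Aut(X, μ)`. -/
noncomputable def AutMeas.rep (T : AutMeas μ) : mpPerm μ := T.exists_rep.choose

theorem AutMeas.mk_rep (T : AutMeas μ) : AutMeas.mk T.rep = T := T.exists_rep.choose_spec

/-- The image of a set under a representative of an element of `Aut(X, μ)`. -/
noncomputable def AutMeas.img (T : AutMeas μ) (A : Set X) : Set X := (T.rep : Equiv.Perm X) '' A

theorem mpPerm_mk_eq_iff {f g : mpPerm μ} :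
    AutMeas.mk f = AutMeas.mk g ↔
      (f : Equiv.Perm X) =ᵐ[μ] (g : Equiv.Perm X) := by
  have : AutMeas.mk f = AutMeas.mk g ↔ f⁻¹ * g ∈ mpPermNull μ := QuotientGroup.eq
  rw [this]
  constructor
  · intro h
    filter_upwards [show ∀ᵐ x ∂μ, ((f⁻¹ * g : mpPerm μ) : Equiv.Perm X) x = x from h] with x hx
    have : (f : Equiv.Perm X).symm ((g : Equiv.Perm X) x) = x := hx
    rw [Equiv.symm_apply_eq] at this
    exact this.symm
  · intro h
    change ∀ᵐ x ∂μ, ((f⁻¹ * g : mpPerm μ) : Equiv.Perm X) x = x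
    filter_upwards [h] with x hx
    change (f : Equiv.Perm X).symm ((g : Equiv.Perm X) x) = x
    rw [← hx, Equiv.symm_apply_apply]

theorem mpPerm_image_ae_eq_of_mk_eq {f g : mpPerm μ} (h : AutMeas.mk f = AutMeas.mk g)
    (A : Set X) :
    ((f : Equiv.Perm X) '' A : Set X) =ᵐ[μ] ((g : Equiv.Perm X) '' A : Set X) :=
  mpPerm_image_ae_eq (Quotient.exact h) A

theorem AutMeas.img_mk (f : mpPerm μ) (A : Set X) :
    (AutMeas.mk f).img A =ᵐ[μ] ((f : Equiv.Perm X) '' A : Set X) :=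
  mpPerm_image_ae_eq_of_mk_eq (AutMeas.mk_rep _) A

theorem AutMeas.measurableSet_img (T : AutMeas μ) {A : Set X} (hA : MeasurableSet A) :
    MeasurableSet (T.img A) :=
  mpPerm_measurableSet_image _ hA

theorem AutMeas.imageDist_eq (A : Set X) (S T : AutMeas μ) :
    AutMeas.imageDist A S T = setDist μ (S.img A) (T.img A) := by
  conv_lhs => rw [← S.mk_rep, ← T.mk_rep]
  rfl

theorem AutMeas.img_ae_congr (T : AutMeas μ) {A B : Set X} (h : A =ᵐ[μ] B) :
    T.img A =ᵐ[μ] T.img B := by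
  unfold AutMeas.img
  rw [Equiv.image_eq_preimage_symm, Equiv.image_eq_preimage_symm]
  exact T.rep.2.2.quasiMeasurePreserving.preimage_ae_eq h

theorem AutMeas.img_mul (S T : AutMeas μ) (A : Set X) :
    (S * T).img A =ᵐ[μ] S.img (T.img A) := by
  have h : (S * T).img A =ᵐ[μ] ((S.rep * T.rep : mpPerm μ) : Equiv.Perm X) '' A :=
    mpPerm_image_ae_eq_of_mk_eq (by rw [AutMeas.mk_rep, AutMeas.mk_mul, S.mk_rep, T.mk_rep]) A
  refine h.trans (ae_eq_of_set_eq ?_)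
  simp only [Subgroup.coe_mul, Equiv.Perm.coe_mul, image_comp, AutMeas.img]

theorem AutMeas.img_one (A : Set X) : (1 : AutMeas μ).img A =ᵐ[μ] A := by
  have h := AutMeas.img_mk (1 : mpPerm μ) A
  rw [AutMeas.mk_one] at h
  exact h.trans (ae_eq_of_set_eq (by simp))

theorem AutMeas.setDist_img (T : AutMeas μ) {A B : Set X} (hA : MeasurableSet A)
    (hB : MeasurableSet B) : setDist μ (T.img A) (T.img B) = setDist μ A B := by
  unfold AutMeas.img
  rw [Equiv.image_eq_preimage_symm, Equiv.image_eq_preimage_symm]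
  exact setDist_preimage T.rep.2.2 hA hB

theorem AutMeas.img_inv_img (T : AutMeas μ) (A : Set X) : T⁻¹.img (T.img A) =ᵐ[μ] A := by
  refine (AutMeas.img_mul _ _ _).symm.trans ?_
  rw [inv_mul_cancel]
  exact AutMeas.img_one A

theorem AutMeas.img_img_inv (T : AutMeas μ) (A : Set X) : T.img (T⁻¹.img A) =ᵐ[μ] A := by
  refine (AutMeas.img_mul _ _ _).symm.trans ?_
  rw [mul_inv_cancel]
  exact AutMeas.img_one A

/-- Moving an automorphism from one side of the distance to the other. -/
theorem AutMeas.setDist_img_left (T : AutMeas μ) {A B : Set X} (hA : MeasurableSet A)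
    (hB : MeasurableSet B) : setDist μ (T.img A) B = setDist μ A (T⁻¹.img B) := by
  rw [← T.setDist_img hA (T⁻¹.measurableSet_img hB)]
  exact setDist_congr_right (T.img_img_inv B).symm

theorem AutMeas.measure_img (T : AutMeas μ) {A : Set X} (hA : MeasurableSet A) :
    μ (T.img A) = μ A := by
  unfold AutMeas.img
  rw [Equiv.image_eq_preimage_symm]
  exact T.rep.2.2.measure_preimage hA.nullMeasurableSet

end Img

/-! ## Automorphisms from almost everywhere inverse pairs -/

section AEInverse

variable {X : Type*} [MeasurableSpace X] {μ : Measure X}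

theorem MeasureTheory.MeasurePreserving.ae_iterate {S : X → X} (hS : MeasurePreserving S μ μ)
    {p : X → Prop} (hp : ∀ᵐ x ∂μ, p x) : ∀ᵐ x ∂μ, ∀ n, p (S^[n] x) :=
  ae_all_iff.2 fun n => (hS.iterate n).quasiMeasurePreserving.ae hp

/-- Elements of `mpPerm` are bijections everywhere, so null sets have to be repaired. Both maps
preserve the conull set of points all of whose `S`-iterates and `R`-iterates lie where `S` and `R`
invert each other. There they are mutually inverse; elsewhere the identity is used. -/
theorem exists_mpPerm_of_ae_inverse [StandardBorelSpace X] {S R : X → X}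
    (hS : MeasurePreserving S μ μ) (hR : MeasurePreserving R μ μ)
    (hRS : ∀ᵐ x ∂μ, R (S x) = x) (hSR : ∀ᵐ x ∂μ, S (R x) = x) :
    ∃ f : mpPerm μ, (f : Equiv.Perm X) =ᵐ[μ] S ∧ (f : Equiv.Perm X).symm =ᵐ[μ] R := by
  classical
  set E : Set X := {x | R (S x) = x ∧ S (R x) = x} with hE
  have hEm : MeasurableSet E :=
    (measurableSet_eq_fun (hR.measurable.comp hS.measurable) measurable_id).inter
      (measurableSet_eq_fun (hS.measurable.comp hR.measurable) measurable_id)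
  have hEae : ∀ᵐ x ∂μ, x ∈ E := by
    filter_upwards [hRS, hSR] with x h1 h2 using ⟨h1, h2⟩
  set X0 : Set X := {x | (∀ n, S^[n] x ∈ E) ∧ ∀ n, R^[n] x ∈ E} with hX0
  have hX0m : MeasurableSet X0 := by
    have : X0 = (⋂ n, S^[n] ⁻¹' E) ∩ ⋂ n, R^[n] ⁻¹' E := by ext; simp [hX0]
    rw [this]
    exact (MeasurableSet.iInter fun n => hS.measurable.iterate n hEm).inter
      (MeasurableSet.iInter fun n => hR.measurable.iterate n hEm)
  have hX0ae : ∀ᵐ x ∂μ, x ∈ X0 := by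
    filter_upwards [hS.ae_iterate hEae, hR.ae_iterate hEae] with x h1 h2 using ⟨h1, h2⟩
  have hSX : ∀ x ∈ X0, S x ∈ X0 := by
    intro x hx
    refine ⟨fun n => hx.1 (n + 1), fun n => ?_⟩
    cases n with
    | zero => exact hx.1 1
    | succ n =>
      rw [Function.iterate_succ_apply, show R (S x) = x from (hx.1 0).1]
      exact hx.2 n
  have hRX : ∀ x ∈ X0, R x ∈ X0 := by
    intro x hx
    refine ⟨fun n => ?_, fun n => hx.2 (n + 1)⟩
    cases n with
    | zero => exact hx.2 1
    | succ n =>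
      rw [Function.iterate_succ_apply, show S (R x) = x from (hx.2 0).2]
      exact hx.1 n
  let e : Equiv.Perm X :=
    { toFun := X0.piecewise S id
      invFun := X0.piecewise R id
      left_inv := fun x => by
        by_cases hx : x ∈ X0
        · simp [piecewise_eq_of_mem, hx, hSX x hx, show R (S x) = x from (hx.1 0).1]
        · simp [piecewise_eq_of_notMem, hx]
      right_inv := fun x => by
        by_cases hx : x ∈ X0
        · simp [piecewise_eq_of_mem, hx, hRX x hx, show S (R x) = x from (hx.1 0).2]
        · simp [piecewise_eq_of_notMem, hx] }
  have h1 : (e : X → X) =ᵐ[μ] S := by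
    filter_upwards [hX0ae] with x hx using piecewise_eq_of_mem _ _ _ hx
  have h2 : (e.symm : X → X) =ᵐ[μ] R := by
    filter_upwards [hX0ae] with x hx using piecewise_eq_of_mem _ _ _ hx
  have m1 : Measurable (e : X → X) := Measurable.piecewise hX0m hS.measurable measurable_id
  have m2 : Measurable (e.symm : X → X) := Measurable.piecewise hX0m hR.measurable measurable_id
  refine ⟨⟨e, ⟨m1, ?_⟩, ⟨m2, ?_⟩⟩, h1, h2⟩
  · rw [Measure.map_congr h1, hS.map_eq]
  · rw [Measure.map_congr h2, hR.map_eq]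

theorem ae_eq_of_forall_preimage_ae_eq {Y : Type*} [MeasurableSpace Y] [StandardBorelSpace X]
    {ν : Measure Y} {f g : Y → X}
    (h : ∀ A, MeasurableSet A → f ⁻¹' A =ᵐ[ν] g ⁻¹' A) : f =ᵐ[ν] g := by
  refine Filter.EventuallyEq.of_forall_separating_preimage MeasurableSet fun A hA => ?_
  exact h A hA

end AEInverse

/-! ## Pointwise realizations and the weak topology -/

section WeakTopology

variable {X : Type*} [MeasurableSpace X] {μ : Measure X}

/-- The point map of a representative of an element of `Aut(X, μ)`. -/
noncomputable def AutMeas.pt (T : AutMeas μ) : X → X := (T.rep : Equiv.Perm X)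

theorem AutMeas.measurePreserving_pt (T : AutMeas μ) : MeasurePreserving T.pt μ μ := T.rep.2.1

theorem AutMeas.pt_mk (f : mpPerm μ) : (AutMeas.mk f).pt =ᵐ[μ] (f : Equiv.Perm X) :=
  mpPerm_mk_eq_iff.1 (AutMeas.mk_rep _)

theorem AutMeas.pt_inv (T : AutMeas μ) : T⁻¹.pt =ᵐ[μ] (T.rep : Equiv.Perm X).symm := by
  have h := AutMeas.pt_mk (T.rep⁻¹)
  rwa [show AutMeas.mk T.rep⁻¹ = (AutMeas.mk T.rep)⁻¹ from rfl, T.mk_rep] at h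

theorem AutMeas.img_eq (T : AutMeas μ) (A : Set X) : T.img A =ᵐ[μ] T⁻¹.pt ⁻¹' A := by
  unfold AutMeas.img
  rw [Equiv.image_eq_preimage_symm]
  filter_upwards [T.pt_inv] with x hx
  change ((T.rep : Equiv.Perm X).symm x ∈ A) = (T⁻¹.pt x ∈ A)
  rw [hx]

theorem AutMeas.img_inv_eq (T : AutMeas μ) (A : Set X) : T⁻¹.img A =ᵐ[μ] T.pt ⁻¹' A := by
  have := T⁻¹.img_eq A
  rwa [inv_inv] at this

theorem AutMeas.pt_inv_pt (T : AutMeas μ) : ∀ᵐ x ∂μ, T⁻¹.pt (T.pt x) = x := by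
  filter_upwards [T.measurePreserving_pt.quasiMeasurePreserving.ae T.pt_inv] with x hx
  rw [hx]
  exact Equiv.symm_apply_apply _ _

theorem AutMeas.ext_of_pt {S T : AutMeas μ} (h : S.pt =ᵐ[μ] T.pt) : S = T := by
  rw [← S.mk_rep, ← T.mk_rep]
  exact mpPerm_mk_eq_iff.2 h

theorem AutMeas.isOpen_basicNhd (α : AutMeas μ) {Ω : Set (Set X)} (hΩ : Ω.Finite)
    (hm : ∀ A ∈ Ω, MeasurableSet A) {ε : ℝ} (hε : 0 < ε) : IsOpen (AutMeas.basicNhd α Ω ε) :=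
  TopologicalSpace.isOpen_generateFrom_of_mem ⟨α, Ω, ε, hΩ, hm, hε, rfl⟩

variable [IsFiniteMeasure μ]

theorem dist_indicatorConstLp_one {A B : Set X} (hA : MeasurableSet A) (hB : MeasurableSet B) :
    dist (indicatorConstLp 1 hA (measure_ne_top μ A) (1 : ℝ))
      (indicatorConstLp 1 hB (measure_ne_top μ B) (1 : ℝ)) = setDist μ A B := by
  rw [dist_indicatorConstLp_eq_norm, norm_indicatorConstLp one_ne_zero ENNReal.one_ne_top]
  simp [setDist]

/-- The indicator functions of the images of all measurable sets under an automorphism. -/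
noncomputable def AutMeas.toL1 (T : AutMeas μ) (A : {A : Set X // MeasurableSet A}) : Lp ℝ 1 μ :=
  indicatorConstLp 1 (T.measurableSet_img A.2) (measure_ne_top μ _) (1 : ℝ)

theorem AutMeas.dist_toL1 (S T : AutMeas μ) (A : {A : Set X // MeasurableSet A}) :
    dist (S.toL1 A) (T.toL1 A) = setDist μ (S.img A) (T.img A) :=
  dist_indicatorConstLp_one _ _

/-- Since `μ (A ∆ B)` is the `L¹`-distance of indicators, the weak topology is pointwise
convergence, over all measurable sets, in a metric space. Continuity questions then reduce to the
criterion `AutMeas.tendsto_iff`. -/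
theorem AutMeas.isInducing_toL1 : Topology.IsInducing (AutMeas.toL1 (μ := μ)) := by
  refine ⟨le_antisymm ?_ ?_⟩
  · rw [← continuous_iff_le_induced]
    refine continuous_pi fun A => continuous_iff_continuousAt.2 fun α => ?_
    refine Metric.tendsto_nhds.2 fun ε hε => ?_
    refine Filter.mem_of_superset ((AutMeas.isOpen_basicNhd α (finite_singleton A.1)
      (by simpa using A.2) hε).mem_nhds ?_) ?_
    · intro B _
      rw [AutMeas.imageDist_eq, setDist_self]
      exact hε
    · intro β hβ
      have := hβ A rfl
      rwa [AutMeas.imageDist_eq, ← AutMeas.dist_toL1] at this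
  · refine le_generateFrom ?_
    rintro _ ⟨α, Ω, ε, hΩ, hm, hε, rfl⟩
    let _ := TopologicalSpace.induced (AutMeas.toL1 (μ := μ)) inferInstance
    have hc : Continuous (AutMeas.toL1 (μ := μ)) := continuous_induced_dom
    have : AutMeas.basicNhd α Ω ε =
        ⋂ A ∈ hΩ.toFinset.attach, {β | dist (β.toL1 ⟨A.1, hm _ (hΩ.mem_toFinset.1 A.2)⟩)
          (α.toL1 ⟨A.1, hm _ (hΩ.mem_toFinset.1 A.2)⟩) < ε} := by
      ext β
      simp [AutMeas.basicNhd, AutMeas.dist_toL1, AutMeas.imageDist_eq]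
    rw [this]
    refine isOpen_biInter_finset fun A _ => ?_
    exact isOpen_lt (((continuous_apply _).comp hc).dist continuous_const) continuous_const

theorem AutMeas.tendsto_iff {ι : Type*} {l : Filter ι} {F : ι → AutMeas μ} {T : AutMeas μ} :
    Filter.Tendsto F l (𝓝 T) ↔ ∀ A, MeasurableSet A →
      Filter.Tendsto (fun i => setDist μ ((F i).img A) (T.img A)) l (𝓝 0) := by
  rw [AutMeas.isInducing_toL1.tendsto_nhds_iff, tendsto_pi_nhds]
  simp only [Subtype.forall]
  refine forall₂_congr fun A hA => ?_
  rw [tendsto_iff_dist_tendsto_zero]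
  simp [AutMeas.dist_toL1]

instance AutMeas.instIsTopologicalGroup : IsTopologicalGroup (AutMeas μ) where
  continuous_mul := by
    refine continuous_iff_continuousAt.2 fun ⟨S, T⟩ => AutMeas.tendsto_iff.2 fun A hA => ?_
    have h1 := AutMeas.tendsto_iff.1 (continuous_fst.tendsto (S, T)) _ (T.measurableSet_img hA)
    have h2 := AutMeas.tendsto_iff.1 (continuous_snd.tendsto (S, T)) _ hA
    have h := h2.add h1
    rw [add_zero] at h
    refine squeeze_zero (fun _ => setDist_nonneg _ _) (fun p => ?_) h
    rw [setDist_congr (AutMeas.img_mul p.1 p.2 A) (AutMeas.img_mul S T A)]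
    refine (setDist_triangle _ (p.1.img (T.img A)) _).trans_eq ?_
    rw [p.1.setDist_img (p.2.measurableSet_img hA) (T.measurableSet_img hA)]
  continuous_inv := by
    refine continuous_iff_continuousAt.2 fun S => AutMeas.tendsto_iff.2 fun A hA => ?_
    -- Applying `T` turns the distance of `T⁻¹(A)` and `S⁻¹(A)` into that of `A = S(S⁻¹(A))` and
    -- `T(S⁻¹(A))`, so `S⁻¹(A)` is the test set.
    have h1 := AutMeas.tendsto_iff.1 (Filter.tendsto_id (x := 𝓝 S)) _ (S⁻¹.measurableSet_img hA)
    refine h1.congr fun T => ?_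
    change setDist μ (T.img (S⁻¹.img A)) (S.img (S⁻¹.img A)) = setDist μ (T⁻¹.img A) (S⁻¹.img A)
    rw [setDist_congr_right (S.img_img_inv A), T.setDist_img_left (S⁻¹.measurableSet_img hA) hA,
      setDist_comm]

theorem AutMeas.continuous_setDist_img {Y : Type*} [TopologicalSpace Y] {F G : Y → AutMeas μ}
    (hF : Continuous F) (hG : Continuous G) {A B : Set X} (hA : MeasurableSet A)
    (hB : MeasurableSet B) : Continuous fun y => setDist μ ((F y).img A) ((G y).img B) := by
  have h1 : Continuous fun y => (F y).toL1 ⟨A, hA⟩ :=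
    (continuous_apply (⟨A, hA⟩ : {A : Set X // MeasurableSet A})).comp
      (AutMeas.isInducing_toL1.continuous.comp hF)
  have h2 : Continuous fun y => (G y).toL1 ⟨B, hB⟩ :=
    (continuous_apply (⟨B, hB⟩ : {A : Set X // MeasurableSet A})).comp
      (AutMeas.isInducing_toL1.continuous.comp hG)
  refine (h1.dist h2).congr fun y => dist_indicatorConstLp_one _ _

end WeakTopology

/-! ## `Aut(X, μ)` is Polish -/

section PolishAut

variable {X : Type*} [MeasurableSpace X] {μ : Measure X}

theorem setDist_eq_integral {A B : Set X} (hA : MeasurableSet A) (hB : MeasurableSet B) :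
    setDist μ A B = ∫ x, |A.indicator (1 : X → ℝ) x - B.indicator (1 : X → ℝ) x| ∂μ := by
  rw [setDist, ← integral_indicator_one (hA.symmDiff hB)]
  congr 1 with x
  by_cases h1 : x ∈ A <;> by_cases h2 : x ∈ B <;> simp [h1, h2, mem_symmDiff]

variable [IsProbabilityMeasure μ] (e : X ≃ᵐ unitInterval)

theorem integrable_indicator_one {A : Set X} (hA : MeasurableSet A) :
    Integrable (A.indicator (1 : X → ℝ)) μ :=
  (integrable_const (1 : ℝ)).indicator hA

theorem measurable_coe_equiv : Measurable fun x => (e x : ℝ) :=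
  measurable_subtype_coe.comp e.measurable

theorem abs_sub_coe_le_one (a b : unitInterval) : |(a : ℝ) - b| ≤ 1 := by
  have := a.2.1; have := a.2.2; have := b.2.1; have := b.2.2
  rw [abs_le]; constructor <;> linarith

theorem integrable_abs_coe_sub {F R : X → X} (hF : Measurable F) (hR : Measurable R) :
    Integrable (fun x => |(e (F x) : ℝ) - e (R x)|) μ := by
  refine Integrable.of_bound (((measurable_coe_equiv e).comp hF).sub
    ((measurable_coe_equiv e).comp hR)).abs.aestronglyMeasurable 1 (ae_of_all _ fun x => ?_)
  simpa using abs_sub_coe_le_one (e (F x)) (e (R x))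

/-- Uniform continuity handles close points, boundedness distant ones. The linear form of the bound
lets it be integrated. -/
theorem exists_abs_sub_le_add_mul {g : unitInterval → ℝ} (hg : Continuous g) {ε : ℝ} (hε : 0 < ε) :
    ∃ C : ℝ, ∀ x y : unitInterval, |g x - g y| ≤ ε + C * |(x : ℝ) - y| := by
  obtain ⟨M, hM⟩ := isCompact_univ.exists_bound_of_continuousOn hg.continuousOn
  obtain ⟨δ, hδ, h⟩ := Metric.uniformContinuous_iff.1
    (CompactSpace.uniformContinuous_of_continuous hg) ε hε
  have hM0 : 0 ≤ M := (norm_nonneg _).trans (hM 0 (mem_univ _))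
  refine ⟨2 * M / δ, fun x y => ?_⟩
  by_cases hxy : dist x y < δ
  · have := (h hxy).le
    rw [Real.dist_eq] at this
    have h0 : 0 ≤ 2 * M / δ * |(x : ℝ) - y| := by positivity
    linarith
  · have h1 := hM x (mem_univ _)
    have h2 := hM y (mem_univ _)
    rw [Real.norm_eq_abs] at h1 h2
    have h3 : |g x - g y| ≤ 2 * M := by
      have := abs_sub (g x) (g y)
      linarith
    rw [not_lt, Subtype.dist_eq, Real.dist_eq] at hxy
    have h4 : 2 * M ≤ 2 * M / δ * |(x : ℝ) - y| := by
      rw [div_mul_eq_mul_div, le_div_iff₀ hδ]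
      gcongr
    linarith

/-- One `g` serves all `F`: measure-preserving maps have the same distribution, so the error is a
single integral against `μ.map e`, made small by density of continuous functions in `L¹`. -/
theorem exists_continuous_integral_sub_le {A : Set X} (hA : MeasurableSet A) {ε : ℝ} (hε : 0 < ε) :
    ∃ g : unitInterval → ℝ, Continuous g ∧ ∀ F : X → X, MeasurePreserving F μ μ →
      Integrable (fun x => |A.indicator (1 : X → ℝ) (F x) - g (e (F x))|) μ ∧
      ∫ x, |A.indicator (1 : X → ℝ) (F x) - g (e (F x))| ∂μ ≤ ε := by
  have : IsProbabilityMeasure (μ.map e) := Measure.isProbabilityMeasure_map e.measurable.aemeasurable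
  have hf : Integrable (fun y => A.indicator (1 : X → ℝ) (e.symm y)) (μ.map e) := by
    refine Integrable.of_bound
      ((measurable_one.indicator hA).comp e.symm.measurable).aestronglyMeasurable 1
      (ae_of_all _ fun x => ?_)
    by_cases h : e.symm x ∈ A <;> simp [h]
  obtain ⟨g, -, hg1, hg2, hg3⟩ := hf.exists_hasCompactSupport_integral_sub_le hε
  refine ⟨g, hg2, fun F hF => ?_⟩
  have hmp : MeasurePreserving (fun x => e (F x)) μ (μ.map e) :=
    (MeasurePreserving.mk e.measurable rfl).comp hF
  have hint := (hf.sub hg3).norm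
  have key : ∀ x, |A.indicator (1 : X → ℝ) (F x) - g (e (F x))| =
      ‖A.indicator (1 : X → ℝ) (e.symm (e (F x))) - g (e (F x))‖ := fun x => by simp
  constructor
  · refine (hmp.integrable_comp_of_integrable hint).congr (ae_of_all _ fun x => (key x).symm)
  · calc _ = ∫ x, ‖A.indicator (1 : X → ℝ) (e.symm (e (F x))) - g (e (F x))‖ ∂μ := by
          simp_rw [key]
      _ = _ := by
          conv_rhs => rw [← hmp.map_eq]
          rw [integral_map hmp.measurable.aemeasurable
            (by rw [hmp.map_eq]; exact hint.aestronglyMeasurable)]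
      _ ≤ ε := hg1

theorem tendsto_setDist_preimage_of_tendsto_integral {ι : Type*} {l : Filter ι} {F : ι → X → X}
    {R : X → X} (hF : ∀ i, MeasurePreserving (F i) μ μ) (hR : MeasurePreserving R μ μ)
    (h : Filter.Tendsto (fun i => ∫ x, |(e (F i x) : ℝ) - e (R x)| ∂μ) l (𝓝 0)) {A : Set X}
    (hA : MeasurableSet A) :
    Filter.Tendsto (fun i => setDist μ (F i ⁻¹' A) (R ⁻¹' A)) l (𝓝 0) := by
  rw [Metric.tendsto_nhds]
  intro ε hε
  obtain ⟨g, hg, hg'⟩ := exists_continuous_integral_sub_le e (μ := μ) hA (ε := ε / 4) (by positivity)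
  obtain ⟨C, hC⟩ := exists_abs_sub_le_add_mul hg (ε := ε / 8) (by positivity)
  have h1 : Filter.Tendsto (fun i => C * ∫ x, |(e (F i x) : ℝ) - e (R x)| ∂μ) l (𝓝 0) := by
    simpa using h.const_mul C
  filter_upwards [h1.eventually (gt_mem_nhds (show 0 < ε / 8 by positivity))] with i hi
  rw [Real.dist_eq, sub_zero, abs_of_nonneg (setDist_nonneg _ _),
    setDist_eq_integral ((hF i).measurable hA) (hR.measurable hA)]
  obtain ⟨i1, b1⟩ := hg' (F i) (hF i)
  obtain ⟨i2, b2⟩ := hg' R hR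
  have i3 := integrable_abs_coe_sub e (μ := μ) (hF i).measurable hR.measurable
  calc _ ≤ ∫ x, ((|A.indicator (1 : X → ℝ) (F i x) - g (e (F i x))| +
        |A.indicator (1 : X → ℝ) (R x) - g (e (R x))|) +
        (ε / 8 + C * |(e (F i x) : ℝ) - e (R x)|)) ∂μ := by
        refine integral_mono_of_nonneg (ae_of_all _ fun x => abs_nonneg _)
          ((i1.add i2).add ((integrable_const _).add (i3.const_mul C))) (ae_of_all _ fun x => ?_)
        have h2 := hC (e (F i x)) (e (R x))
        change |A.indicator (1 : X → ℝ) (F i x) - A.indicator (1 : X → ℝ) (R x)| ≤ _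
        have h3 := abs_sub_le (A.indicator (1 : X → ℝ) (F i x)) (g (e (F i x)))
          (A.indicator (1 : X → ℝ) (R x))
        have h4 := abs_sub_le (g (e (F i x))) (g (e (R x))) (A.indicator (1 : X → ℝ) (R x))
        rw [abs_sub_comm (g (e (R x)))] at h4
        linarith
    _ = _ := integral_add (i1.add i2) ((integrable_const _).add (i3.const_mul C))
    _ < ε := by
        rw [integral_add i1 i2, integral_add (integrable_const _) (i3.const_mul C),
          integral_const_mul]
        simp only [integral_const, probReal_univ, one_smul]
        linarith

/-- Cut the interval into cells of length `1 / n`. Points in a common cell are within `1 / n`;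
otherwise the cell of `F x` contributes `1` to the sum. There are `n + 1` cells because the endpoint
`1` has floor `n`. -/
theorem integral_abs_sub_le_sum_setDist {F R : X → X} (hF : Measurable F) (hR : Measurable R)
    {n : ℕ} (hn : 0 < n) :
    ∫ x, |(e (F x) : ℝ) - e (R x)| ∂μ ≤ 1 / n + ∑ i ∈ Finset.range (n + 1),
      setDist μ (F ⁻¹' {x | ⌊n * (e x : ℝ)⌋₊ = i}) (R ⁻¹' {x | ⌊n * (e x : ℝ)⌋₊ = i}) := by
  have hn' : (0 : ℝ) < n := by exact_mod_cast hn
  have hm : ∀ i : ℕ, MeasurableSet {x | ⌊n * (e x : ℝ)⌋₊ = i} := fun i =>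
    (Nat.measurable_floor.comp ((measurable_coe_equiv e).const_mul _)) (measurableSet_singleton i)
  set A : ℕ → Set X := fun i => {x | ⌊n * (e x : ℝ)⌋₊ = i} with hAdef
  have hi : ∀ i, Integrable (fun x => |(F ⁻¹' A i).indicator (1 : X → ℝ) x -
      (R ⁻¹' A i).indicator (1 : X → ℝ) x|) μ := fun i =>
    ((integrable_indicator_one (hF (hm i))).sub (integrable_indicator_one (hR (hm i)))).abs
  calc _ ≤ ∫ x, (1 / n + ∑ i ∈ Finset.range (n + 1), |(F ⁻¹' A i).indicator (1 : X → ℝ) x -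
      (R ⁻¹' A i).indicator (1 : X → ℝ) x|) ∂μ := by
        refine integral_mono (integrable_abs_coe_sub e hF hR)
          ((integrable_const _).add (integrable_finsetSum _ fun i _ => hi i)) fun x => ?_
        by_cases hx : ⌊n * (e (F x) : ℝ)⌋₊ = ⌊n * (e (R x) : ℝ)⌋₊
        · refine le_add_of_le_of_nonneg ?_ (Finset.sum_nonneg fun _ _ => abs_nonneg _)
          have a1 := Nat.floor_le (show 0 ≤ n * (e (F x) : ℝ) from
            mul_nonneg hn'.le (e (F x)).2.1)
          have a2 := Nat.lt_floor_add_one (n * (e (F x) : ℝ))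
          have b1 := Nat.floor_le (show 0 ≤ n * (e (R x) : ℝ) from
            mul_nonneg hn'.le (e (R x)).2.1)
          have b2 := Nat.lt_floor_add_one (n * (e (R x) : ℝ))
          rw [hx] at a1 a2
          rw [abs_le, neg_le, le_div_iff₀ hn', le_div_iff₀ hn']
          constructor <;> linarith
        · have h0 : (0 : ℝ) ≤ 1 / n := by positivity
          refine (abs_sub_coe_le_one _ _).trans (le_add_of_nonneg_of_le h0 ?_)
          have hmem : ⌊n * (e (F x) : ℝ)⌋₊ ∈ Finset.range (n + 1) := by
            rw [Finset.mem_range, Nat.lt_succ_iff]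
            refine Nat.floor_le_of_le ?_
            have := (e (F x)).2.2
            nlinarith
          refine le_trans ?_ (Finset.single_le_sum (fun _ _ => abs_nonneg _) hmem)
          have h1 : x ∈ F ⁻¹' A ⌊n * (e (F x) : ℝ)⌋₊ := rfl
          have h2 : x ∉ R ⁻¹' A ⌊n * (e (F x) : ℝ)⌋₊ := fun h => hx h.symm
          simp only [indicator_of_mem h1, indicator_of_notMem h2]
          simp
    _ = _ := by
        rw [integral_add (integrable_const _) (integrable_finsetSum _ fun i _ => hi i),
          integral_finsetSum _ fun i _ => hi i]
        simp only [integral_const, probReal_univ, one_smul]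
        congr 1
        exact Finset.sum_congr rfl fun i _ => (setDist_eq_integral (hF (hm i)) (hR (hm i))).symm

theorem tendsto_integral_of_tendsto_setDist_preimage {ι : Type*} {l : Filter ι} {F : ι → X → X}
    {R : X → X} (hF : ∀ i, Measurable (F i)) (hR : Measurable R)
    (h : ∀ A, MeasurableSet A →
      Filter.Tendsto (fun i => setDist μ (F i ⁻¹' A) (R ⁻¹' A)) l (𝓝 0)) :
    Filter.Tendsto (fun i => ∫ x, |(e (F i x) : ℝ) - e (R x)| ∂μ) l (𝓝 0) := by
  rw [Metric.tendsto_nhds]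
  intro ε hε
  obtain ⟨n, hn⟩ := exists_nat_one_div_lt (half_pos hε)
  have hm : ∀ i : ℕ, MeasurableSet {x | ⌊((n + 1 : ℕ) : ℝ) * (e x : ℝ)⌋₊ = i} := fun i =>
    (Nat.measurable_floor.comp ((measurable_coe_equiv e).const_mul _)) (measurableSet_singleton i)
  have h1 := tendsto_finsetSum (Finset.range (n + 1 + 1)) fun i _ => h _ (hm i)
  rw [Finset.sum_const_zero] at h1
  filter_upwards [h1.eventually (gt_mem_nhds (half_pos hε))] with i hi
  rw [Real.dist_eq, sub_zero, abs_of_nonneg (integral_nonneg fun _ => abs_nonneg _)]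
  refine (integral_abs_sub_le_sum_setDist e (hF i) hR n.succ_pos).trans_lt ?_
  push_cast at hi ⊢
  linarith

theorem tendsto_nhds_iff_integral {ι : Type*} {l : Filter ι} {F : ι → AutMeas μ} {T : AutMeas μ} :
    Filter.Tendsto F l (𝓝 T) ↔
      Filter.Tendsto (fun i => ∫ x, |(e ((F i).pt x) : ℝ) - e (T.pt x)| ∂μ) l (𝓝 0) := by
  have key : Filter.Tendsto F l (𝓝 T) ↔ ∀ A, MeasurableSet A →
      Filter.Tendsto (fun i => setDist μ ((F i).pt ⁻¹' A) (T.pt ⁻¹' A)) l (𝓝 0) := by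
    -- The topology is defined by images, which are preimages under the inverse; continuity of
    -- inversion permits the switch.
    have : Filter.Tendsto F l (𝓝 T) ↔ Filter.Tendsto (fun i => (F i)⁻¹) l (𝓝 T⁻¹) :=
      ⟨fun h => h.inv, fun h => by simpa using h.inv⟩
    rw [this, AutMeas.tendsto_iff]
    refine forall₂_congr fun A hA => ?_
    simp only [setDist_congr (AutMeas.img_inv_eq _ A) (AutMeas.img_inv_eq _ A)]
  rw [key]
  exact ⟨fun h => tendsto_integral_of_tendsto_setDist_preimage e
    (fun i => (F i).measurePreserving_pt.measurable) T.measurePreserving_pt.measurable h,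
    fun h A hA => tendsto_setDist_preimage_of_tendsto_integral e
      (fun i => (F i).measurePreserving_pt) T.measurePreserving_pt h hA⟩

end PolishAut

/-! ### `Aut(X, μ)` as a closed subset of a product of two `L¹` spaces -/

section PolishAut

variable {X : Type*} [MeasurableSpace X] {μ : Measure X} [IsProbabilityMeasure μ]
  (e : X ≃ᵐ unitInterval)

theorem integrable_coe_comp {F : X → X} (hF : Measurable F) :
    Integrable (fun x => (e (F x) : ℝ)) μ := by
  refine Integrable.of_bound ((measurable_coe_equiv e).comp hF).aestronglyMeasurable 1
    (ae_of_all _ fun x => ?_)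
  rw [Real.norm_of_nonneg (e (F x)).2.1]
  exact (e (F x)).2.2

/-- Along a subsequence the convergence holds almost everywhere, so the limit takes values in `[0,
1]`. By dominated convergence against continuous functions it has the common distribution of the `e
∘ F k`, which is what makes `R` measure-preserving. -/
theorem exists_measurePreserving_of_tendsto {F : ℕ → X → X}
    (hF : ∀ k, MeasurePreserving (F k) μ μ) {f : Lp ℝ 1 μ}
    (h : Filter.Tendsto (fun k => (integrable_coe_comp e (hF k).measurable).toL1 _)
      Filter.atTop (𝓝 f)) :
    ∃ R : X → X, MeasurePreserving R μ μ ∧ f =ᵐ[μ] fun x => (e (R x) : ℝ) := by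
  obtain ⟨ns, hns, hae⟩ := (tendstoInMeasure_of_tendsto_Lp h).exists_seq_tendsto_ae
  have hae' : ∀ᵐ x ∂μ, Filter.Tendsto (fun i => (e (F (ns i) x) : ℝ)) Filter.atTop (𝓝 (f x)) := by
    have h1 : ∀ᵐ x ∂μ, ∀ k, (integrable_coe_comp e (hF k).measurable).toL1 _ x = (e (F k x) : ℝ) :=
      ae_all_iff.2 fun k => Integrable.coeFn_toL1 (integrable_coe_comp e (hF k).measurable)
    filter_upwards [h1, hae] with x h2 h3
    simpa only [h2] using h3
  have hf : Measurable (f : X → ℝ) := (Lp.stronglyMeasurable f).measurable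
  -- Clamping alters `f` only on a null set and makes it land in the unit interval everywhere, so
  -- that `e.symm` applies.
  set r : X → unitInterval := fun x => projIcc (0 : ℝ) 1 zero_le_one (f x) with hr
  have hrm : Measurable r := continuous_projIcc.measurable.comp hf
  have hrf : ∀ᵐ x ∂μ, f x = r x := by
    filter_upwards [hae'] with x hx
    have hx01 : f x ∈ Icc (0 : ℝ) 1 :=
      isClosed_Icc.mem_of_tendsto hx (Filter.Eventually.of_forall fun i => (e (F (ns i) x)).2)
    simp [hr, projIcc_of_mem zero_le_one hx01]
  have hlim : ∀ᵐ x ∂μ, Filter.Tendsto (fun i => e (F (ns i) x)) Filter.atTop (𝓝 (r x)) := by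
    filter_upwards [hae', hrf] with x h1 h2
    rw [tendsto_subtype_rng]
    rwa [← h2]
  have h1 : IsProbabilityMeasure (μ.map e) :=
    Measure.isProbabilityMeasure_map e.measurable.aemeasurable
  have h2 : IsProbabilityMeasure (μ.map r) := Measure.isProbabilityMeasure_map hrm.aemeasurable
  have hmap : μ.map r = μ.map e := by
    refine ext_of_forall_integral_eq_of_IsFiniteMeasure fun g => ?_
    rw [integral_map hrm.aemeasurable g.continuous.aestronglyMeasurable,
      integral_map e.measurable.aemeasurable g.continuous.aestronglyMeasurable]
    have hc : ∀ i, ∫ x, g (e (F (ns i) x)) ∂μ = ∫ x, g (e x) ∂μ := fun i => by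
      conv_rhs => rw [← (hF (ns i)).map_eq]
      rw [integral_map (hF (ns i)).measurable.aemeasurable]
      exact (g.continuous.measurable.comp e.measurable).aestronglyMeasurable
    have ht : Filter.Tendsto (fun i => ∫ x, g (e (F (ns i) x)) ∂μ) Filter.atTop
        (𝓝 (∫ x, g (r x) ∂μ)) := by
      refine tendsto_integral_of_dominated_convergence (fun _ => ‖g‖)
        (fun i => (g.continuous.measurable.comp
          (e.measurable.comp (hF (ns i)).measurable)).aestronglyMeasurable)
        (integrable_const _) (fun i => ae_of_all _ fun x => g.norm_coe_le_norm _) ?_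
      filter_upwards [hlim] with x hx using (g.continuous.tendsto _).comp hx
    simp only [hc] at ht
    exact tendsto_nhds_unique ht tendsto_const_nhds |>.symm ▸ rfl
  refine ⟨fun x => e.symm (r x), ⟨e.symm.measurable.comp hrm, ?_⟩, ?_⟩
  · change μ.map (e.symm ∘ r) = μ
    rw [← Measure.map_map e.symm.measurable hrm, hmap, Measure.map_map e.symm.measurable e.measurable]
    simp
  · filter_upwards [hrf] with x hx
    simp [hx]

/-- The point map of an automorphism, read in the unit interval, as an element of `L¹`. -/
noncomputable def AutMeas.ptL1 (T : AutMeas μ) : Lp ℝ 1 μ :=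
  (integrable_coe_comp e T.measurePreserving_pt.measurable).toL1 _

theorem dist_toL1_coe_comp {F R : X → X} (hF : Measurable F) (hR : Measurable R) :
    dist ((integrable_coe_comp e (μ := μ) hF).toL1 _) ((integrable_coe_comp e hR).toL1 _) =
      ∫ x, |(e (F x) : ℝ) - e (R x)| ∂μ := by
  rw [dist_eq_norm, ← Integrable.toL1_sub, L1.norm_of_fun_eq_integral_norm]
  rfl

theorem AutMeas.isInducing_ptL1 : Topology.IsInducing (AutMeas.ptL1 (μ := μ) e) := by
  have key : ∀ {l : Filter (AutMeas μ)} {T : AutMeas μ}, l ≤ 𝓝 T ↔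
      l ≤ Filter.comap (AutMeas.ptL1 e) (𝓝 (AutMeas.ptL1 e T)) := by
    intro l T
    rw [← Filter.map_le_iff_le_comap]
    have h := tendsto_nhds_iff_integral e (l := l) (F := id) (T := T)
    rw [Filter.tendsto_id'] at h
    rw [h]
    change _ ↔ Filter.Tendsto (AutMeas.ptL1 e) l _
    rw [tendsto_iff_dist_tendsto_zero (f := AutMeas.ptL1 e)]
    refine Filter.tendsto_congr fun S => ?_
    exact (dist_toL1_coe_comp e S.measurePreserving_pt.measurable
      T.measurePreserving_pt.measurable).symm
  refine Topology.isInducing_iff_nhds.2 fun T => le_antisymm (key.1 le_rfl) (key.2 le_rfl)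

theorem AutMeas.ptL1_injective : Function.Injective (AutMeas.ptL1 (μ := μ) e) := by
  intro S T h
  refine AutMeas.ext_of_pt ?_
  filter_upwards [(Integrable.toL1_eq_toL1_iff _ _ _ _).1 h] with x hx
  exact e.injective (Subtype.coe_injective hx)

theorem AutMeas.ptL1_mk {f : mpPerm μ} {g : Lp ℝ 1 μ} {R : X → X}
    (hf : (f : Equiv.Perm X) =ᵐ[μ] R) (hg : g =ᵐ[μ] fun x => (e (R x) : ℝ)) :
    AutMeas.ptL1 e (AutMeas.mk f) = g := by
  refine Lp.ext ?_
  filter_upwards [Integrable.coeFn_toL1 (integrable_coe_comp e (μ := μ)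
    (AutMeas.mk f).measurePreserving_pt.measurable), AutMeas.pt_mk f, hf, hg] with x h1 h2 h3 h4
  rw [h4, ← h3, ← h2]
  exact h1

/-- Automorphisms alone may converge in `L¹` to a non-invertible measure-preserving map, hence the
second coordinate. If `T k` tends to `R` and `(T k)⁻¹` to `S`, then the preimages of any set under
`S ∘ R` and under `(T k)⁻¹ ∘ T k = id` become arbitrarily close, so `S` inverts `R` almost
everywhere; symmetrically `R` inverts `S`. -/
theorem AutMeas.isClosedEmbedding_ptL1_prod [StandardBorelSpace X] :
    Topology.IsClosedEmbedding
      (fun T : AutMeas μ => (AutMeas.ptL1 e T, AutMeas.ptL1 e T⁻¹)) := by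
  have hc := (AutMeas.isInducing_ptL1 (μ := μ) e).continuous
  refine ⟨⟨⟨?_⟩, fun S T h => AutMeas.ptL1_injective e (congrArg Prod.fst h)⟩, ?_⟩
  · refine le_antisymm (continuous_iff_le_induced.1 (hc.prodMk (hc.comp continuous_inv))) ?_
    conv_rhs => rw [(AutMeas.isInducing_ptL1 (μ := μ) e).eq_induced]
    let _ := TopologicalSpace.induced
      (fun T : AutMeas μ => (AutMeas.ptL1 e T, AutMeas.ptL1 e T⁻¹)) inferInstance
    exact continuous_iff_le_induced.1 (continuous_fst.comp (continuous_induced_dom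
      (f := fun T : AutMeas μ => (AutMeas.ptL1 e T, AutMeas.ptL1 e T⁻¹))))
  · refine isClosed_of_closure_subset fun ⟨f, g⟩ hfg => ?_
    obtain ⟨u, hu, hlim⟩ := mem_closure_iff_seq_limit.1 hfg
    choose T hT using hu
    have hlf : Filter.Tendsto (fun k => AutMeas.ptL1 e (T k)) Filter.atTop (𝓝 f) := by
      have := (continuous_fst.tendsto _).comp hlim
      refine this.congr fun k => ?_
      simp [← hT k]
    have hlg : Filter.Tendsto (fun k => AutMeas.ptL1 e (T k)⁻¹) Filter.atTop (𝓝 g) := by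
      have := (continuous_snd.tendsto _).comp hlim
      refine this.congr fun k => ?_
      simp [← hT k]
    obtain ⟨R, hR, hRf⟩ := exists_measurePreserving_of_tendsto e
      (fun k => (T k).measurePreserving_pt) hlf
    obtain ⟨S, hS, hSg⟩ := exists_measurePreserving_of_tendsto e
      (fun k => (T k)⁻¹.measurePreserving_pt) hlg
    have aux : ∀ {U : ℕ → AutMeas μ} {Q : X → X} {q : Lp ℝ 1 μ}, MeasurePreserving Q μ μ →
        q =ᵐ[μ] (fun x => (e (Q x) : ℝ)) →
        Filter.Tendsto (fun k => AutMeas.ptL1 e (U k)) Filter.atTop (𝓝 q) →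
        ∀ A, MeasurableSet A → Filter.Tendsto (fun k => setDist μ ((U k).pt ⁻¹' A) (Q ⁻¹' A))
          Filter.atTop (𝓝 0) := by
      intro U Q q hQ hq hU A hA
      refine tendsto_setDist_preimage_of_tendsto_integral e
        (fun k => (U k).measurePreserving_pt) hQ ?_ hA
      have hq' : q = (integrable_coe_comp e (μ := μ) hQ.measurable).toL1 _ := by
        refine Lp.ext (hq.trans ?_)
        exact (Integrable.coeFn_toL1 _).symm
      rw [hq', tendsto_iff_dist_tendsto_zero] at hU
      exact hU.congr fun k =>
        dist_toL1_coe_comp e (U k).measurePreserving_pt.measurable hQ.measurable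
    have comp_id : ∀ {U : ℕ → AutMeas μ} {Q P : X → X}, MeasurePreserving Q μ μ →
        MeasurePreserving P μ μ →
        (∀ A, MeasurableSet A → Filter.Tendsto (fun k => setDist μ ((U k).pt ⁻¹' A) (Q ⁻¹' A))
          Filter.atTop (𝓝 0)) →
        (∀ A, MeasurableSet A → Filter.Tendsto (fun k => setDist μ ((U k)⁻¹.pt ⁻¹' A) (P ⁻¹' A))
          Filter.atTop (𝓝 0)) → ∀ᵐ x ∂μ, P (Q x) = x := by
      intro U Q P hQ hP h1 h2
      refine ae_eq_of_forall_preimage_ae_eq (g := id) (f := P ∘ Q) fun A hA => ?_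
      refine (setDist_eq_zero_iff (μ := μ)).1 (le_antisymm ?_ (setDist_nonneg _ _))
      have h3 := (h2 A hA).add (h1 _ (hP.measurable hA))
      rw [add_zero] at h3
      refine ge_of_tendsto' h3 fun k => ?_
      have hU := (U k).measurePreserving_pt
      have hU' := (U k)⁻¹.measurePreserving_pt
      have h4 : (U k).pt ⁻¹' ((U k)⁻¹.pt ⁻¹' A) =ᵐ[μ] A := by
        filter_upwards [(U k).pt_inv_pt] with x hx
        change ((U k)⁻¹.pt ((U k).pt x) ∈ A) = (x ∈ A)
        rw [hx]
      rw [preimage_comp, preimage_id, ← setDist_congr_right h4,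
        ← setDist_preimage hU (hU'.measurable hA) (hP.measurable hA)]
      refine (setDist_triangle _ ((U k).pt ⁻¹' (P ⁻¹' A)) _).trans_eq ?_
      rw [add_comm, setDist_comm (Q ⁻¹' _)]
      congr 1
      exact setDist_comm _ _
    have hf1 := aux hR hRf hlf
    have hg1 := aux hS hSg hlg
    have hSR : ∀ᵐ x ∂μ, S (R x) = x := comp_id hR hS hf1 hg1
    have hRS : ∀ᵐ x ∂μ, R (S x) = x := comp_id (U := fun k => (T k)⁻¹) hS hR hg1
      (by simpa using hf1)
    obtain ⟨φ, h1, h2⟩ := exists_mpPerm_of_ae_inverse hR hS hSR hRS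
    exact ⟨AutMeas.mk φ, Prod.ext (AutMeas.ptL1_mk e h1 hRf)
      (AutMeas.ptL1_mk e (f := φ⁻¹) h2 hSg)⟩

theorem nonempty_measurableEquiv_unitInterval [StandardBorelSpace X] (μ : Measure X)
    [IsProbabilityMeasure μ] [NullSingletonClass μ] : Nonempty (X ≃ᵐ unitInterval) := by
  refine ⟨PolishSpace.measurableEquivOfNotCountable (fun h => ?_) ?_⟩
  · have h1 : μ univ = 0 := countable_univ.measure_zero μ
    simp at h1
  · intro h
    have := (Set.countable_coe_iff.1 h)
    exact (Cardinal.Real.Icc_countable_iff.1 this).not_gt zero_lt_one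

theorem AutMeas.polishSpace [StandardBorelSpace X] [NullSingletonClass μ] :
    PolishSpace (AutMeas μ) := by
  obtain ⟨e⟩ := nonempty_measurableEquiv_unitInterval μ
  have : Fact ((1 : ENNReal) ≠ ⊤) := ⟨ENNReal.one_ne_top⟩
  have : SecondCountableTopology (Lp ℝ 1 μ) := inferInstance
  have : PolishSpace (Lp ℝ 1 μ) := inferInstance
  exact (AutMeas.isClosedEmbedding_ptL1_prod (μ := μ) e).polishSpace

end PolishAut

/-! ## The space of measure-preserving actions is Polish -/

theorem ContinuousMap.polishSpace {G Y : Type*} [TopologicalSpace G] [LocallyCompactSpace G]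
    [TopologicalSpace Y] [PolishSpace Y] [SecondCountableTopology G] : PolishSpace C(G, Y) := by
  let _ := TopologicalSpace.upgradeIsCompletelyMetrizable Y
  infer_instance

section PolishAct

variable {G : Type*} [Group G] [TopologicalSpace G] {X : Type*} [MeasurableSpace X]
  {μ : Measure X}

/-- An action as a continuous map into `Aut(X, μ)`. -/
def MPAct.toCM (α : MPAct G μ) : C(G, AutMeas μ) := ⟨α, α.continuous_toFun⟩

theorem MPAct.continuous_coe (α : MPAct G μ) : Continuous (α : G → AutMeas μ) := α.continuous_toFun

theorem MPAct.map_mul (α : MPAct G μ) (s t : G) : α (s * t) = α s * α t :=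
  α.toMonoidHom.map_mul s t

theorem MPAct.map_one (α : MPAct G μ) : α 1 = 1 := α.toMonoidHom.map_one

theorem MPAct.map_inv (α : MPAct G μ) (s : G) : α s⁻¹ = (α s)⁻¹ := α.toMonoidHom.map_inv s

theorem MPAct.isOpen_basicNhd (α : MPAct G μ) {K : Set G} (hK : IsCompact K) {Ω : Set (Set X)}
    (hΩ : Ω.Finite) (hm : ∀ A ∈ Ω, MeasurableSet A) {ε : ℝ} (hε : 0 < ε) :
    IsOpen (MPAct.basicNhd α K Ω ε) :=
  TopologicalSpace.isOpen_generateFrom_of_mem ⟨α, K, Ω, ε, hK, hΩ, hm, hε, rfl⟩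

theorem MPAct.toCM_injective : Function.Injective (MPAct.toCM (G := G) (μ := μ)) :=
  fun _ _ h => MPAct.ext fun s => congrArg (fun f : C(G, AutMeas μ) => f s) h

theorem MPAct.mem_basicNhd_self (α : MPAct G μ) (K : Set G) (Ω : Set (Set X)) {ε : ℝ}
    (hε : 0 < ε) : α ∈ MPAct.basicNhd α K Ω ε := by
  intro s _ A _
  rwa [AutMeas.imageDist_eq, setDist_self]

variable [IsFiniteMeasure μ] [LocallyCompactSpace G]

/-- The sets `MPAct.basicNhd` express uniform convergence on compact sets, so this is the
compact-open topology. -/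
theorem MPAct.isInducing_toCM : Topology.IsInducing (MPAct.toCM (G := G) (μ := μ)) := by
  refine ⟨le_antisymm ?_ ?_⟩
  · rw [← continuous_iff_le_induced]
    -- With the uniformity pulled back from `L¹`, uniform convergence on `K` can be checked for one
    -- measurable set at a time.
    let _ : UniformSpace (AutMeas μ) := (UniformSpace.comap AutMeas.toL1 inferInstance).replaceTopology
      AutMeas.isInducing_toL1.eq_induced
    refine continuous_iff_continuousAt.2 fun α => ?_
    refine ContinuousMap.tendsto_iff_forall_isCompact_tendstoUniformlyOn.2 fun K hK => ?_
    have hu : uniformity (AutMeas μ) = Filter.comap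
        (Prod.map (AutMeas.toL1 (μ := μ)) (AutMeas.toL1 (μ := μ))) (uniformity _) := rfl
    rw [tendstoUniformlyOn_iff_tendsto, hu, Filter.tendsto_comap_iff, Pi.uniformity,
      Filter.tendsto_iInf]
    intro A
    rw [Filter.tendsto_comap_iff]
    refine (tendstoUniformlyOn_iff_tendsto (F := fun (β : MPAct G μ) s => (β s).toL1 A)
      (f := fun s => (α s).toL1 A)).1 (Metric.tendstoUniformlyOn_iff.2 fun ε hε => ?_)
    filter_upwards [(MPAct.isOpen_basicNhd α hK (finite_singleton A.1)
      (by simpa using A.2) hε).mem_nhds (α.mem_basicNhd_self K _ hε)] with β hβ s hs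
    have := hβ s hs A rfl
    rwa [AutMeas.imageDist_eq, ← AutMeas.dist_toL1, dist_comm] at this
  · refine le_generateFrom ?_
    rintro _ ⟨α, K, Ω, ε, hK, hΩ, hm, hε, rfl⟩
    let _ := TopologicalSpace.induced (MPAct.toCM (G := G) (μ := μ)) inferInstance
    have hc : Continuous (MPAct.toCM (G := G) (μ := μ)) := continuous_induced_dom
    -- The centre `α s` moves with `s`, so the condition on `β` is that its graph `s ↦ (s, β s)`
    -- maps `K` into an open set `W`.
    set W : Set (G × AutMeas μ) := {p | ∀ A ∈ hΩ.toFinset.attach,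
      setDist μ (p.2.img A.1) ((α p.1).img A.1) < ε} with hW
    have hWo : IsOpen W := by
      have : W = ⋂ A ∈ hΩ.toFinset.attach, {p : G × AutMeas μ |
          setDist μ (p.2.img A.1) ((α p.1).img A.1) < ε} := by ext; simp [hW]
      rw [this]
      refine isOpen_biInter_finset fun A _ => isOpen_lt ?_ continuous_const
      have hA := hm _ (hΩ.mem_toFinset.1 A.2)
      exact AutMeas.continuous_setDist_img continuous_snd (α.continuous_coe.comp continuous_fst)
        hA hA
    have h1 : Continuous fun f : C(G, AutMeas μ) => (ContinuousMap.id G).prodMk f :=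
      ContinuousMap.continuous_of_continuous_uncurry _ (by
        refine continuous_snd.prodMk ?_
        exact continuous_eval)
    have h2 := (ContinuousMap.isOpen_setOfPred_mapsTo hK hWo).preimage (h1.comp hc)
    convert h2 using 1
    ext β
    simp only [MPAct.basicNhd, hW, AutMeas.imageDist_eq]
    simp [MapsTo, MPAct.toCM]

theorem MPAct.continuous_eval :
    Continuous fun p : MPAct G μ × G => p.1 p.2 :=
  (ContinuousEval.continuous_eval (F := C(G, AutMeas μ))).comp
    (MPAct.isInducing_toCM.continuous.prodMap continuous_id)

theorem MPAct.continuous_eval_const (s : G) : Continuous fun α : MPAct G μ => α s :=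
  MPAct.continuous_eval.comp (continuous_id.prodMk continuous_const)

instance MPAct.instContinuousSMul : ContinuousSMul (AutMeas μ) (MPAct G μ) where
  continuous_smul := by
    refine MPAct.isInducing_toCM.continuous_iff.2
      (ContinuousMap.continuous_of_continuous_uncurry _ ?_)
    have h1 : Continuous fun p : (AutMeas μ × MPAct G μ) × G => p.1.1 := by fun_prop
    have h2 : Continuous fun p : (AutMeas μ × MPAct G μ) × G => p.1.2 p.2 :=
      MPAct.continuous_eval.comp (by fun_prop : Continuous fun p : (AutMeas μ × MPAct G μ) × G =>
        (p.1.2, p.2))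
    exact (h1.mul h2).mul h1.inv

instance MPErg.instContinuousSMul : ContinuousSMul (AutMeas μ) (MPErg G μ) where
  continuous_smul := by
    refine Topology.IsInducing.subtypeVal.continuous_iff.2 ?_
    exact continuous_smul.comp (by fun_prop : Continuous fun p : AutMeas μ × MPErg G μ =>
      (p.1, p.2.1))

theorem MPAct.isClosedEmbedding_toCM [T2Space (AutMeas μ)] :
    Topology.IsClosedEmbedding (MPAct.toCM (G := G) (μ := μ)) := by
  refine ⟨⟨MPAct.isInducing_toCM, MPAct.toCM_injective⟩, ?_⟩
  have : range (MPAct.toCM (G := G) (μ := μ)) =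
      {f | f 1 = 1} ∩ ⋂ (s : G) (t : G), {f | f (s * t) = f s * f t} := by
    ext f
    simp only [mem_inter_iff, mem_iInter]
    constructor
    · rintro ⟨α, rfl⟩
      exact ⟨α.map_one, fun s t => α.map_mul s t⟩
    · rintro ⟨h1, h2⟩
      exact ⟨⟨⟨⟨f, h1⟩, h2⟩, f.continuous⟩, rfl⟩
  rw [this]
  have hc : ∀ s : G, Continuous fun f : C(G, AutMeas μ) => f s := fun s =>
    ContinuousEvalConst.continuous_eval_const s
  refine (isClosed_eq (hc 1) continuous_const).inter
    (isClosed_iInter fun s => isClosed_iInter fun t => ?_)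
  exact isClosed_eq (hc _) ((hc s).mul (hc t))

theorem MPAct.polishSpace [SecondCountableTopology G] [PolishSpace (AutMeas μ)] :
    PolishSpace (MPAct G μ) :=
  have := ContinuousMap.polishSpace (G := G) (Y := AutMeas μ)
  MPAct.isClosedEmbedding_toCM.polishSpace

end PolishAct

/-! ## `Gδ` subsets of Polish spaces -/

/-- The diagonal map identifies the intersection with a closed subset of the product of the Polish
spaces `U n`. -/
theorem polishSpace_iInter_of_isOpen {Y : Type*} [TopologicalSpace Y] [PolishSpace Y]
    {U : ℕ → Set Y} (hU : ∀ n, IsOpen (U n)) : PolishSpace (⋂ n, U n : Set Y) := by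
  have : ∀ n, PolishSpace (U n) := fun n => (hU n).polishSpace
  let f : (⋂ n, U n : Set Y) → ∀ n, U n := fun y n => ⟨y.1, mem_iInter.1 y.2 n⟩
  have hf : Continuous f := by fun_prop
  have hind : Topology.IsInducing f := by
    have h1 : Topology.IsInducing ((fun z : ∀ n, U n => (z 0 : Y)) ∘ f) :=
      Topology.IsInducing.subtypeVal
    exact Topology.IsInducing.of_comp hf (by fun_prop) h1
  refine Topology.IsClosedEmbedding.polishSpace (f := f) ⟨⟨hind, ?_⟩, ?_⟩
  · intro y z h
    exact Subtype.ext (congrArg (fun z : ∀ n, U n => (z 0 : Y)) h)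
  · have : range f = ⋂ n, {z : ∀ n, U n | (z n : Y) = z 0} := by
      ext z
      simp only [mem_iInter]
      constructor
      · rintro ⟨y, rfl⟩ n
        rfl
      · intro h
        exact ⟨⟨(z 0 : Y), mem_iInter.2 fun n => h n ▸ (z n).2⟩, funext fun n =>
          Subtype.ext (h n).symm⟩
    rw [this]
    exact isClosed_iInter fun n => isClosed_eq (by fun_prop) (by fun_prop)

/-! ## Ergodic actions form a `Gδ` set -/

section Koopman

variable {X : Type*} [MeasurableSpace X] {μ : Measure X}

/-- The Koopman isometry of `L²` given by an automorphism. -/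
noncomputable def AutMeas.koopman (T : AutMeas μ) : Lp ℝ 2 μ →ₗᵢ[ℝ] Lp ℝ 2 μ :=
  Lp.compMeasurePreservingₗᵢ ℝ T⁻¹.pt T⁻¹.measurePreserving_pt

theorem AutMeas.coeFn_koopman (T : AutMeas μ) (g : Lp ℝ 2 μ) :
    T.koopman g =ᵐ[μ] g ∘ T⁻¹.pt :=
  Lp.coeFn_compMeasurePreserving g T⁻¹.measurePreserving_pt

variable [IsProbabilityMeasure μ]

/-- The indicator function of a measurable set in `L²`. -/
noncomputable def indL2 (μ : Measure X) [IsProbabilityMeasure μ] {A : Set X}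
    (hA : MeasurableSet A) : Lp ℝ 2 μ :=
  indicatorConstLp 2 hA (measure_ne_top μ A) (1 : ℝ)

theorem coeFn_indL2 {A : Set X} (hA : MeasurableSet A) :
    indL2 μ hA =ᵐ[μ] A.indicator fun _ => (1 : ℝ) :=
  indicatorConstLp_coeFn

theorem dist_indL2 {A B : Set X} (hA : MeasurableSet A) (hB : MeasurableSet B) :
    dist (indL2 μ hA) (indL2 μ hB) = √(setDist μ A B) := by
  rw [indL2, indL2, dist_indicatorConstLp_eq_norm,
    norm_indicatorConstLp two_ne_zero ENNReal.ofNat_ne_top, Real.sqrt_eq_rpow]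
  simp [setDist]

theorem indL2_congr {A B : Set X} (hA : MeasurableSet A) (hB : MeasurableSet B) (h : A =ᵐ[μ] B) :
    indL2 μ hA = indL2 μ hB := by
  rw [← dist_eq_zero, dist_indL2, setDist_eq_zero_iff.2 h, Real.sqrt_zero]

theorem AutMeas.koopman_indL2 (T : AutMeas μ) {A : Set X} (hA : MeasurableSet A) :
    T.koopman (indL2 μ hA) = indL2 μ (T.measurableSet_img hA) :=
  (Lp.indicatorConstLp_compMeasurePreserving hA (measure_ne_top μ A) (1 : ℝ)
    T⁻¹.measurePreserving_pt).trans
    (indL2_congr (T⁻¹.measurePreserving_pt.measurable hA) _ (T.img_eq A).symm)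

theorem exists_ae_eq_const_of_forall_zero_or_one {f : X → ℝ}
    (h : ∀ B, MeasurableSet B → MeasurableSet (f ⁻¹' B) ∧ (μ (f ⁻¹' B) = 0 ∨ μ (f ⁻¹' B) = 1)) :
    ∃ c : ℝ, f =ᵐ[μ] fun _ => c := by
  refine Filter.exists_eventuallyEq_const_of_forall_separating MeasurableSet fun B hB => ?_
  obtain ⟨hm, h0 | h1⟩ := h B hB
  · exact .inr (measure_eq_zero_iff_ae_notMem.1 h0)
  · exact .inl ((prob_compl_eq_zero_iff hm).2 h1)

end Koopman

section ErgodicGdelta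

variable {G : Type*} [Group G] [TopologicalSpace G] {X : Type*} [MeasurableSpace X]
  {μ : Measure X} [IsProbabilityMeasure μ]

/-- The orbit of the indicator function of a measurable set under an action. -/
noncomputable def MPAct.orbitL2 (α : MPAct G μ) {A : Set X} (hA : MeasurableSet A) :
    Set (Lp ℝ 2 μ) :=
  range fun s => indL2 μ ((α s).measurableSet_img hA)

theorem MPAct.koopman_image_orbitL2_subset (α : MPAct G μ) {A : Set X} (hA : MeasurableSet A)
    (t : G) : (α t).koopman '' α.orbitL2 hA ⊆ α.orbitL2 hA := by
  rintro _ ⟨_, ⟨s, rfl⟩, rfl⟩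
  refine ⟨t * s, ?_⟩
  simp only [AutMeas.koopman_indL2]
  refine indL2_congr _ _ ?_
  rw [α.map_mul]
  exact AutMeas.img_mul _ _ _

theorem MPAct.koopman_mem_closure_convexHull (α : MPAct G μ) {A : Set X} (hA : MeasurableSet A)
    (t : G) {w : Lp ℝ 2 μ} (hw : w ∈ closure (convexHull ℝ (α.orbitL2 hA))) :
    (α t).koopman w ∈ closure (convexHull ℝ (α.orbitL2 hA)) := by
  have h1 : (α t).koopman w ∈ (α t).koopman '' closure (convexHull ℝ (α.orbitL2 hA)) := ⟨w, hw, rfl⟩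
  have h2 := image_closure_subset_closure_image (α t).koopman.continuous h1
  refine closure_mono ?_ h2
  have h3 := LinearMap.image_convexHull (𝕜 := ℝ) (α t).koopman.toLinearMap (α.orbitL2 hA)
  refine h3.subset.trans (convexHull_mono (α.koopman_image_orbitL2_subset hA t))

/-- Two elements of least norm satisfy the variational inequality against each other; the sum of the
two inequalities is `‖v - w‖² ≤ 0`. -/
theorem exists_unique_min_norm {H : Type*} [NormedAddCommGroup H] [InnerProductSpace ℝ H]
    [CompleteSpace H] {C : Set H} (hne : C.Nonempty) (hcl : IsClosed C) (hco : Convex ℝ C) :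
    ∃ w ∈ C, ∀ v ∈ C, ‖v‖ = ‖w‖ → v = w := by
  obtain ⟨w, hw, hmin⟩ := exists_norm_eq_iInf_of_complete_convex hne hcl.isComplete hco 0
  refine ⟨w, hw, fun v hv hvw => ?_⟩
  have hmin' : ‖0 - v‖ = ⨅ u : C, ‖0 - (u : H)‖ := by rw [← hmin]; simpa using hvw
  have h1 := (norm_eq_iInf_iff_real_inner_le_zero hco hw).1 hmin v hv
  have h2 := (norm_eq_iInf_iff_real_inner_le_zero hco hv).1 hmin' w hw
  have h3 : inner ℝ (v - w) (v - w) ≤ 0 := by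
    have e1 : inner ℝ (0 - w) (v - w) = -inner ℝ w (v - w) := by rw [zero_sub, inner_neg_left]
    have e2 : inner ℝ (0 - v) (w - v) = inner ℝ v (v - w) := by
      rw [zero_sub, inner_neg_left, ← inner_neg_right, neg_sub]
    rw [inner_sub_left]
    linarith
  exact sub_eq_zero.1 (real_inner_self_nonpos.1 h3)

/-- The Alaoglu–Birkhoff argument: the element of least norm in the closed convex hull of the orbit
is fixed by the Koopman isometries by uniqueness, hence constant by ergodicity. Its value is `μ(A)`
because integration is constant on the orbit, hence on the closed hull. -/
theorem MPAct.IsErgodic.mem_closure_convexHull {α : MPAct G μ} (hα : α.IsErgodic) {A : Set X}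
    (hA : MeasurableSet A) :
    μ.real A • indL2 μ MeasurableSet.univ ∈ closure (convexHull ℝ (α.orbitL2 hA)) := by
  have hne : (closure (convexHull ℝ (α.orbitL2 hA))).Nonempty :=
    ((range_nonempty _).mono (subset_convexHull ℝ _)).closure
  obtain ⟨w, hw, hu⟩ := exists_unique_min_norm hne isClosed_closure
    (convex_convexHull ℝ (α.orbitL2 hA)).closure
  have hinv : ∀ s, (α s).koopman w = w := fun s =>
    hu _ (α.koopman_mem_closure_convexHull hA s hw) ((α s).koopman.norm_map w)
  have hwm : Measurable (w : X → ℝ) := (Lp.stronglyMeasurable w).measurable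
  obtain ⟨c, hc⟩ : ∃ c : ℝ, (w : X → ℝ) =ᵐ[μ] fun _ => c := by
    refine exists_ae_eq_const_of_forall_zero_or_one fun B hB => ⟨hwm hB, hα _ (hwm hB) fun s => ?_⟩
    rw [AutMeas.imageDist_eq, setDist_eq_zero_iff]
    refine Filter.EventuallyEq.trans ?_ (AutMeas.img_one _).symm
    refine ((α s).img_eq _).trans ?_
    have h1 := (α s).coeFn_koopman w
    rw [hinv s] at h1
    filter_upwards [h1] with x hx
    change (w ((α s)⁻¹.pt x) ∈ B) = (w x ∈ B)
    rw [hx]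
    rfl
  have hint : inner ℝ (indL2 μ MeasurableSet.univ) w = μ.real A := by
    have hcl : IsClosed {v : Lp ℝ 2 μ | inner ℝ (indL2 μ MeasurableSet.univ) v = μ.real A} :=
      isClosed_eq (continuous_const.inner continuous_id) continuous_const
    have hco : Convex ℝ {v : Lp ℝ 2 μ | inner ℝ (indL2 μ MeasurableSet.univ) v = μ.real A} := by
      intro v hv u hu a b _ _ hab
      simp only [mem_ofPred_eq] at hv hu ⊢
      rw [inner_add_right, inner_smul_right, inner_smul_right, hv, hu, ← add_mul, hab, one_mul]
    refine closure_minimal (convexHull_min ?_ hco) hcl hw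
    rintro _ ⟨s, rfl⟩
    change inner ℝ (indicatorConstLp 2 MeasurableSet.univ (measure_ne_top μ univ) (1 : ℝ)) _ = _
    rw [L2.inner_indicatorConstLp_one, setIntegral_univ,
      integral_congr_ae (coeFn_indL2 ((α s).measurableSet_img hA)),
      integral_indicator ((α s).measurableSet_img hA)]
    simp [measureReal_def, (α s).measure_img hA]
  have hwc : w = c • indL2 μ MeasurableSet.univ := by
    refine Lp.ext ?_
    filter_upwards [hc, Lp.coeFn_smul c (indL2 μ MeasurableSet.univ),
      coeFn_indL2 (μ := μ) MeasurableSet.univ] with x h1 h2 h3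
    rw [h1, h2, Pi.smul_apply, h3]
    simp
  have hcA : c = μ.real A := by
    rw [← hint]
    change _ = inner ℝ (indicatorConstLp 2 MeasurableSet.univ (measure_ne_top μ univ) (1 : ℝ)) _
    rw [L2.inner_indicatorConstLp_one, setIntegral_univ, integral_congr_ae hc]
    simp
  rw [← hcA, ← hwc]
  exact hw

theorem norm_smul_indL2_univ (c : ℝ) : ‖c • indL2 μ MeasurableSet.univ‖ = |c| := by
  rw [norm_smul, indL2, norm_indicatorConstLp two_ne_zero ENNReal.ofNat_ne_top]
  simp

theorem measure_zero_or_one_of_indL2_eq {A : Set X} (hA : MeasurableSet A) {c : ℝ}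
    (h : indL2 μ hA = c • indL2 μ MeasurableSet.univ) : μ A = 0 ∨ μ A = 1 := by
  have h1 : ∀ᵐ x ∂μ, A.indicator (fun _ => (1 : ℝ)) x = c := by
    filter_upwards [coeFn_indL2 (μ := μ) hA, Lp.coeFn_smul c (indL2 μ MeasurableSet.univ),
      coeFn_indL2 (μ := μ) MeasurableSet.univ] with x h1 h2 h3
    rw [← h1, h, h2, Pi.smul_apply, h3]
    simp
  by_cases hc : c = 1
  · right
    rw [← prob_compl_eq_zero_iff hA]
    refine mem_ae_iff.1 ?_
    filter_upwards [h1] with x hx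
    by_contra hxA
    rw [indicator_of_notMem hxA, hc] at hx
    exact zero_ne_one hx
  · left
    refine measure_eq_zero_iff_ae_notMem.2 ?_
    filter_upwards [h1] with x hx hxA
    rw [indicator_of_mem hxA] at hx
    exact hc hx.symm

/-- If `A` is invariant and `C n` is close to `A`, all translates of `1_{C n}` lie in a small ball
around `1_A`, and so does their convex hull. Hence `1_A` is arbitrarily close to a constant. -/
theorem MPAct.isErgodic_of_forall_exists_convexHull {α : MPAct G μ} {C : ℕ → Set X}
    (hC : ∀ n, MeasurableSet (C n))
    (hd : ∀ A, MeasurableSet A → ∀ ε > 0, ∃ n, setDist μ A (C n) < ε)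
    (h : ∀ n, ∀ ε > 0, ∃ g ∈ convexHull ℝ (α.orbitL2 (hC n)),
      ‖g - μ.real (C n) • indL2 μ MeasurableSet.univ‖ < ε) : α.IsErgodic := by
  intro A hA hinv
  refine measure_zero_or_one_of_indL2_eq hA (c := μ.real A) (dist_le_zero.1 ?_)
  refine le_of_forall_pos_le_add fun ε hε => ?_
  -- The square is needed because the `L²`-distance of indicators is the square root of `setDist`;
  -- the other bound controls the means.
  set δ := min (ε / 3) ((ε / 3) ^ 2) with hδ
  have hδ0 : 0 < δ := lt_min (by positivity) (by positivity)
  obtain ⟨n, hn⟩ := hd A hA δ hδ0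
  obtain ⟨g, hg, hgε⟩ := h n (ε / 3) (by positivity)
  have h1 : dist g (indL2 μ hA) ≤ ε / 3 := by
    refine convexHull_min (t := Metric.closedBall (indL2 μ hA) (ε / 3)) ?_
      (convex_closedBall _ _) hg
    rintro _ ⟨s, rfl⟩
    rw [Metric.mem_closedBall, dist_indL2]
    have h2 : A =ᵐ[μ] (α s).img A := by
      have := hinv s
      rw [AutMeas.imageDist_eq, setDist_eq_zero_iff] at this
      exact (AutMeas.img_one A).symm.trans this.symm
    rw [setDist_congr_right h2, (α s).setDist_img (hC n) hA, setDist_comm]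
    exact Real.sqrt_le_iff.2 ⟨by positivity, (hn.trans_le (min_le_right _ _)).le⟩
  have h3 : dist (μ.real (C n) • indL2 μ MeasurableSet.univ)
      (μ.real A • indL2 μ MeasurableSet.univ) ≤ ε / 3 := by
    rw [dist_eq_norm, ← sub_smul, norm_smul_indL2_univ, abs_sub_comm]
    exact (abs_measureReal_sub_le_setDist hA (hC n)).trans (hn.trans_le (min_le_left _ _)).le
  rw [← dist_eq_norm] at hgε
  have h4 := dist_triangle4 (indL2 μ hA) g (μ.real (C n) • indL2 μ MeasurableSet.univ)
    (μ.real A • indL2 μ MeasurableSet.univ)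
  rw [dist_comm _ g] at h4
  linarith

variable [LocallyCompactSpace G]

theorem MPAct.continuous_indL2 (s : G) {A : Set X} (hA : MeasurableSet A) :
    Continuous fun α : MPAct G μ => indL2 μ ((α s).measurableSet_img hA) := by
  refine continuous_iff_continuousAt.2 fun α => tendsto_iff_dist_tendsto_zero.2 ?_
  simp only [dist_indL2]
  have h := (AutMeas.continuous_setDist_img (MPAct.continuous_eval_const (μ := μ) s)
    (continuous_const (y := α s)) hA hA).sqrt.tendsto α
  rwa [setDist_self, Real.sqrt_zero] at h

/-- A convex combination involves finitely many times; keeping the weights and times, it varies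
continuously with the action. -/
theorem MPAct.isOpen_exists_convexHull {A : Set X} (hA : MeasurableSet A) (v : Lp ℝ 2 μ) (ε : ℝ) :
    IsOpen {α : MPAct G μ | ∃ g ∈ convexHull ℝ (α.orbitL2 hA), ‖g - v‖ < ε} := by
  refine isOpen_iff_mem_nhds.2 fun α ⟨g, hg, hgε⟩ => ?_
  obtain ⟨ι, _, c, z, hc0, hc1, hz, hsum⟩ := mem_convexHull_iff_exists_fintype.1 hg
  choose s hs using hz
  have hcont : Continuous fun β : MPAct G μ =>
      ‖∑ i, c i • indL2 μ ((β (s i)).measurableSet_img hA) - v‖ :=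
    ((continuous_finsetSum _ fun i _ =>
      (MPAct.continuous_indL2 (s i) hA).const_smul (c i)).sub continuous_const).norm
  have h0 : ‖∑ i, c i • indL2 μ ((α (s i)).measurableSet_img hA) - v‖ < ε := by
    have : ∑ i, c i • indL2 μ ((α (s i)).measurableSet_img hA) = g := by
      rw [← hsum]
      exact Finset.sum_congr rfl fun i _ => by rw [← hs i]
    rwa [this]
  filter_upwards [(isOpen_lt hcont continuous_const).mem_nhds h0] with β hβ
  exact ⟨_, mem_convexHull_of_exists_fintype c _ hc0 hc1 (fun i => ⟨s i, rfl⟩) rfl, hβ⟩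

theorem MPErg.polishSpace [SecondCountableTopology G] [MeasurableSpace.CountablyGenerated X]
    [PolishSpace (AutMeas μ)] : PolishSpace (MPErg G μ) := by
  have := MPAct.polishSpace (G := G) (μ := μ)
  obtain ⟨C, hC, hd⟩ := exists_countable_setDist_dense μ
  let V : ℕ → ℕ → Set (MPAct G μ) := fun n k =>
    {α | ∃ g ∈ convexHull ℝ (α.orbitL2 (hC n)),
      ‖g - μ.real (C n) • indL2 μ MeasurableSet.univ‖ < 1 / (k + 1)}
  let U : ℕ → Set (MPAct G μ) := fun n => V n.unpair.1 n.unpair.2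
  have hUo : ∀ n, IsOpen (U n) := fun n => MPAct.isOpen_exists_convexHull _ _ _
  have hE : {α : MPAct G μ | α.IsErgodic} = ⋂ n, U n := by
    ext α
    simp only [mem_iInter]
    constructor
    · intro hα n
      have := hα.mem_closure_convexHull (hC n.unpair.1)
      obtain ⟨g, hg, h⟩ := Metric.mem_closure_iff.1 this (1 / (n.unpair.2 + 1)) (by positivity)
      exact ⟨g, hg, by rwa [dist_comm, dist_eq_norm] at h⟩
    · intro h
      refine MPAct.isErgodic_of_forall_exists_convexHull hC hd fun n ε hε => ?_
      obtain ⟨k, hk⟩ := exists_nat_one_div_lt hε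
      have hn : α ∈ V n k := by
        have := h (Nat.pair n k)
        simpa only [U, Nat.unpair_pair] using this
      obtain ⟨g, hg, hgk⟩ := hn
      exact ⟨g, hg, hgk.trans hk⟩
  have := polishSpace_iInter_of_isOpen hUo
  rw [← hE] at this
  exact this

end ErgodicGdelta

/-! ## Atomless standard probability spaces -/

section Quantile

variable (ν : Measure ℝ) [IsProbabilityMeasure ν]

/-- The uniform distribution on the unit interval, as a measure on the line. -/
noncomputable def uniform01 : Measure ℝ := volume.restrict (Ioo 0 1)

instance : IsProbabilityMeasure uniform01 := ⟨by simp [uniform01]⟩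

theorem ae_uniform01 : ∀ᵐ u ∂uniform01, u ∈ Ioo (0 : ℝ) 1 := ae_restrict_mem measurableSet_Ioo

theorem uniform01_Iic {a : ℝ} (h1 : a ≤ 1) : uniform01 (Iic a) = ENNReal.ofReal a := by
  rw [uniform01, Measure.restrict_apply measurableSet_Iic]
  have h2 : volume (Iic a ∩ Ioo (0 : ℝ) 1) = volume (Iic a ∩ Ioc (0 : ℝ) 1) :=
    measure_congr (.inter .rfl Ioo_ae_eq_Ioc)
  rw [h2, inter_comm, Ioc_inter_Iic, min_eq_right h1, Real.volume_Ioc, sub_zero]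

theorem continuous_cdf [NullSingletonClass ν] : Continuous (ProbabilityTheory.cdf ν) := by
  refine continuous_iff_continuousAt.2 fun x => ?_
  have hm : Monotone (ProbabilityTheory.cdf ν) := ProbabilityTheory.monotone_cdf ν
  rw [hm.continuousAt_iff_leftLim_eq_rightLim, StieltjesFunction.rightLim_eq]
  refine le_antisymm (hm.leftLim_le le_rfl) ?_
  have h := (ProbabilityTheory.cdf ν).measure_singleton x
  rw [ProbabilityTheory.measure_cdf, measure_singleton] at h
  exact sub_nonpos.1 (ENNReal.ofReal_eq_zero.1 h.symm)

/-- The quantile function of a distribution on the line. -/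
noncomputable def quantile (u : ℝ) : ℝ :=
  open Classical in if u ∈ Ioo (0 : ℝ) 1 then sInf {x | u ≤ ProbabilityTheory.cdf ν x} else 0

variable {ν} [NullSingletonClass ν]

theorem quantile_le_iff {u : ℝ} (hu : u ∈ Ioo (0 : ℝ) 1) (x : ℝ) :
    quantile ν u ≤ x ↔ u ≤ ProbabilityTheory.cdf ν x := by
  have hm : Monotone (ProbabilityTheory.cdf ν) := ProbabilityTheory.monotone_cdf ν
  rw [quantile, if_pos hu]
  obtain ⟨b, hb⟩ := ((ProbabilityTheory.tendsto_cdf_atBot ν).eventually (gt_mem_nhds hu.1)).exists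
  obtain ⟨c, hc⟩ := ((ProbabilityTheory.tendsto_cdf_atTop ν).eventually (lt_mem_nhds hu.2)).exists
  have hbdd : BddBelow {x | u ≤ ProbabilityTheory.cdf ν x} := by
    refine ⟨b, fun y hy => ?_⟩
    by_contra h
    exact (le_trans hy (hm (not_le.1 h).le)).not_gt hb
  refine ⟨fun h => ?_, fun h => csInf_le hbdd h⟩
  have hcl : IsClosed {x | u ≤ ProbabilityTheory.cdf ν x} :=
    isClosed_le continuous_const (continuous_cdf ν)
  exact le_trans (hcl.csInf_mem ⟨c, hc.le⟩ hbdd) (hm h)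

theorem cdf_quantile {u : ℝ} (hu : u ∈ Ioo (0 : ℝ) 1) :
    ProbabilityTheory.cdf ν (quantile ν u) = u := by
  refine le_antisymm ?_ ((quantile_le_iff hu _).1 le_rfl)
  refine le_of_tendsto ((continuous_cdf ν).continuousWithinAt.tendsto (s := Iio (quantile ν u))) ?_
  filter_upwards [self_mem_nhdsWithin] with x hx
  by_contra h
  exact hx.not_ge ((quantile_le_iff hu x).2 (not_le.1 h).le)

variable (ν)

theorem measurable_quantile : Measurable (quantile ν) := by
  refine measurable_of_Iic fun x => ?_
  have : quantile ν ⁻¹' Iic x = (Ioo 0 1 ∩ Iic (ProbabilityTheory.cdf ν x)) ∪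
      ((Ioo 0 1)ᶜ ∩ {_u | (0 : ℝ) ≤ x}) := by
    ext u
    by_cases hu : u ∈ Ioo (0 : ℝ) 1
    · have := quantile_le_iff (ν := ν) hu x
      simp [hu, this]
    · simp [quantile, hu]
  rw [this]
  exact (measurableSet_Ioo.inter measurableSet_Iic).union
    (measurableSet_Ioo.compl.inter (MeasurableSet.const _))

theorem measurePreserving_quantile : MeasurePreserving (quantile ν) uniform01 ν := by
  refine ⟨measurable_quantile ν, ?_⟩
  have : IsProbabilityMeasure (uniform01.map (quantile ν)) :=
    Measure.isProbabilityMeasure_map (measurable_quantile ν).aemeasurable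
  refine Measure.ext_of_Iic _ _ fun x => ?_
  rw [Measure.map_apply (measurable_quantile ν) measurableSet_Iic,
    ← ProbabilityTheory.ofReal_cdf ν x, ← uniform01_Iic (ProbabilityTheory.cdf_le_one ν x)]
  refine measure_congr ?_
  filter_upwards [ae_uniform01] with u hu
  exact propext (quantile_le_iff hu x)

theorem ae_cdf_quantile : ∀ᵐ u ∂uniform01, ProbabilityTheory.cdf ν (quantile ν u) = u := by
  filter_upwards [ae_uniform01] with u hu using cdf_quantile hu

theorem measurePreserving_cdf :
    MeasurePreserving (ProbabilityTheory.cdf ν) ν uniform01 := by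
  refine ⟨(continuous_cdf ν).measurable, ?_⟩
  have h := Measure.map_map (μ := uniform01) (continuous_cdf ν).measurable (measurable_quantile ν)
  rw [(measurePreserving_quantile ν).map_eq] at h
  exact h.trans ((Measure.map_congr (ae_cdf_quantile ν)).trans Measure.map_id)

theorem ae_quantile_cdf : ∀ᵐ x ∂ν, quantile ν (ProbabilityTheory.cdf ν x) = x := by
  have h := ae_map_iff (μ := uniform01) (measurable_quantile ν).aemeasurable (measurableSet_eq_fun
    ((measurable_quantile ν).comp (continuous_cdf ν).measurable) measurable_id)
  rw [(measurePreserving_quantile ν).map_eq] at h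
  refine h.2 ?_
  filter_upwards [ae_cdf_quantile ν] with u hu
  simp only [Function.comp_apply, id_eq, hu]

end Quantile

/-- Points labelled `k` land in `[2k, 2k + 1]`. The spacing `2` keeps these closed blocks disjoint,
so the order of the line respects labels. -/
theorem label_le_iff {X : Type*} [MeasurableSpace X] (e : X ≃ᵐ unitInterval) (ℓ : X → ℕ) (k : ℕ) (x : X) :
    2 * (ℓ x : ℝ) + e x ≤ 2 * k + 1 ↔ ℓ x ≤ k := by
  have hx := (e x).2
  constructor
  · intro h
    by_contra hc
    have : (k : ℝ) + 1 ≤ ℓ x := by exact_mod_cast not_le.1 hc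
    linarith [hx.1]
  · intro h
    have : (ℓ x : ℝ) ≤ k := by exact_mod_cast h
    linarith [hx.2]

/-! ### Isomorphisms of atomless spaces, compatible with labels -/

section Isomorphism

variable {X : Type*} [MeasurableSpace X] {μ : Measure X} [IsProbabilityMeasure μ]
  [NullSingletonClass μ]

/-- A measurable embedding of an atomless probability space in the line yields an almost everywhere
isomorphism with the unit interval which is monotone in the value of the embedding. -/
theorem exists_ae_iso_uniform01 {j : X → ℝ} (hj : MeasurableEmbedding j) :
    ∃ (S : X → ℝ) (R : ℝ → X), MeasurePreserving S μ uniform01 ∧ MeasurePreserving R uniform01 μ ∧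
      (∀ᵐ x ∂μ, R (S x) = x) ∧ (∀ᵐ u ∂uniform01, S (R u) = u) ∧
      ∀ c : ℝ, ∀ᵐ u ∂uniform01, j (R u) ≤ c ↔ u ≤ μ.real {x | j x ≤ c} := by
  set ν := μ.map j with hν
  have : IsProbabilityMeasure ν := Measure.isProbabilityMeasure_map hj.measurable.aemeasurable
  have : NullSingletonClass ν := ⟨fun x => by
    rw [hν, hj.map_apply]
    exact (subsingleton_singleton.preimage hj.injective).measure_zero μ⟩
  have hne : Nonempty X := by
    by_contra h
    rw [not_nonempty_iff] at h
    have := measure_univ (μ := μ)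
    rw [eq_empty_of_isEmpty (univ : Set X), measure_empty] at this
    exact zero_ne_one this
  obtain ⟨r, hr, hrj⟩ := hj.exists_measurable_extend measurable_id (fun _ => hne)
  have hjr : ∀ᵐ y ∂ν, j (r y) = y := by
    rw [hν, hj.ae_map_iff]
    exact ae_of_all _ fun x => by rw [show r (j x) = x from congrFun hrj x]
  have hjm : MeasurePreserving j μ ν := ⟨hj.measurable, rfl⟩
  have hrm : MeasurePreserving r ν μ := by
    refine ⟨hr, ?_⟩
    rw [hν, Measure.map_map hr hj.measurable, hrj, Measure.map_id]
  have hjQ : ∀ᵐ u ∂uniform01, j (r (quantile ν u)) = quantile ν u :=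
    (measurePreserving_quantile ν).quasiMeasurePreserving.ae hjr
  refine ⟨ProbabilityTheory.cdf ν ∘ j, r ∘ quantile ν, (measurePreserving_cdf ν).comp hjm,
    hrm.comp (measurePreserving_quantile ν), ?_, ?_, fun c => ?_⟩
  · filter_upwards [hjm.quasiMeasurePreserving.ae (ae_quantile_cdf ν)] with x hx
    simp only [Function.comp_apply, hx]
    exact congrFun hrj x
  · filter_upwards [hjQ, ae_cdf_quantile ν] with u h1 h2
    simp only [Function.comp_apply, h1, h2]
  · filter_upwards [hjQ, ae_uniform01] with u h1 h2
    simp only [Function.comp_apply, h1]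
    rw [quantile_le_iff h2, ProbabilityTheory.cdf_eq_real, hν,
      map_measureReal_apply hj.measurable measurableSet_Iic]
    rfl

variable [StandardBorelSpace X]

theorem measurableEmbedding_label (e : X ≃ᵐ unitInterval) {ℓ : X → ℕ} (hℓ : Measurable ℓ) :
    MeasurableEmbedding fun x => 2 * (ℓ x : ℝ) + e x := by
  have hm : Measurable fun x => 2 * (ℓ x : ℝ) + e x :=
    ((measurable_from_nat (f := fun n : ℕ => (n : ℝ))).comp hℓ |>.const_mul 2).add
      (measurable_coe_equiv e)
  refine hm.measurableEmbedding fun x y hxy => ?_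
  have hx := (e x).2
  have hy := (e y).2
  have hxy' : 2 * (ℓ x : ℝ) + e x = 2 * (ℓ y : ℝ) + e y := hxy
  have h1 : ℓ x = ℓ y := by
    rcases lt_trichotomy (ℓ x) (ℓ y) with h | h | h
    · have : (ℓ x : ℝ) + 1 ≤ ℓ y := by exact_mod_cast h
      linarith [hx.2, hy.1]
    · exact h
    · have : (ℓ y : ℝ) + 1 ≤ ℓ x := by exact_mod_cast h
      linarith [hx.1, hy.2]
  rw [h1] at hxy'
  exact e.injective (Subtype.ext (by linarith))

/-- A measure-preserving map agrees with an automorphism as far as a label is concerned. -/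
theorem exists_mpPerm_label_eq {p : X → X} (hp : MeasurePreserving p μ μ) {ℓ : X → ℕ}
    (hℓ : Measurable ℓ) : ∃ γ : mpPerm μ, ∀ᵐ x ∂μ, ℓ ((γ : Equiv.Perm X) x) = ℓ (p x) := by
  obtain ⟨e⟩ := nonempty_measurableEquiv_unitInterval μ
  obtain ⟨S, R, hS, hR, hRS, hSR, hc⟩ :=
    exists_ae_iso_uniform01 (μ := μ) (measurableEmbedding_label e hℓ)
  obtain ⟨S', R', hS', hR', hRS', hSR', hc'⟩ :=
    exists_ae_iso_uniform01 (μ := μ) (measurableEmbedding_label e (hℓ.comp hp.measurable))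
  obtain ⟨γ, hγ, -⟩ := exists_mpPerm_of_ae_inverse (hR.comp hS') (hR'.comp hS)
    (by filter_upwards [hS'.quasiMeasurePreserving.ae hSR, hRS'] with x h1 h2
        simp only [Function.comp_apply, h1, h2])
    (by filter_upwards [hS.quasiMeasurePreserving.ae hSR', hRS] with x h1 h2
        simp only [Function.comp_apply, h1, h2])
  refine ⟨γ, ?_⟩
  -- Both isomorphisms with the interval are monotone in the label, and `ℓ`, `ℓ ∘ p` have the same
  -- distribution because `p` preserves `μ`. So the labels change at the same points of the
  -- interval.
  have key : ∀ᵐ u ∂uniform01, ∀ k : ℕ, ℓ (R u) ≤ k ↔ ℓ (p (R' u)) ≤ k := by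
    refine ae_all_iff.2 fun k => ?_
    filter_upwards [hc (2 * k + 1), hc' (2 * k + 1)] with u h1 h2
    simp only [label_le_iff e ℓ, label_le_iff e (ℓ ∘ p)] at h1 h2
    simp only [Function.comp_apply] at h2
    rw [h1, h2]
    have : μ.real {x | ℓ (p x) ≤ k} = μ.real {x | ℓ x ≤ k} :=
      hp.measureReal_preimage (s := {x | ℓ x ≤ k})
        (hℓ (measurableSet_Iic (a := k))).nullMeasurableSet
    rw [this]
  filter_upwards [hγ, hS'.quasiMeasurePreserving.ae key, hRS'] with x h1 h2 h3
  rw [h3] at h2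
  rw [h1, Function.comp_apply]
  exact le_antisymm ((h2 _).2 le_rfl) ((h2 _).1 le_rfl)

/-- The pattern of memberships in the sets of `Ω` takes finitely many values, so it can be coded as
a label. This replaces a possibly non-invertible `p` by an automorphism indistinguishable from it on
`Ω`. -/
theorem exists_mpPerm_preimage_ae_eq {p : X → X} (hp : MeasurePreserving p μ μ)
    {Ω : Set (Set X)} (hΩ : Ω.Finite) (hm : ∀ A ∈ Ω, MeasurableSet A) :
    ∃ γ : mpPerm μ, ∀ A ∈ Ω, (γ : Equiv.Perm X) ⁻¹' A =ᵐ[μ] p ⁻¹' A := by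
  have := hΩ.to_subtype
  obtain ⟨c, hc⟩ := exists_injective_nat (Ω → Prop)
  have hℓ : Measurable fun x : X => c fun A : Ω => x ∈ A.1 := by
    refine (measurable_of_countable c).comp (measurable_pi_lambda _ fun A => ?_)
    exact measurableSet_setOfPred.1 (hm A.1 A.2)
  obtain ⟨γ, hγ⟩ := exists_mpPerm_label_eq hp hℓ
  refine ⟨γ, fun A hA => ?_⟩
  filter_upwards [hγ] with x hx
  exact congrFun (hc hx) ⟨A, hA⟩

/-- Any two standard atomless probability spaces are isomorphic almost everywhere. -/
theorem exists_ae_iso {Y : Type*} [MeasurableSpace Y] [StandardBorelSpace Y] (μ : Measure X)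
    [IsProbabilityMeasure μ] [NullSingletonClass μ] (ν : Measure Y) [IsProbabilityMeasure ν]
    [NullSingletonClass ν] : ∃ (S : X → Y) (R : Y → X), MeasurePreserving S μ ν ∧
      MeasurePreserving R ν μ ∧ (∀ᵐ x ∂μ, R (S x) = x) ∧ (∀ᵐ y ∂ν, S (R y) = y) := by
  obtain ⟨e⟩ := nonempty_measurableEquiv_unitInterval μ
  obtain ⟨e'⟩ := nonempty_measurableEquiv_unitInterval ν
  obtain ⟨S, R, hS, hR, hRS, hSR, -⟩ := exists_ae_iso_uniform01 (μ := μ)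
    (measurableEmbedding_label e (measurable_const (a := 0)))
  obtain ⟨S', R', hS', hR', hRS', hSR', -⟩ := exists_ae_iso_uniform01 (μ := ν)
    (measurableEmbedding_label e' (measurable_const (a := 0)))
  refine ⟨R' ∘ S, R ∘ S', hR'.comp hS, hR.comp hS', ?_, ?_⟩
  · filter_upwards [hS.quasiMeasurePreserving.ae hSR', hRS] with x h1 h2
    simp only [Function.comp_apply, h1, h2]
  · filter_upwards [hS'.quasiMeasurePreserving.ae hSR, hRS'] with x h1 h2
    simp only [Function.comp_apply, h1, h2]

end Isomorphism

/-! ## Linear flows on the torus -/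

section TorusErgodic

instance : IsProbabilityMeasure (volume : Measure UnitAddCircle) := ⟨UnitAddCircle.measure_univ⟩

instance : NullSingletonClass (volume : Measure UnitAddCircle) := by
  refine ⟨fun x => ?_⟩
  rw [← (UnitAddCircle.measurePreserving_mk 0).measure_preimage
    (measurableSet_singleton x).nullMeasurableSet]
  refine Set.Countable.measure_zero ?_ _
  obtain ⟨r, rfl⟩ := QuotientAddGroup.mk_surjective x
  refine (countable_range fun n : ℤ => r + n).mono fun t ht => ?_
  have h0 : ((t - r : ℝ) : UnitAddCircle) = 0 := by
    rw [AddCircle.coe_sub, sub_eq_zero]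
    exact ht
  obtain ⟨n, hn⟩ := (AddCircle.coe_eq_zero_iff (1 : ℝ)).1 h0
  exact ⟨n, by simp only [zsmul_eq_mul, mul_one] at hn; simp only [hn]; ring⟩

/-- The normalized Haar measure of the two-dimensional torus. -/
noncomputable def torusMeasure : Measure (UnitAddCircle × UnitAddCircle) := volume.prod volume

instance : IsProbabilityMeasure torusMeasure := by unfold torusMeasure; infer_instance

instance : NullSingletonClass torusMeasure := by unfold torusMeasure; infer_instance

theorem measurePreserving_sub_torus (v : UnitAddCircle × UnitAddCircle) :
    MeasurePreserving (fun z => z - v) torusMeasure torusMeasure := by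
  have h1 := measurePreserving_sub_right (volume : Measure UnitAddCircle) v.1
  have h2 := measurePreserving_sub_right (volume : Measure UnitAddCircle) v.2
  exact h1.prod h2

theorem addOrderOf_coe_eq_zero {r : ℝ} (hr : Irrational r) :
    addOrderOf (r : UnitAddCircle) = 0 := by
  rw [← AddCircle.denseRange_zsmul_iff, AddCircle.denseRange_zsmul_coe_iff, div_one]
  exact hr

theorem ae_empty_or_univ_of_sub_irrational {r : ℝ} (hr : Irrational r) {E : Set UnitAddCircle}
    (hE : MeasurableSet E) (h : (fun y => y - (r : UnitAddCircle)) ⁻¹' E =ᵐ[volume] E) :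
    E =ᵐ[volume] (∅ : Set UnitAddCircle) ∨ E =ᵐ[volume] (univ : Set UnitAddCircle) := by
  have he : Ergodic (fun y : UnitAddCircle => y + (-(r : UnitAddCircle))) :=
    AddCircle.ergodic_add_right.2 (by rw [addOrderOf_neg, addOrderOf_coe_eq_zero hr])
  refine he.quasiErgodic.ae_empty_or_univ₀ hE.nullMeasurableSet ?_
  simpa only [sub_eq_add_neg] using h

/-- A set which is invariant under a linear flow of irrational slope is null or conull. -/
theorem torus_zero_or_one_of_invariant {a b : ℝ} (hb : b ≠ 0) (hab : Irrational (a / b))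
    {B : Set (UnitAddCircle × UnitAddCircle)} (hB : MeasurableSet B)
    (h : ∀ s : ℝ, (fun z => z - (((b * s : ℝ) : UnitAddCircle), ((a * s : ℝ) : UnitAddCircle))) ⁻¹' B
      =ᵐ[torusMeasure] B) : torusMeasure B = 0 ∨ torusMeasure B = 1 := by
  set g : UnitAddCircle → ENNReal := fun y => volume (Prod.mk y ⁻¹' B) with hg
  have hgm : Measurable g := measurable_measure_prodMk_left hB
  have hBm : ∀ y : UnitAddCircle, MeasurableSet (Prod.mk y ⁻¹' B) := fun y =>
    measurable_prodMk_left hB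
  have hslice : ∀ s : ℝ, ∀ᵐ y : UnitAddCircle,
      (fun x => x - ((a * s : ℝ) : UnitAddCircle)) ⁻¹'
        (Prod.mk (y - ((b * s : ℝ) : UnitAddCircle)) ⁻¹' B) =ᵐ[volume] Prod.mk y ⁻¹' B := by
    intro s
    filter_upwards [Measure.ae_ae_of_ae_prod (h s)] with y hy
    exact hy
  -- At time `1 / b` the base coordinate is back and each fibre is rotated by the irrational `a /
  -- b`, so almost every fibre of `B` is null or conull.
  have h01 : ∀ᵐ y : UnitAddCircle, g y = 0 ∨ g y = 1 := by
    filter_upwards [hslice (1 / b)] with y hy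
    rw [mul_one_div, mul_one_div, div_self hb] at hy
    have h1 : ((1 : ℝ) : UnitAddCircle) = 0 := AddCircle.coe_period 1
    rw [h1, sub_zero] at hy
    rcases ae_empty_or_univ_of_sub_irrational hab (hBm y) hy with h2 | h2
    · left; simp only [hg]; rw [measure_congr h2, measure_empty]
    · right; simp only [hg]; rw [measure_congr h2, measure_univ]
  set E : Set UnitAddCircle := {y | g y = 1} with hE
  have hEm : MeasurableSet E := hgm (measurableSet_singleton 1)
  -- The time `√2 / b` rotates the base by an irrational; the accompanying rotation of the fibre
  -- does not affect its measure. Thus two single times suffice for ergodicity.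
  have hEinv : (fun y => y - ((√2 : ℝ) : UnitAddCircle)) ⁻¹' E =ᵐ[volume] E := by
    filter_upwards [hslice (√2 / b)] with y hy
    rw [mul_div_cancel₀ _ hb] at hy
    change (g (y - _) = 1) = (g y = 1)
    simp only [hg]
    rw [← measure_congr hy, (measurePreserving_sub_right (volume : Measure UnitAddCircle)
      ((a * (√2 / b) : ℝ) : UnitAddCircle)).measure_preimage (hBm _).nullMeasurableSet]
  have hBg : torusMeasure B = ∫⁻ y, g y := Measure.prod_apply hB
  rcases ae_empty_or_univ_of_sub_irrational irrational_sqrt_two hEm hEinv with h2 | h2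
  · left
    rw [hBg, lintegral_congr_ae (g := fun _ => 0), lintegral_zero]
    filter_upwards [h2, h01] with y h3 h4
    rcases h4 with h4 | h4
    · exact h4
    · have h5 : y ∈ (∅ : Set UnitAddCircle) := by rw [← show (y ∈ E) = (y ∈ (∅ : Set UnitAddCircle)) from h3]; exact h4
      exact h5.elim
  · right
    rw [hBg, lintegral_congr_ae (g := fun _ => 1), lintegral_one, measure_univ]
    filter_upwards [h2] with y h3
    have h5 : y ∈ E := by rw [show (y ∈ E) = (y ∈ univ) from h3]; trivial
    exact h5

end TorusErgodic

/-! ## Transferring linear flows to a standard atomless probability space -/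

section Transfer

variable {X : Type*} [MeasurableSpace X] {μ : Measure X}

theorem AutMeas.pt_mul (S T : AutMeas μ) : (S * T).pt =ᵐ[μ] S.pt ∘ T.pt := by
  have h := AutMeas.pt_mk (S.rep * T.rep)
  rw [AutMeas.mk_mul, S.mk_rep, T.mk_rep] at h
  exact h

variable (μ) in
/-- An almost everywhere isomorphism with the two-dimensional torus. -/
structure TorusIso where
  /-- the map to the torus -/
  toTorus : X → UnitAddCircle × UnitAddCircle
  /-- the map from the torus -/
  ofTorus : UnitAddCircle × UnitAddCircle → X
  measurePreserving_to : MeasurePreserving toTorus μ torusMeasure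
  measurePreserving_of : MeasurePreserving ofTorus torusMeasure μ
  of_to : ∀ᵐ x ∂μ, ofTorus (toTorus x) = x
  to_of : ∀ᵐ z ∂torusMeasure, toTorus (ofTorus z) = z

variable (μ) in
theorem nonempty_torusIso [StandardBorelSpace X] [IsProbabilityMeasure μ] [NullSingletonClass μ] :
    Nonempty (TorusIso μ) := by
  obtain ⟨S, R, hS, hR, h1, h2⟩ := exists_ae_iso μ torusMeasure
  exact ⟨⟨S, R, hS, hR, h1, h2⟩⟩

variable (Θ : TorusIso μ)

/-- A translation of the torus as a map of the space. -/
def TorusIso.trans (v : UnitAddCircle × UnitAddCircle) (x : X) : X := Θ.ofTorus (Θ.toTorus x - v)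

theorem TorusIso.measurePreserving_trans (v : UnitAddCircle × UnitAddCircle) :
    MeasurePreserving (Θ.trans v) μ μ :=
  Θ.measurePreserving_of.comp ((measurePreserving_sub_torus v).comp Θ.measurePreserving_to)

theorem TorusIso.trans_trans (v w : UnitAddCircle × UnitAddCircle) :
    ∀ᵐ x ∂μ, Θ.trans v (Θ.trans w x) = Θ.trans (v + w) x := by
  filter_upwards [((measurePreserving_sub_torus w).comp
    Θ.measurePreserving_to).quasiMeasurePreserving.ae Θ.to_of] with x hx
  simp only [TorusIso.trans]
  rw [show Θ.toTorus (Θ.ofTorus (Θ.toTorus x - w)) = Θ.toTorus x - w from hx, sub_sub, add_comm w]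

theorem TorusIso.trans_zero : ∀ᵐ x ∂μ, Θ.trans 0 x = x := by
  filter_upwards [Θ.of_to] with x hx
  simp [TorusIso.trans, hx]

theorem TorusIso.preimage_preimage (A : Set X) :
    Θ.toTorus ⁻¹' (Θ.ofTorus ⁻¹' A) =ᵐ[μ] A := by
  filter_upwards [Θ.of_to] with x hx
  change (Θ.ofTorus (Θ.toTorus x) ∈ A) = (x ∈ A)
  rw [hx]

variable [StandardBorelSpace X]

theorem TorusIso.exists_aut (v : UnitAddCircle × UnitAddCircle) :
    ∃ T : AutMeas μ, T⁻¹.pt =ᵐ[μ] Θ.trans v := by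
  obtain ⟨f, hf, hf'⟩ := exists_mpPerm_of_ae_inverse (Θ.measurePreserving_trans (-v))
    (Θ.measurePreserving_trans v)
    (by filter_upwards [Θ.trans_trans v (-v), Θ.trans_zero] with x h1 h2
        rw [h1, add_neg_cancel, h2])
    (by filter_upwards [Θ.trans_trans (-v) v, Θ.trans_zero] with x h1 h2
        rw [h1, neg_add_cancel, h2])
  exact ⟨AutMeas.mk f, (AutMeas.pt_mk f⁻¹).trans hf'⟩

/-- The automorphism given by a translation of the torus. -/
noncomputable def TorusIso.aut (v : UnitAddCircle × UnitAddCircle) : AutMeas μ :=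
  (Θ.exists_aut v).choose

theorem TorusIso.pt_inv_aut (v : UnitAddCircle × UnitAddCircle) :
    (Θ.aut v)⁻¹.pt =ᵐ[μ] Θ.trans v :=
  (Θ.exists_aut v).choose_spec

theorem TorusIso.aut_add (v w : UnitAddCircle × UnitAddCircle) :
    Θ.aut (v + w) = Θ.aut v * Θ.aut w := by
  rw [← inv_inj, mul_inv_rev]
  refine AutMeas.ext_of_pt ?_
  filter_upwards [Θ.pt_inv_aut (v + w), AutMeas.pt_mul (Θ.aut w)⁻¹ (Θ.aut v)⁻¹, Θ.pt_inv_aut v,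
    (Θ.measurePreserving_trans v).quasiMeasurePreserving.ae (Θ.pt_inv_aut w),
    Θ.trans_trans w v] with x h1 h2 h3 h4 h5
  rw [h1, h2, Function.comp_apply, h3, h4, h5, add_comm]

theorem TorusIso.img_aut_preimage (v : UnitAddCircle × UnitAddCircle)
    (B : Set (UnitAddCircle × UnitAddCircle)) :
    (Θ.aut v).img (Θ.toTorus ⁻¹' B) =ᵐ[μ] Θ.toTorus ⁻¹' ((fun z => z - v) ⁻¹' B) := by
  refine (AutMeas.img_eq _ _).trans ?_
  filter_upwards [Θ.pt_inv_aut v, ((measurePreserving_sub_torus v).comp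
    Θ.measurePreserving_to).quasiMeasurePreserving.ae Θ.to_of] with x h1 h2
  change (Θ.toTorus ((Θ.aut v)⁻¹.pt x) ∈ B) = (Θ.toTorus x - v ∈ B)
  rw [h1]
  exact congrArg (· ∈ B) h2

theorem TorusIso.setDist_img_aut (v : UnitAddCircle × UnitAddCircle)
    {B C : Set (UnitAddCircle × UnitAddCircle)} (hB : MeasurableSet B) (hC : MeasurableSet C) :
    setDist μ ((Θ.aut v).img (Θ.toTorus ⁻¹' B)) (Θ.toTorus ⁻¹' C) =
      setDist torusMeasure ((fun z => z - v) ⁻¹' B) C := by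
  rw [setDist_congr_left (Θ.img_aut_preimage v B)]
  exact setDist_preimage Θ.measurePreserving_to
    ((measurePreserving_sub_torus v).measurable hB) hC

theorem continuous_setDist_sub_torus {B : Set (UnitAddCircle × UnitAddCircle)}
    (hB : MeasurableSet B) (w : UnitAddCircle × UnitAddCircle) :
    Filter.Tendsto (fun v => setDist torusMeasure ((fun z => z - v) ⁻¹' B) ((fun z => z - w) ⁻¹' B))
      (𝓝 w) (𝓝 0) := by
  have hc : Continuous fun v : UnitAddCircle × UnitAddCircle =>
      (⟨fun z => z - v, by fun_prop⟩ : C(UnitAddCircle × UnitAddCircle,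
        UnitAddCircle × UnitAddCircle)) :=
    ContinuousMap.continuous_of_continuous_uncurry _ (by
      change Continuous fun p : (UnitAddCircle × UnitAddCircle) × (UnitAddCircle × UnitAddCircle) =>
        p.2 - p.1
      fun_prop)
  have := tendsto_measure_symmDiff_preimage_nhds_zero (hc.tendsto w)
    (.of_forall fun v => measurePreserving_sub_torus v) (measurePreserving_sub_torus w)
    hB.nullMeasurableSet (measure_ne_top torusMeasure B)
  exact (ENNReal.tendsto_toReal_zero_iff (fun v => measure_ne_top _ _)).2 this

variable [IsProbabilityMeasure μ]

theorem TorusIso.continuous_aut : Continuous Θ.aut := by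
  refine continuous_iff_continuousAt.2 fun w => AutMeas.tendsto_iff.2 fun A hA => ?_
  have hB := Θ.measurePreserving_of.measurable hA
  refine (continuous_setDist_sub_torus hB w).congr fun v => ?_
  rw [← Θ.setDist_img_aut v hB ((measurePreserving_sub_torus w).measurable hB)]
  rw [setDist_congr_left ((Θ.aut v).img_ae_congr (Θ.preimage_preimage A)),
    ← setDist_congr_right (Θ.img_aut_preimage w _),
    setDist_congr_right ((Θ.aut w).img_ae_congr (Θ.preimage_preimage A))]

/-- The direction `(b s, a s)` of a linear flow. -/
def linearDir (a b s : ℝ) : UnitAddCircle × UnitAddCircle :=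
  (((b * s : ℝ) : UnitAddCircle), ((a * s : ℝ) : UnitAddCircle))

theorem linearDir_add (a b s t : ℝ) : linearDir a b (s + t) = linearDir a b s + linearDir a b t := by
  simp [linearDir, mul_add]

theorem continuous_linearDir (a b : ℝ) : Continuous (linearDir a b) := by
  unfold linearDir
  exact ((AddCircle.continuous_mk' (1 : ℝ)).comp (by fun_prop)).prodMk
    ((AddCircle.continuous_mk' (1 : ℝ)).comp (by fun_prop))

/-- A linear flow of the torus, transferred to a standard atomless probability space. -/
noncomputable def TorusIso.linearFlow (a b : ℝ) : MPAct (Multiplicative ℝ) μ where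
  toFun s := Θ.aut (linearDir a b s.toAdd)
  map_one' := by
    have h := Θ.aut_add 0 0
    rw [add_zero, right_eq_mul] at h
    change Θ.aut (linearDir a b 0) = 1
    rw [← h]
    congr 1
    simp [linearDir, Prod.ext_iff]
  map_mul' s t := by rw [toAdd_mul, linearDir_add, Θ.aut_add]
  continuous_toFun := Θ.continuous_aut.comp ((continuous_linearDir a b).comp continuous_toAdd)

theorem TorusIso.linearFlow_apply (a b s : ℝ) :
    Θ.linearFlow a b (Multiplicative.ofAdd s) = Θ.aut (linearDir a b s) := rfl

theorem TorusIso.isErgodic_linearFlow {a b : ℝ} (hb : b ≠ 0) (hab : Irrational (a / b)) :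
    (Θ.linearFlow a b).IsErgodic := by
  intro A hA h
  have hB := Θ.measurePreserving_of.measurable hA
  rw [← Θ.measurePreserving_of.measure_preimage hA.nullMeasurableSet]
  refine torus_zero_or_one_of_invariant hb hab hB fun s => ?_
  have h1 := h (Multiplicative.ofAdd s)
  rw [AutMeas.imageDist_eq, setDist_congr_right (AutMeas.img_one A), Θ.linearFlow_apply] at h1
  rw [← setDist_eq_zero_iff, ← h1]
  refine (Θ.setDist_img_aut (linearDir a b s) hB hB).symm.trans ?_
  exact setDist_congr ((Θ.aut _).img_ae_congr (Θ.preimage_preimage A)) (Θ.preimage_preimage A)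

end Transfer

/-! ## Approximating a pair of flows by conjugates of a linear flow -/

section CircleRep

/-- The representative in `[0, 1)` of a point of the circle. -/
noncomputable def circleRep (y : UnitAddCircle) : ℝ := AddCircle.equivIco 1 0 y

theorem circleRep_mem (y : UnitAddCircle) : circleRep y ∈ Ico (0 : ℝ) 1 := by
  have h : circleRep y ∈ Ico (0 : ℝ) (0 + 1) := (AddCircle.equivIco 1 0 y).2
  rwa [zero_add] at h

theorem coe_circleRep (y : UnitAddCircle) : ((circleRep y : ℝ) : UnitAddCircle) = y :=
  AddCircle.coe_equivIco

theorem circleRep_coe {r : ℝ} (hr : r ∈ Ico (0 : ℝ) 1) : circleRep (r : UnitAddCircle) = r := by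
  have h1 : circleRep (r : UnitAddCircle) ∈ Ico (0 : ℝ) (0 + 1) :=
    (AddCircle.equivIco 1 0 (r : UnitAddCircle)).2
  rw [← zero_add (1 : ℝ)] at hr
  exact (AddCircle.coe_eq_coe_iff_of_mem_Ico h1 hr).1 (coe_circleRep _)

theorem circleRep_sub {y : UnitAddCircle} {c : ℝ} (h : circleRep y - c ∈ Ico (0 : ℝ) 1) :
    circleRep (y - (c : UnitAddCircle)) = circleRep y - c := by
  rw [← circleRep_coe h, AddCircle.coe_sub, coe_circleRep]

theorem measurable_circleRep : Measurable circleRep :=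
  measurable_subtype_coe.comp (AddCircle.measurableEquivIco 1 0).measurable

/-- Subtraction leaves `[0, 1)` only for representatives in `[0, c)` or in `[1 + c, 1)`, according
to the sign of `c`. -/
theorem volume_circleRep_sub_notMem_le (c : ℝ) :
    volume {y : UnitAddCircle | circleRep y - c ∉ Ico (0 : ℝ) 1} ≤ ENNReal.ofReal |c| := by
  have hm : MeasurableSet {y : UnitAddCircle | circleRep y - c ∉ Ico (0 : ℝ) 1} :=
    ((measurable_circleRep.sub_const c) measurableSet_Ico).compl
  have hsub : ((fun r : ℝ => (r : UnitAddCircle)) ⁻¹'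
      {y | circleRep y - c ∉ Ico (0 : ℝ) 1}) ∩ Ioo 0 1 ⊆ Ico 0 c ∪ Ico (1 + c) 1 := by
    rintro r ⟨h1, h2⟩
    simp only [mem_preimage, mem_ofPred_eq] at h1
    rw [circleRep_coe ⟨h2.1.le, h2.2⟩, mem_Ico, not_and_or, not_le, not_lt] at h1
    rcases h1 with h1 | h1
    · exact .inl ⟨h2.1.le, by linarith⟩
    · exact .inr ⟨by linarith, h2.2⟩
  have h2 := (UnitAddCircle.measurePreserving_mk 0).measure_preimage hm.nullMeasurableSet
  rw [zero_add] at h2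
  rw [← h2, ← restrict_Ioo_eq_restrict_Ioc, Measure.restrict_apply
    ((UnitAddCircle.measurePreserving_mk 0).measurable hm)]
  refine (measure_mono hsub).trans ((measure_union_le _ _).trans ?_)
  rw [Real.volume_Ico, Real.volume_Ico]
  rcases le_total 0 c with hc | hc
  · rw [abs_of_nonneg hc, ENNReal.ofReal_of_nonpos (by linarith : 1 - (1 + c) ≤ 0)]
    simp
  · rw [abs_of_nonpos hc, ENNReal.ofReal_of_nonpos (by linarith : c - 0 ≤ 0)]
    simp

theorem abs_floor_sub_floor_sub_le {N : ℕ} {r c : ℝ} (hr : 0 ≤ r) (hc : 0 ≤ r - c) :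
    |((⌊N * r⌋₊ : ℝ) - ⌊N * (r - c)⌋₊) - N * c| ≤ 1 := by
  have hN : (0 : ℝ) ≤ N := N.cast_nonneg
  have a1 := Nat.floor_le (mul_nonneg hN hr)
  have a2 := Nat.lt_floor_add_one (N * r)
  have b1 := Nat.floor_le (mul_nonneg hN hc)
  have b2 := Nat.lt_floor_add_one (N * (r - c))
  rw [abs_le]
  constructor <;> linarith

/-- Fubini: fibres over `Y` contribute at most `c`, the others at most the measure of `Yᶜ`. -/
theorem setDist_torus_le {P Q : Set (UnitAddCircle × UnitAddCircle)} (hP : MeasurableSet P)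
    (hQ : MeasurableSet Q) {Y : Set UnitAddCircle} (hY : MeasurableSet Y) {c r : ℝ} (hc : 0 ≤ c)
    (hr : 0 ≤ r) (hYr : volume Yᶜ ≤ ENNReal.ofReal r)
    (h : ∀ y ∈ Y, setDist volume (Prod.mk y ⁻¹' P) (Prod.mk y ⁻¹' Q) ≤ c) :
    setDist torusMeasure P Q ≤ c + r := by
  rw [setDist, measureReal_def]
  refine ENNReal.toReal_le_of_le_ofReal (by positivity) ?_
  rw [torusMeasure, Measure.prod_apply (hP.symmDiff hQ)]
  calc _ ≤ ∫⁻ y : UnitAddCircle, (ENNReal.ofReal c + Yᶜ.indicator 1 y) := by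
        refine lintegral_mono fun y => ?_
        by_cases hy : y ∈ Y
        · refine le_add_right ?_
          have := h y hy
          rw [setDist, ← preimage_symmDiff] at this
          exact (ENNReal.le_ofReal_iff_toReal_le (measure_ne_top _ _) hc).2 this
        · refine le_add_left ?_
          rw [indicator_of_mem (show y ∈ Yᶜ from hy)]
          exact prob_le_one
    _ = ENNReal.ofReal c + volume Yᶜ := by
        rw [lintegral_add_left measurable_const, lintegral_const, measure_univ, mul_one,
          lintegral_indicator_one hY.compl]
    _ ≤ ENNReal.ofReal (c + r) := by
        rw [ENNReal.ofReal_add hc hr]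
        gcongr

end CircleRep

/-! ### Interpolation between two sets over the circle -/

section Mix

variable {X : Type*} [MeasurableSpace X] {μ : Measure X} [IsProbabilityMeasure μ]
  {θ : UnitAddCircle → X × ℝ}

/-- The set which is `D` above the level `t` and `E` below it. -/
def mixSet (θ : UnitAddCircle → X × ℝ) (t : ℝ) (D E : Set X) : Set UnitAddCircle :=
  θ ⁻¹' (D ×ˢ Ioi t ∪ E ×ˢ Iic t)

omit [IsProbabilityMeasure μ] in
theorem measurableSet_mixSet (hθ : MeasurePreserving θ volume (μ.prod uniform01)) (t : ℝ)
    {D E : Set X} (hD : MeasurableSet D) (hE : MeasurableSet E) : MeasurableSet (mixSet θ t D E) :=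
  hθ.measurable ((hD.prod measurableSet_Ioi).union (hE.prod measurableSet_Iic))

theorem uniform01_real_Iic {t : ℝ} (h0 : 0 ≤ t) (h1 : t ≤ 1) : uniform01.real (Iic t) = t := by
  rw [measureReal_def, uniform01_Iic h1, ENNReal.toReal_ofReal h0]

theorem uniform01_real_Ioi {t : ℝ} (h0 : 0 ≤ t) (h1 : t ≤ 1) : uniform01.real (Ioi t) = 1 - t := by
  rw [← compl_Iic, probReal_compl_eq_one_sub measurableSet_Iic, uniform01_real_Iic h0 h1]

theorem uniform01_real_Ioc {s t : ℝ} (h0 : 0 ≤ s) (hst : s ≤ t) (h1 : t ≤ 1) :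
    uniform01.real (Ioc s t) = t - s := by
  have h : Ioc s t = Iic t \ Iic s := by
    ext u
    simp [and_comm]
  rw [h, measureReal_sdiff (Iic_subset_Iic.2 hst) measurableSet_Iic,
    uniform01_real_Iic (h0.trans hst) h1, uniform01_real_Iic h0 (hst.trans h1)]

theorem measureReal_mixSet (hθ : MeasurePreserving θ volume (μ.prod uniform01)) {t : ℝ}
    (h0 : 0 ≤ t) (h1 : t ≤ 1) {D E : Set X} (hD : MeasurableSet D) (hE : MeasurableSet E) :
    volume.real (mixSet θ t D E) = (1 - t) * μ.real D + t * μ.real E := by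
  rw [mixSet, hθ.measureReal_preimage
    ((hD.prod measurableSet_Ioi).union (hE.prod measurableSet_Iic)).nullMeasurableSet,
    measureReal_union _ (hE.prod measurableSet_Iic), measureReal_prod_prod, measureReal_prod_prod,
    uniform01_real_Ioi h0 h1, uniform01_real_Iic h0 h1, mul_comm, mul_comm (μ.real E)]
  rw [Set.disjoint_left]
  rintro ⟨x, u⟩ ⟨_, h2⟩ ⟨_, h3⟩
  exact absurd (show u ≤ t from h3) (not_le.2 (show t < u from h2))

/-- The parts above and below the level do not interact. This is the source of the convex
combinations in the later estimates. -/
theorem setDist_mixSet (hθ : MeasurePreserving θ volume (μ.prod uniform01)) {t : ℝ}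
    (h0 : 0 ≤ t) (h1 : t ≤ 1) {D E D' E' : Set X} (hD : MeasurableSet D) (hE : MeasurableSet E)
    (hD' : MeasurableSet D') (hE' : MeasurableSet E') :
    setDist volume (mixSet θ t D E) (mixSet θ t D' E') =
      (1 - t) * setDist μ D D' + t * setDist μ E E' := by
  rw [setDist, setDist, setDist, ← measureReal_mixSet hθ h0 h1 (hD.symmDiff hD') (hE.symmDiff hE')]
  congr 1
  ext x
  simp only [mixSet, mem_preimage, mem_symmDiff, mem_union, mem_prod, mem_Ioi, mem_Iic]
  rcases lt_or_ge t (θ x).2 with h | h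
  · simp [h, not_le.2 h]
  · simp [h, not_lt.2 h]

end Mix

/-! ### The interpolating maps from the torus -/

section MixMap

variable {X : Type*} [MeasurableSpace X] {μ : Measure X}
  {θ : UnitAddCircle → X × ℝ} (α β : MPAct (Multiplicative ℝ) μ) (N : ℕ) (δ t : ℝ)

/-- The map which at height `y` follows the flow `α` (above the level `t`) or `β` (below it) for
the time `δ ⌊N y⌋`. -/
noncomputable def mixMap (θ : UnitAddCircle → X × ℝ) (z : UnitAddCircle × UnitAddCircle) : X :=
  open Classical in
  if t < (θ z.2).2 then (α (.ofAdd (⌊N * circleRep z.1⌋₊ * δ))).pt (θ z.2).1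
  else (β (.ofAdd (⌊N * circleRep z.1⌋₊ * δ))).pt (θ z.2).1

/-- A slice of the preimage of a set under `mixMap`. -/
noncomputable def mixSlice (θ : UnitAddCircle → X × ℝ) (A : Set X) (j : ℕ) : Set UnitAddCircle :=
  mixSet θ t ((α (.ofAdd (j * δ))).pt ⁻¹' A) ((β (.ofAdd (j * δ))).pt ⁻¹' A)

theorem mk_preimage_mixMap (A : Set X) (y : UnitAddCircle) :
    Prod.mk y ⁻¹' (mixMap α β N δ t θ ⁻¹' A) = mixSlice α β δ t θ A ⌊N * circleRep y⌋₊ := by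
  ext x
  simp only [mixSlice, mixSet, mixMap, mem_preimage, mem_union, mem_prod, mem_Ioi, mem_Iic]
  split_ifs with h
  · simp [h, not_le.2 h]
  · simp [h, not_lt.1 h]

variable [IsProbabilityMeasure μ] (hθ : MeasurePreserving θ volume (μ.prod uniform01))
include hθ

omit [IsProbabilityMeasure μ] in
theorem measurableSet_mixSlice {A : Set X} (hA : MeasurableSet A) (j : ℕ) :
    MeasurableSet (mixSlice α β δ t θ A j) :=
  measurableSet_mixSet hθ t ((AutMeas.measurePreserving_pt _).measurable hA)
    ((AutMeas.measurePreserving_pt _).measurable hA)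

omit [IsProbabilityMeasure μ] in
theorem measurable_mixMap : Measurable (mixMap α β N δ t θ) := by
  intro A hA
  have : mixMap α β N δ t θ ⁻¹' A =
      ⋃ j : ℕ, {y | ⌊N * circleRep y⌋₊ = j} ×ˢ mixSlice α β δ t θ A j := by
    ext ⟨y, x⟩
    have h := Set.ext_iff.1 (mk_preimage_mixMap (θ := θ) α β N δ t A y) x
    simp only [mem_iUnion, mem_prod, mem_ofPred_eq, exists_eq_left']
    exact h
  rw [this]
  refine MeasurableSet.iUnion fun j => MeasurableSet.prod ?_ (measurableSet_mixSlice α β δ t hθ hA j)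
  exact (Nat.measurable_floor.comp (measurable_circleRep.const_mul _)) (measurableSet_singleton j)

variable {t} (h0 : 0 ≤ t) (h1 : t ≤ 1)
include h0 h1

/-- Over each `y` the time is constant, so the fibre of the preimage of `A` has measure `(1 - t)
μ(A) + t μ(A)`. -/
theorem measurePreserving_mixMap : MeasurePreserving (mixMap α β N δ t θ) torusMeasure μ := by
  have hm := measurable_mixMap α β N δ t hθ
  refine ⟨hm, Measure.ext fun A hA => ?_⟩
  rw [Measure.map_apply hm hA, torusMeasure, Measure.prod_apply (hm hA)]
  have : ∀ y : UnitAddCircle, volume (Prod.mk y ⁻¹' (mixMap α β N δ t θ ⁻¹' A)) = μ A := by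
    intro y
    have hp := fun T : AutMeas μ => T.measurePreserving_pt.measureReal_preimage hA.nullMeasurableSet
    have h2 := measureReal_mixSet hθ h0 h1
      ((AutMeas.measurePreserving_pt (α (.ofAdd (⌊N * circleRep y⌋₊ * δ)))).measurable hA)
      ((AutMeas.measurePreserving_pt (β (.ofAdd (⌊N * circleRep y⌋₊ * δ)))).measurable hA)
    rw [hp, hp, ← add_mul, sub_add_cancel, one_mul] at h2
    rw [mk_preimage_mixMap]
    exact (measureReal_eq_measureReal_iff (measure_ne_top _ _) (measure_ne_top _ _)).1 h2
  simp [this]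

/-- For either flow `γ`, comparing `γ_{-iδ}(A)` with `γ_{-jδ}(B)` is comparing `γ_{(j-i)δ}(A)` with
`B`. The time `(j - i)δ` is within one step `δ` of `s`, which costs `η`. -/
theorem setDist_mixSlice_le {A B : Set X} (hA : MeasurableSet A) (hB : MeasurableSet B) {s η : ℝ}
    {i j : ℕ} (hij : |((j : ℝ) - i) * δ - s| ≤ δ)
    (hα : ∀ r, |r| ≤ δ → setDist μ ((α (.ofAdd r)).img A) A ≤ η)
    (hβ : ∀ r, |r| ≤ δ → setDist μ ((β (.ofAdd r)).img A) A ≤ η) :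
    setDist volume (mixSlice α β δ t θ A i) (mixSlice α β δ t θ B j) ≤
      (1 - t) * setDist μ ((α (.ofAdd s)).img A) B + t * setDist μ ((β (.ofAdd s)).img A) B + η := by
  have key : ∀ γ : MPAct (Multiplicative ℝ) μ,
      (∀ r, |r| ≤ δ → setDist μ ((γ (.ofAdd r)).img A) A ≤ η) →
      setDist μ ((γ (.ofAdd (i * δ))).pt ⁻¹' A) ((γ (.ofAdd (j * δ))).pt ⁻¹' B) ≤
        setDist μ ((γ (.ofAdd s)).img A) B + η := by
    intro γ hγ
    have e1 : setDist μ ((γ (.ofAdd (i * δ))).pt ⁻¹' A) ((γ (.ofAdd (j * δ))).pt ⁻¹' B) =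
        setDist μ ((γ (.ofAdd s * .ofAdd ((j - i) * δ - s))).img A) B := by
      rw [← setDist_congr (AutMeas.img_inv_eq _ A) (AutMeas.img_inv_eq _ B), setDist_comm,
        AutMeas.setDist_img_left _ hB (AutMeas.measurableSet_img _ hA), inv_inv, setDist_comm,
        ← setDist_congr_left (AutMeas.img_mul _ _ A), ← γ.map_inv, ← γ.map_mul]
      congr 3
      rw [← ofAdd_neg, ← ofAdd_add, ← ofAdd_add]
      congr 1
      ring_nf
    rw [e1, γ.map_mul, setDist_congr_left (AutMeas.img_mul _ _ A)]
    refine (setDist_triangle _ ((γ (.ofAdd s)).img A) _).trans ?_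
    rw [AutMeas.setDist_img _ (AutMeas.measurableSet_img _ hA) hA, add_comm]
    gcongr
    exact hγ _ hij
  rw [mixSlice, mixSlice, setDist_mixSet hθ h0 h1
    ((AutMeas.measurePreserving_pt _).measurable hA) ((AutMeas.measurePreserving_pt _).measurable hA)
    ((AutMeas.measurePreserving_pt _).measurable hB) ((AutMeas.measurePreserving_pt _).measurable hB)]
  have k1 := mul_le_mul_of_nonneg_left (key α hα) (sub_nonneg.2 h1)
  have k2 := mul_le_mul_of_nonneg_left (key β hβ) h0
  linarith

/-- Moving for time `s` lowers `y` by `s / L`, hence the elapsed time of the flow by about `s`. The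
three errors `η` come from the translation by `a s` in the fibre, from the rounding of time to
multiples of `L / N`, and from the points `y` that wrap around. -/
theorem setDist_mixMap_le {A B : Set X} (hA : MeasurableSet A) (hB : MeasurableSet B) {a L s η : ℝ}
    (hL : 0 < L) (hN : 0 < N) (hη : 0 ≤ η)
    (hα : ∀ r, |r| ≤ L / N → setDist μ ((α (.ofAdd r)).img A) A ≤ η)
    (hβ : ∀ r, |r| ≤ L / N → setDist μ ((β (.ofAdd r)).img A) A ≤ η)
    (ha : ∀ j ≤ N, setDist volume ((fun x => x - ((a * s : ℝ) : UnitAddCircle)) ⁻¹'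
      mixSlice α β (L / N) t θ A j) (mixSlice α β (L / N) t θ A j) ≤ η)
    (hs : |L⁻¹ * s| ≤ η) :
    setDist torusMeasure ((fun z => z - linearDir a L⁻¹ s) ⁻¹' (mixMap α β N (L / N) t θ ⁻¹' A))
      (mixMap α β N (L / N) t θ ⁻¹' B) ≤
      (1 - t) * setDist μ ((α (.ofAdd s)).img A) B + t * setDist μ ((β (.ofAdd s)).img A) B +
        3 * η := by
  have hm := measurable_mixMap α β N (L / N) t hθ
  have hN' : (0 : ℝ) < N := by exact_mod_cast hN
  have ht : 0 ≤ 1 - t := sub_nonneg.2 h1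
  have hd1 := setDist_nonneg (μ := μ) ((α (.ofAdd s)).img A) B
  have hd2 := setDist_nonneg (μ := μ) ((β (.ofAdd s)).img A) B
  refine (setDist_torus_le ((measurePreserving_sub_torus _).measurable (hm hA)) (hm hB)
    (Y := {y | circleRep y - L⁻¹ * s ∈ Ico (0 : ℝ) 1})
    ((measurable_circleRep.sub_const _) measurableSet_Ico) (by positivity) (abs_nonneg _)
    (volume_circleRep_sub_notMem_le (L⁻¹ * s))
    (c := (1 - t) * setDist μ ((α (.ofAdd s)).img A) B + t * setDist μ ((β (.ofAdd s)).img A) B +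
        2 * η) fun y hy => ?_).trans (by linarith)
  have hy' : circleRep y - L⁻¹ * s ∈ Ico (0 : ℝ) 1 := hy
  have e1 : Prod.mk y ⁻¹' ((fun z => z - linearDir a L⁻¹ s) ⁻¹' (mixMap α β N (L / N) t θ ⁻¹' A)) =
      (fun x => x - ((a * s : ℝ) : UnitAddCircle)) ⁻¹'
        mixSlice α β (L / N) t θ A ⌊N * (circleRep y - L⁻¹ * s)⌋₊ := by
    rw [← circleRep_sub hy', ← mk_preimage_mixMap]
    rfl
  rw [e1, mk_preimage_mixMap]
  refine (setDist_triangle _ (mixSlice α β (L / N) t θ A ⌊N * (circleRep y - L⁻¹ * s)⌋₊) _).trans ?_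
  have h2 := ha ⌊N * (circleRep y - L⁻¹ * s)⌋₊ (Nat.floor_le_of_le (by
    have := hy'.2
    nlinarith))
  have h3 := setDist_mixSlice_le α β (L / N) hθ h0 h1 hA hB (s := s)
    (i := ⌊N * (circleRep y - L⁻¹ * s)⌋₊) (j := ⌊N * circleRep y⌋₊) (η := η) ?_ hα hβ
  · linarith
  · have h4 := abs_floor_sub_floor_sub_le (N := N) (circleRep_mem y).1 hy'.1
    have h5 := mul_le_mul_of_nonneg_right h4 (div_nonneg hL.le hN'.le)
    rw [one_mul, ← abs_of_nonneg (div_nonneg hL.le hN'.le), ← abs_mul,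
      abs_of_nonneg (div_nonneg hL.le hN'.le)] at h5
    have h6 : N * (L⁻¹ * s) * (L / N) = s := by field_simp
    rwa [sub_mul, h6] at h5

-- At time `L` the base coordinate is back exactly, so neither rounding nor wrapping intervenes;
-- only the translation by `a L` in the fibre remains.
omit [IsProbabilityMeasure μ] h0 h1 in
theorem setDist_mixMap_period_le {A : Set X} (hA : MeasurableSet A) {a L η : ℝ}
    (hL : 0 < L) (hη : 0 ≤ η)
    (ha : ∀ j ≤ N, setDist volume ((fun x => x - ((a * L : ℝ) : UnitAddCircle)) ⁻¹'
      mixSlice α β (L / N) t θ A j) (mixSlice α β (L / N) t θ A j) ≤ η) :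
    setDist torusMeasure ((fun z => z - linearDir a L⁻¹ L) ⁻¹' (mixMap α β N (L / N) t θ ⁻¹' A))
      (mixMap α β N (L / N) t θ ⁻¹' A) ≤ η := by
  have hm := measurable_mixMap α β N (L / N) t hθ
  have h := setDist_torus_le ((measurePreserving_sub_torus (linearDir a L⁻¹ L)).measurable (hm hA))
    (hm hA) MeasurableSet.univ hη le_rfl (by simp) fun y _ => ?_
  · simpa using h
  have e1 : Prod.mk y ⁻¹' ((fun z => z - linearDir a L⁻¹ L) ⁻¹' (mixMap α β N (L / N) t θ ⁻¹' A)) =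
      (fun x => x - ((a * L : ℝ) : UnitAddCircle)) ⁻¹'
        mixSlice α β (L / N) t θ A ⌊N * circleRep y⌋₊ := by
    have h2 : y = y - ((L⁻¹ * L : ℝ) : UnitAddCircle) := by
      rw [inv_mul_cancel₀ hL.ne', AddCircle.coe_period 1, sub_zero]
    conv_rhs => rw [h2, ← mk_preimage_mixMap]
    rfl
  rw [e1, mk_preimage_mixMap]
  exact ha _ (Nat.floor_le_of_le (by
    have := (circleRep_mem y).2
    have : (0 : ℝ) ≤ N := N.cast_nonneg
    nlinarith))

-- The two maps differ only where the level coordinate of `θ` lies in `(t, t']`, whatever the set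
-- `A`.
omit h1 in
theorem setDist_mixMap_mixMap_le {t' : ℝ} (htt' : t ≤ t') (h1' : t' ≤ 1) (A : Set X) :
    setDist torusMeasure (mixMap α β N δ t θ ⁻¹' A) (mixMap α β N δ t' θ ⁻¹' A) ≤ t' - t := by
  have hsub : (mixMap α β N δ t θ ⁻¹' A) ∆ (mixMap α β N δ t' θ ⁻¹' A) ⊆
      univ ×ˢ (θ ⁻¹' (univ ×ˢ Ioc t t')) := by
    intro z hz
    refine ⟨trivial, trivial, ?_⟩
    by_contra hc
    have : mixMap α β N δ t θ z = mixMap α β N δ t' θ z := by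
      simp only [mixMap]
      rw [mem_Ioc, not_and_or, not_lt, not_le] at hc
      rcases hc with hc | hc
      · rw [if_neg (not_lt.2 hc), if_neg (not_lt.2 (hc.trans htt'))]
      · rw [if_pos (htt'.trans_lt hc), if_pos hc]
    rcases hz with ⟨h2, h3⟩ | ⟨h2, h3⟩
    · exact h3 (by rw [mem_preimage, ← this]; exact h2)
    · exact h3 (by rw [mem_preimage, this]; exact h2)
  refine (measureReal_mono hsub).trans_eq ?_
  rw [torusMeasure, measureReal_prod_prod, probReal_univ, one_mul,
    hθ.measureReal_preimage (MeasurableSet.univ.prod measurableSet_Ioc).nullMeasurableSet,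
    measureReal_prod_prod, probReal_univ, one_mul, uniform01_real_Ioc h0 htt' h1']

end MixMap

/-! ### Choice of the parameters of the linear flow -/

section Approx

theorem tendsto_setDist_sub_circle {E : Set UnitAddCircle} (hE : MeasurableSet E) :
    Filter.Tendsto (fun c : ℝ => setDist volume ((fun x => x - (c : UnitAddCircle)) ⁻¹' E) E)
      (𝓝 0) (𝓝 0) := by
  have h1 := (continuous_setDist_sub_torus (MeasurableSet.univ.prod hE) 0).comp
    ((continuous_linearDir 1 0).tendsto' 0 0 (by simp [linearDir]))
  refine h1.congr fun c => ?_
  rw [← setDist_preimage (measurePreserving_snd (μ := (volume : Measure UnitAddCircle)))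
    ((measurePreserving_sub_right volume (c : UnitAddCircle)).measurable hE) hE]
  simp only [Function.comp, linearDir, sub_zero, torusMeasure]
  congr 1 <;> ext <;> simp

variable {X : Type*} [MeasurableSpace X] {μ : Measure X} [IsProbabilityMeasure μ]

theorem MPAct.tendsto_setDist_img_zero (α : MPAct (Multiplicative ℝ) μ) {A : Set X}
    (hA : MeasurableSet A) :
    Filter.Tendsto (fun r : ℝ => setDist μ ((α (.ofAdd r)).img A) A) (𝓝 0) (𝓝 0) := by
  have h : Continuous fun r : ℝ => setDist μ ((α (.ofAdd r)).img A) ((1 : AutMeas μ).img A) :=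
    AutMeas.continuous_setDist_img (α.continuous_coe.comp continuous_ofAdd) continuous_const hA hA
  have h2 : ∀ r : ℝ, setDist μ ((α (.ofAdd r)).img A) ((1 : AutMeas μ).img A) =
      setDist μ ((α (.ofAdd r)).img A) A := fun r => setDist_congr_right (AutMeas.img_one A)
  simp only [h2] at h
  refine h.tendsto' 0 0 ?_
  rw [ofAdd_zero, α.map_one, setDist_congr_left (AutMeas.img_one A), setDist_self]

variable [StandardBorelSpace X] [NullSingletonClass μ]

/-- Two flows can be approximated simultaneously by a linear flow of the torus, seen through two
measure-preserving maps which are joined by a chain of maps with small steps. -/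
theorem exists_linearFlow_approx (α β : MPAct (Multiplicative ℝ) μ) {Ω : Set (Set X)}
    (hΩ : Ω.Finite) (hm : ∀ A ∈ Ω, MeasurableSet A) (M : ℝ) {η : ℝ} (hη : 0 < η) {m : ℕ}
    (hm0 : 0 < m) :
    ∃ L₀ > 0, ∀ L ≥ L₀, ∃ ξ : MPErg (Multiplicative ℝ) μ, ∃ q : ℕ → X → X,
      (∀ k ≤ m, MeasurePreserving (q k) μ μ) ∧
      (∀ k ≤ m, ∀ A ∈ Ω, ∀ B, MeasurableSet B → ∀ s, |s| ≤ M →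
        setDist μ ((ξ.1 (.ofAdd s)).img (q k ⁻¹' A)) (q k ⁻¹' B) ≤
          (1 - k / m) * setDist μ ((α (.ofAdd s)).img A) B +
            k / m * setDist μ ((β (.ofAdd s)).img A) B + η) ∧
      (∀ k ≤ m, ∀ A ∈ Ω, setDist μ ((ξ.1 (.ofAdd L)).img (q k ⁻¹' A)) (q k ⁻¹' A) ≤ η) ∧
      (∀ k < m, ∀ C, MeasurableSet C → setDist μ (q k ⁻¹' C) (q (k + 1) ⁻¹' C) ≤ 1 / m) := by
  obtain ⟨θ, -, hθ, -⟩ := exists_ae_iso (volume : Measure UnitAddCircle) (μ.prod uniform01)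
  obtain ⟨Θ⟩ := nonempty_torusIso μ
  have hm0' : (0 : ℝ) < m := by exact_mod_cast hm0
  have hη3 : 0 < η / 3 := by positivity
  -- This makes `|s| / L ≤ η / 3` for `|s| ≤ M`, which bounds the measure of the points that wrap
  -- around.
  refine ⟨3 * (|M| + 1) / η, by positivity, fun L hL => ?_⟩
  have hL0 : 0 < L := lt_of_lt_of_le (by positivity) hL
  have hsmall : ∀ s, |s| ≤ M → |L⁻¹ * s| ≤ η / 3 := by
    intro s hs
    rw [abs_mul, abs_of_pos (inv_pos.2 hL0), inv_mul_le_iff₀ hL0]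
    have h1 : 3 * (|M| + 1) ≤ L * η := (div_le_iff₀ hη).1 hL
    have h2 := hs.trans (le_abs_self M)
    linarith
  have hev : ∀ᶠ r : ℝ in 𝓝 0, ∀ A ∈ Ω, setDist μ ((α (.ofAdd r)).img A) A ≤ η / 3 ∧
      setDist μ ((β (.ofAdd r)).img A) A ≤ η / 3 := by
    rw [Filter.eventually_all_finite hΩ]
    intro A hA
    exact ((α.tendsto_setDist_img_zero (hm A hA)).eventually_le_const hη3).and
      ((β.tendsto_setDist_img_zero (hm A hA)).eventually_le_const hη3)
  obtain ⟨δ₀, hδ₀, hδ⟩ := Metric.eventually_nhds_iff.1 hev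
  simp only [dist_zero_right, Real.norm_eq_abs] at hδ
  -- The time step `L / N` is made shorter than the time in which `α` and `β` visibly move a set of
  -- `Ω`.
  obtain ⟨N, hN⟩ := exists_nat_gt (L / δ₀)
  have hN0' : (0 : ℝ) < N := lt_trans (by positivity) hN
  have hN0 : 0 < N := by exact_mod_cast hN0'
  have hLN : L / N < δ₀ := by rwa [div_lt_iff₀ hN0', mul_comm, ← div_lt_iff₀ hδ₀]
  have hev2 : ∀ᶠ c : ℝ in 𝓝 0, ∀ k ∈ Finset.range (m + 1), ∀ j ∈ Finset.range (N + 1), ∀ A ∈ Ω,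
      setDist volume ((fun x => x - (c : UnitAddCircle)) ⁻¹'
        mixSlice α β (L / N) (k / m) θ A j) (mixSlice α β (L / N) (k / m) θ A j) ≤ η / 3 := by
    rw [Filter.eventually_all_finset]
    intro k _
    rw [Filter.eventually_all_finset]
    intro j _
    rw [Filter.eventually_all_finite hΩ]
    intro A hA
    exact (tendsto_setDist_sub_circle (measurableSet_mixSlice α β _ _ hθ (hm A hA) j)
      ).eventually_le_const hη3
  obtain ⟨ε, hε, hε'⟩ := Metric.eventually_nhds_iff.1 hev2
  simp only [dist_zero_right, Real.norm_eq_abs, Finset.mem_range, Nat.lt_succ_iff] at hε'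
  -- The vertical speed is `a = √2 / (n L)`: the ratio of the two speeds is the irrational `√2 / n`,
  -- and `|a s| < ε` for all `|s| ≤ |M| + L`, which covers both `|s| ≤ M` and the period `L`. It is
  -- chosen after `N`, when only finitely many slices are left to control.
  obtain ⟨n, hn⟩ := exists_nat_gt (√2 * (|M| + L) / (L * ε))
  have hn0 : (0 : ℝ) < n := lt_of_le_of_lt (by positivity) hn
  have hn0' : n ≠ 0 := by rintro rfl; simp at hn0
  have ha : ∀ s, |s| ≤ |M| + L → |√2 / (n * L) * s| < ε := by
    intro s hs
    rw [div_lt_iff₀ (by positivity)] at hn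
    rw [abs_mul, abs_of_nonneg (by positivity), div_mul_eq_mul_div, div_lt_iff₀ (by positivity)]
    have := mul_le_mul_of_nonneg_left hs (Real.sqrt_nonneg 2)
    nlinarith
  have hirr : Irrational (√2 / (n * L) / L⁻¹) := by
    have : √2 / (n * L) / L⁻¹ = √2 / n := by field_simp
    rw [this]
    exact irrational_sqrt_two.div_natCast hn0'
  have hk : ∀ k ≤ m, 0 ≤ (k / m : ℝ) ∧ (k / m : ℝ) ≤ 1 := fun k hk =>
    ⟨by positivity, div_le_one_of_le₀ (by exact_mod_cast hk) hm0'.le⟩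
  have hq : ∀ k ≤ m, MeasurePreserving (mixMap α β N (L / N) (k / m) θ) torusMeasure μ :=
    fun k h => measurePreserving_mixMap α β N (L / N) hθ (hk k h).1 (hk k h).2
  refine ⟨⟨Θ.linearFlow (√2 / (n * L)) L⁻¹, Θ.isErgodic_linearFlow (inv_ne_zero hL0.ne') hirr⟩,
    fun k => mixMap α β N (L / N) (k / m) θ ∘ Θ.toTorus,
    fun k h => (hq k h).comp Θ.measurePreserving_to, ?_, ?_, ?_⟩
  · intro k h A hA B hB s hs
    rw [preimage_comp, preimage_comp, TorusIso.linearFlow_apply,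
      Θ.setDist_img_aut _ ((hq k h).measurable (hm A hA)) ((hq k h).measurable hB)]
    refine (setDist_mixMap_le α β N hθ (hk k h).1 (hk k h).2 (hm A hA) hB hL0 hN0 hη3.le
      (fun r hr => (hδ (hr.trans_lt hLN) A hA).1) (fun r hr => (hδ (hr.trans_lt hLN) A hA).2)
      (fun j hj => hε' (ha s ?_) k h j hj A hA) (hsmall s hs)).trans (by linarith)
    linarith [le_abs_self M]
  · intro k h A hA
    rw [preimage_comp, TorusIso.linearFlow_apply,
      Θ.setDist_img_aut _ ((hq k h).measurable (hm A hA)) ((hq k h).measurable (hm A hA))]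
    refine (setDist_mixMap_period_le α β N hθ (hm A hA) hL0 hη3.le
      (fun j hj => hε' (ha L ?_) k h j hj A hA)).trans (by linarith)
    rw [abs_of_pos hL0]
    linarith [abs_nonneg M]
  · intro k h C hC
    have h1 := setDist_mixMap_mixMap_le α β N (L / N) hθ (hk k h.le).1
      (div_le_div_of_nonneg_right (by simp : (k : ℝ) ≤ (k + 1 : ℕ)) hm0'.le) (hk (k + 1) h).2 C
    simp only [preimage_comp]
    rw [setDist_preimage Θ.measurePreserving_to ((hq k h.le).measurable hC)
      ((hq (k + 1) h).measurable hC)]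
    refine h1.trans_eq ?_
    push_cast
    ring

end Approx

/-! ## Neighbourhood bases -/

section Basis

variable {X : Type*} [MeasurableSpace X] {μ : Measure X}

theorem exists_pos_forall_add_le {ι : Type*} {Ω : Set ι} (hΩ : Ω.Finite) {f : ι → ℝ} {ε : ℝ}
    (h : ∀ i ∈ Ω, f i < ε) : ∃ δ > 0, ∀ i ∈ Ω, f i + δ ≤ ε := by
  have h1 : ∀ᶠ δ : ℝ in 𝓝[>] 0, ∀ i ∈ Ω, f i + δ ≤ ε := by
    rw [Filter.eventually_all_finite hΩ]
    intro i hi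
    filter_upwards [Ioo_mem_nhdsGT (sub_pos.2 (h i hi))] with δ hδ
    linarith [hδ.2]
  obtain ⟨δ, h2, h3⟩ := (h1.and self_mem_nhdsWithin).exists
  exact ⟨δ, h3, h2⟩

/-- Recentring: finitely many strict inequalities leave a common margin, and the triangle inequality
moves the centre to `T`. -/
theorem AutMeas.exists_basicNhd_subset [IsFiniteMeasure μ] {W : Set (AutMeas μ)} (hW : IsOpen W) :
    ∀ T ∈ W, ∃ (Ω : Set (Set X)) (ε : ℝ), Ω.Finite ∧ (∀ A ∈ Ω, MeasurableSet A) ∧ 0 < ε ∧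
      AutMeas.basicNhd T Ω ε ⊆ W := by
  induction hW with
  | basic s hs =>
    obtain ⟨α, Ω, ε, hΩ, hm, hε, rfl⟩ := hs
    intro T hT
    obtain ⟨δ, hδ, h⟩ := exists_pos_forall_add_le hΩ hT
    refine ⟨Ω, δ, hΩ, hm, hδ, fun S hS A hA => ?_⟩
    have h1 := h A hA
    have h2 := hS A hA
    rw [AutMeas.imageDist_eq] at *
    linarith [setDist_triangle (μ := μ) (S.img A) (T.img A) (α.img A)]
  | univ => exact fun T _ => ⟨∅, 1, finite_empty, by simp, one_pos, subset_univ _⟩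
  | inter s t _ _ h1 h2 =>
    intro T hT
    obtain ⟨Ω₁, ε₁, a1, a2, a3, a4⟩ := h1 T hT.1
    obtain ⟨Ω₂, ε₂, b1, b2, b3, b4⟩ := h2 T hT.2
    exact ⟨Ω₁ ∪ Ω₂, min ε₁ ε₂, a1.union b1, fun A hA => hA.elim (a2 A) (b2 A), lt_min a3 b3,
      fun S hS => ⟨a4 fun A hA => (hS A (.inl hA)).trans_le (min_le_left _ _),
        b4 fun A hA => (hS A (.inr hA)).trans_le (min_le_right _ _)⟩⟩
  | sUnion C _ h =>
    rintro T ⟨s, hs, hT⟩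
    obtain ⟨Ω, ε, a1, a2, a3, a4⟩ := h s hs T hT
    exact ⟨Ω, ε, a1, a2, a3, a4.trans (subset_sUnion_of_mem hs)⟩

/-- The flows which are `ε`-close to `α` on all sets in `Ω` at all times in `[-M, M]`. -/
def flowBall (α : MPAct (Multiplicative ℝ) μ) (M : ℝ) (Ω : Set (Set X)) (ε : ℝ) :
    Set (MPAct (Multiplicative ℝ) μ) :=
  {β | ∀ s : ℝ, |s| ≤ M → ∀ A ∈ Ω,
    setDist μ ((β (.ofAdd s)).img A) ((α (.ofAdd s)).img A) < ε}

theorem flowBall_eq (α : MPAct (Multiplicative ℝ) μ) (M : ℝ) (Ω : Set (Set X)) (ε : ℝ) :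
    flowBall α M Ω ε = MPAct.basicNhd α (Multiplicative.toAdd ⁻¹' Icc (-M) M) Ω ε := by
  ext β
  simp only [flowBall, MPAct.basicNhd, AutMeas.imageDist_eq, abs_le]
  rfl

theorem isCompact_toAdd_preimage {K : Set ℝ} (hK : IsCompact K) :
    IsCompact ((Multiplicative.toAdd : Multiplicative ℝ → ℝ) ⁻¹' K) := hK

theorem isOpen_flowBall (α : MPAct (Multiplicative ℝ) μ) (M : ℝ) {Ω : Set (Set X)}
    (hΩ : Ω.Finite) (hm : ∀ A ∈ Ω, MeasurableSet A) {ε : ℝ} (hε : 0 < ε) :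
    IsOpen (flowBall α M Ω ε) := by
  rw [flowBall_eq]
  exact MPAct.isOpen_basicNhd α (isCompact_toAdd_preimage isCompact_Icc) hΩ hm hε

theorem mem_flowBall_self (α : MPAct (Multiplicative ℝ) μ) (M : ℝ) (Ω : Set (Set X)) {ε : ℝ}
    (hε : 0 < ε) : α ∈ flowBall α M Ω ε := by
  intro s _ A _
  rwa [setDist_self]

theorem flowBall_mono {α : MPAct (Multiplicative ℝ) μ} {M M' : ℝ} {Ω Ω' : Set (Set X)} {ε ε' : ℝ}
    (hM : M ≤ M') (hΩ : Ω ⊆ Ω') (hε : ε' ≤ ε) : flowBall α M' Ω' ε' ⊆ flowBall α M Ω ε :=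
  fun _ hβ s hs A hA => (hβ s (hs.trans hM) A (hΩ hA)).trans_le hε

variable [IsFiniteMeasure μ]

theorem MPAct.exists_flowBall_subset {W : Set (MPAct (Multiplicative ℝ) μ)} (hW : IsOpen W) :
    ∀ α ∈ W, ∃ (M : ℝ) (Ω : Set (Set X)) (ε : ℝ), Ω.Finite ∧ (∀ A ∈ Ω, MeasurableSet A) ∧ 0 < ε ∧
      flowBall α M Ω ε ⊆ W := by
  induction hW with
  | basic s hs =>
    obtain ⟨τ, K, Ω, ε, hK, hΩ, hm, hε, rfl⟩ := hs
    intro α hα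
    have h1 : ∀ A : Set X, ∃ c : ℝ, A ∈ Ω → c < ε ∧
        ∀ s ∈ K, setDist μ ((α s).img A) ((τ s).img A) ≤ c := by
      intro A
      by_cases hA : A ∈ Ω
      · rcases K.eq_empty_or_nonempty with rfl | hne
        · exact ⟨0, fun _ => ⟨hε, by simp⟩⟩
        -- Infinitely many times are involved, so the margin comes from the maximum over the compact
        -- set `K`.
        · obtain ⟨s, hs, hmax⟩ := hK.exists_isMaxOn hne
            (AutMeas.continuous_setDist_img α.continuous_coe τ.continuous_coe (hm A hA)
              (hm A hA)).continuousOn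
          refine ⟨_, fun _ => ⟨?_, fun t ht => hmax ht⟩⟩
          exact (AutMeas.imageDist_eq A _ _).symm.trans_lt (hα s hs A hA)
      · exact ⟨0, fun h => absurd h hA⟩
    choose c hc using h1
    obtain ⟨δ, hδ, h⟩ := exists_pos_forall_add_le hΩ fun A hA => (hc A hA).1
    obtain ⟨M, hM⟩ := (hK.image continuous_toAdd).isBounded.exists_norm_le
    refine ⟨M, Ω, δ, hΩ, hm, hδ, fun β hβ s hs A hA => ?_⟩
    have h2 := hβ s.toAdd (hM _ (mem_image_of_mem _ hs)) A hA
    have h3 := (hc A hA).2 s hs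
    have h4 := h A hA
    rw [AutMeas.imageDist_eq]
    rw [ofAdd_toAdd] at h2
    linarith [setDist_triangle (μ := μ) ((β s).img A) ((α s).img A) ((τ s).img A)]
  | univ => exact fun T _ => ⟨0, ∅, 1, finite_empty, by simp, one_pos, subset_univ _⟩
  | inter s t _ _ h1 h2 =>
    intro T hT
    obtain ⟨M₁, Ω₁, ε₁, a1, a2, a3, a4⟩ := h1 T hT.1
    obtain ⟨M₂, Ω₂, ε₂, b1, b2, b3, b4⟩ := h2 T hT.2
    exact ⟨max M₁ M₂, Ω₁ ∪ Ω₂, min ε₁ ε₂, a1.union b1, fun A hA => hA.elim (a2 A) (b2 A),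
      lt_min a3 b3, subset_inter
        ((flowBall_mono (le_max_left _ _) subset_union_left (min_le_left _ _)).trans a4)
        ((flowBall_mono (le_max_right _ _) subset_union_right (min_le_right _ _)).trans b4)⟩
  | sUnion C _ h =>
    rintro T ⟨s, hs, hT⟩
    obtain ⟨M, Ω, ε, a1, a2, a3, a4⟩ := h s hs T hT
    exact ⟨M, Ω, ε, a1, a2, a3, a4.trans (subset_sUnion_of_mem hs)⟩

theorem MPErg.exists_flowBall_subset {W : Set (MPErg (Multiplicative ℝ) μ)} (hW : IsOpen W)
    {α : MPErg (Multiplicative ℝ) μ} (hα : α ∈ W) :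
    ∃ (M : ℝ) (Ω : Set (Set X)) (ε : ℝ), Ω.Finite ∧ (∀ A ∈ Ω, MeasurableSet A) ∧ 0 < ε ∧
      ∀ β : MPErg (Multiplicative ℝ) μ, β.1 ∈ flowBall α.1 M Ω ε → β ∈ W := by
  obtain ⟨W', hW', rfl⟩ := isOpen_induced_iff.1 hW
  obtain ⟨M, Ω, ε, h1, h2, h3, h4⟩ := MPAct.exists_flowBall_subset hW' α.1 hα
  exact ⟨M, Ω, ε, h1, h2, h3, fun β hβ => h4 hβ⟩

/-- The translates of a set over a compact interval of times are totally bounded. The net is needed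
because an automorphism imitates a measure-preserving map on finitely many sets only. -/
theorem MPAct.exists_finite_net (τ : MPAct (Multiplicative ℝ) μ) (M : ℝ) {Ω : Set (Set X)}
    (hΩ : Ω.Finite) (hm : ∀ A ∈ Ω, MeasurableSet A) {ε : ℝ} (hε : 0 < ε) :
    ∃ 𝓑 : Set (Set X), 𝓑.Finite ∧ (∀ B ∈ 𝓑, MeasurableSet B) ∧
      ∀ s : ℝ, |s| ≤ M → ∀ A ∈ Ω, ∃ B ∈ 𝓑, setDist μ ((τ (.ofAdd s)).img A) B < ε := by
  have h1 : ∀ s : ℝ, {r : ℝ | ∀ A ∈ Ω,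
      setDist μ ((τ (.ofAdd r)).img A) ((τ (.ofAdd s)).img A) < ε} ∈ 𝓝 s := by
    intro s
    change ∀ᶠ r in 𝓝 s, _
    rw [Filter.eventually_all_finite hΩ]
    intro A hA
    have h2 : Continuous fun r : ℝ => setDist μ ((τ (.ofAdd r)).img A) ((τ (.ofAdd s)).img A) :=
      AutMeas.continuous_setDist_img (τ.continuous_coe.comp continuous_ofAdd) continuous_const
        (hm A hA) (hm A hA)
    refine (h2.tendsto s).eventually_lt_const ?_
    rwa [setDist_self]
  obtain ⟨t, -, ht⟩ := (isCompact_Icc (a := -M) (b := M)).elim_nhds_subcover _ fun s _ => h1 s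
  refine ⟨image2 (fun s A => (τ (.ofAdd s)).img A) t Ω, t.finite_toSet.image2 _ hΩ, ?_, ?_⟩
  · rintro _ ⟨s, -, A, hA, rfl⟩
    exact AutMeas.measurableSet_img _ (hm A hA)
  · intro s hs A hA
    obtain ⟨r, hr, hsr⟩ := mem_iUnion₂.1 (ht (abs_le.1 hs))
    exact ⟨_, mem_image2_of_mem hr hA, hsr A hA⟩

end Basis

/-! ## Local orbits join nearby flows -/

section Key

variable {X : Type*} [MeasurableSpace X] {μ : Measure X} [IsProbabilityMeasure μ]

omit [IsProbabilityMeasure μ] in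
theorem AutMeas.setDist_img_conj (γ S : AutMeas μ) {A B : Set X} (hA : MeasurableSet A)
    (hB : MeasurableSet B) :
    setDist μ ((γ * S * γ⁻¹).img A) B = setDist μ (S.img (γ⁻¹.img A)) (γ⁻¹.img B) := by
  rw [mul_assoc, setDist_congr_left (AutMeas.img_mul _ _ A),
    AutMeas.setDist_img_left _ (AutMeas.measurableSet_img _ hA) hB,
    setDist_congr_left (AutMeas.img_mul _ _ A)]

variable [StandardBorelSpace X] [NullSingletonClass μ]

/-- Two flows can be approximated simultaneously by conjugates of one ergodic flow which is nearly
periodic with a prescribed large period, and the conjugates are joined by a chain of small steps. -/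
theorem exists_conj_approx (α β : MPAct (Multiplicative ℝ) μ)
    {T : Set (MPAct (Multiplicative ℝ) μ)} (hT : T.Finite) {Ω : Set (Set X)} (hΩ : Ω.Finite)
    (hm : ∀ A ∈ Ω, MeasurableSet A) (M : ℝ) {η : ℝ} (hη : 0 < η) {m : ℕ} (hm0 : 0 < m) :
    ∃ L₀, ∀ L ≥ L₀, ∃ ξ : MPErg (Multiplicative ℝ) μ, ∃ γ : ℕ → AutMeas μ,
      (∀ k ≤ m, ∀ τ ∈ T, ∀ s, |s| ≤ M → ∀ A ∈ Ω,
        setDist μ (((γ k • ξ).1 (.ofAdd s)).img A) ((τ (.ofAdd s)).img A) ≤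
          (1 - k / m) * setDist μ ((α (.ofAdd s)).img A) ((τ (.ofAdd s)).img A) +
            k / m * setDist μ ((β (.ofAdd s)).img A) ((τ (.ofAdd s)).img A) + η) ∧
      (∀ k ≤ m, ∀ A ∈ Ω, setDist μ (((γ k • ξ).1 (.ofAdd L)).img A) A ≤ η) ∧
      (∀ k < m, ∀ A ∈ Ω, setDist μ ((γ (k + 1) * (γ k)⁻¹).img A) A ≤ 1 / m) := by
  have hη3 : 0 < η / 3 := by positivity
  have hm0' : (0 : ℝ) < m := by exact_mod_cast hm0
  choose! 𝓑 h𝓑f h𝓑m h𝓑 using fun τ : MPAct (Multiplicative ℝ) μ => τ.exists_finite_net M hΩ hm hη3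
  -- Both the sets being moved and the approximate targets `τ_s(A)` must be carried correctly by the
  -- conjugators.
  set 𝓕 : Set (Set X) := Ω ∪ ⋃ τ ∈ T, 𝓑 τ with h𝓕
  have h𝓕f : 𝓕.Finite := hΩ.union (hT.biUnion fun τ _ => h𝓑f τ)
  have h𝓕m : ∀ A ∈ 𝓕, MeasurableSet A := by
    rintro A (hA | hA)
    · exact hm A hA
    · obtain ⟨τ, -, hA⟩ := mem_iUnion₂.1 hA
      exact h𝓑m τ A hA
  obtain ⟨L₀, -, h⟩ := exists_linearFlow_approx α β h𝓕f h𝓕m M hη3 hm0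
  refine ⟨L₀, fun L hL => ?_⟩
  obtain ⟨ξ, q, hq, h1, h2, h3⟩ := h L hL
  have h4 : ∀ k, ∃ γ : AutMeas μ, k ≤ m → ∀ A ∈ 𝓕, γ⁻¹.img A =ᵐ[μ] q k ⁻¹' A := by
    intro k
    by_cases hk : k ≤ m
    · obtain ⟨f, hf⟩ := exists_mpPerm_preimage_ae_eq (hq k hk) h𝓕f h𝓕m
      refine ⟨AutMeas.mk f, fun _ A hA => (AutMeas.img_inv_eq _ A).trans (.trans ?_ (hf A hA))⟩
      filter_upwards [AutMeas.pt_mk f] with x hx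
      change ((AutMeas.mk f).pt x ∈ A) = (_ ∈ A)
      rw [hx]
    · exact ⟨1, fun h => absurd h hk⟩
  choose γ hγ using h4
  have hΩ𝓕 : Ω ⊆ 𝓕 := subset_union_left
  refine ⟨ξ, γ, ?_, ?_, ?_⟩
  · intro k hk τ hτ s hs A hA
    obtain ⟨B, hB, hAB⟩ := h𝓑 τ s hs A hA
    have hB' : B ∈ 𝓕 := .inr (mem_biUnion hτ hB)
    have h5 := h1 k hk A (hΩ𝓕 hA) B (h𝓕m B hB') s hs
    rw [← setDist_congr (AutMeas.img_ae_congr _ (hγ k hk A (hΩ𝓕 hA))) (hγ k hk B hB'),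
      ← AutMeas.setDist_img_conj _ _ (hm A hA) (h𝓕m B hB')] at h5
    have h6 : setDist μ (((γ k • ξ).1 (.ofAdd s)).img A) B ≤ _ := h5
    have hk0 : (0 : ℝ) ≤ k / m := by positivity
    have hk1 : (0 : ℝ) ≤ 1 - k / m :=
      sub_nonneg.2 (div_le_one_of_le₀ (by exact_mod_cast hk) hm0'.le)
    have h7 := mul_le_mul_of_nonneg_left ((setDist_triangle (μ := μ) ((α (.ofAdd s)).img A)
      ((τ (.ofAdd s)).img A) B).trans (add_le_add_right hAB.le _)) hk1
    have h8 := mul_le_mul_of_nonneg_left ((setDist_triangle (μ := μ) ((β (.ofAdd s)).img A)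
      ((τ (.ofAdd s)).img A) B).trans (add_le_add_right hAB.le _)) hk0
    have h9 := setDist_triangle (μ := μ) (((γ k • ξ).1 (.ofAdd s)).img A) B
      ((τ (.ofAdd s)).img A)
    rw [setDist_comm B] at h9
    linarith
  · intro k hk A hA
    have h5 := h2 k hk A (hΩ𝓕 hA)
    rw [← setDist_congr (AutMeas.img_ae_congr _ (hγ k hk A (hΩ𝓕 hA))) (hγ k hk A (hΩ𝓕 hA)),
      ← AutMeas.setDist_img_conj _ _ (hm A hA) (hm A hA)] at h5
    exact h5.trans (by linarith)
  · intro k hk A hA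
    have h5 := h3 k hk A (hm A hA)
    rw [← setDist_congr (hγ k hk.le A (hΩ𝓕 hA)) (hγ (k + 1) hk A (hΩ𝓕 hA))] at h5
    rwa [setDist_congr_left (AutMeas.img_mul _ _ A),
      AutMeas.setDist_img_left _ (AutMeas.measurableSet_img _ (hm A hA)) (hm A hA)]

/-- The chain `γ k • ξ` runs from near `α` to near `β`. Its distance to `τ` is at most a convex
combination of two numbers below `ε / 2`, plus an error of at most `ε / 2`, so it stays in the
larger ball. The radius does not depend on `V`, which only dictates the number of steps. -/
theorem exists_mem_localOrbit {τ : MPAct (Multiplicative ℝ) μ} {M : ℝ} {Ω : Set (Set X)}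
    (hΩ : Ω.Finite) (hm : ∀ A ∈ Ω, MeasurableSet A) {ε : ℝ} (hε : 0 < ε)
    {α β : MPErg (Multiplicative ℝ) μ} (hα : α.1 ∈ flowBall τ M Ω (ε / 2))
    (hβ : β.1 ∈ flowBall τ M Ω (ε / 2)) {W₁ W₂ : Set (MPErg (Multiplicative ℝ) μ)}
    (hW₁ : IsOpen W₁) (hW₂ : IsOpen W₂) (hα' : α ∈ W₁) (hβ' : β ∈ W₂) {V : Set (AutMeas μ)}
    (hV : IsOpen V) (h1V : 1 ∈ V) :
    ∃ α' ∈ W₁, ∃ β' ∈ W₂, β' ∈ localOrbit α' {x | x.1 ∈ flowBall τ M Ω ε} V := by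
  obtain ⟨M₁, Ω₁, ε₁, a1, a2, a3, a4⟩ := MPErg.exists_flowBall_subset hW₁ hα'
  obtain ⟨M₂, Ω₂, ε₂, b1, b2, b3, b4⟩ := MPErg.exists_flowBall_subset hW₂ hβ'
  obtain ⟨Ω₃, ε₃, c1, c2, c3, c4⟩ := AutMeas.exists_basicNhd_subset hV 1 h1V
  obtain ⟨n, hn⟩ := exists_nat_gt (1 / ε₃)
  have hn0 : (0 : ℝ) < n := lt_trans (by positivity) hn
  have hn0' : 0 < n := by exact_mod_cast hn0
  have hnε : 1 / (n : ℝ) < ε₃ := (one_div_lt hn0 c3).2 hn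
  have hη : 0 < min (ε / 2) (min (ε₁ / 2) (ε₂ / 2)) := by positivity
  have hη1 : min (ε / 2) (min (ε₁ / 2) (ε₂ / 2)) ≤ ε / 2 := min_le_left _ _
  have hη2 : min (ε / 2) (min (ε₁ / 2) (ε₂ / 2)) ≤ ε₁ / 2 :=
    (min_le_right _ _).trans (min_le_left _ _)
  have hη3 : min (ε / 2) (min (ε₁ / 2) (ε₂ / 2)) ≤ ε₂ / 2 :=
    (min_le_right _ _).trans (min_le_right _ _)
  set η := min (ε / 2) (min (ε₁ / 2) (ε₂ / 2))
  -- Comparison with `τ` keeps the chain in the ball; comparison with `α` and `β` places its ends in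
  -- `W₁` and `W₂`.
  obtain ⟨L₀, h⟩ := exists_conj_approx α.1 β.1 (T := {τ, α.1, β.1}) (by simp)
    (Ω := Ω ∪ (Ω₁ ∪ (Ω₂ ∪ Ω₃))) (hΩ.union (a1.union (b1.union c1)))
    (by rintro A (h | h | h | h)
        exacts [hm A h, a2 A h, b2 A h, c2 A h]) (max M (max M₁ M₂)) hη hn0'
  obtain ⟨ξ, γ, h1, -, h3⟩ := h L₀ le_rfl
  have hball : ∀ k ≤ n, (γ k • ξ).1 ∈ flowBall τ M Ω ε := by
    intro k hk s hs A hA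
    have h4 := h1 k hk τ (by simp) s (hs.trans (le_max_left _ _)) A (.inl hA)
    have h5 := hα s hs A hA
    have h6 := hβ s hs A hA
    have hk0 : (0 : ℝ) ≤ k / n := by positivity
    have hk1 : (0 : ℝ) ≤ 1 - k / n :=
      sub_nonneg.2 (div_le_one_of_le₀ (by exact_mod_cast hk) hn0.le)
    have h7 : (1 - k / n) * setDist μ ((α.1 (.ofAdd s)).img A) ((τ (.ofAdd s)).img A) +
        k / n * setDist μ ((β.1 (.ofAdd s)).img A) ((τ (.ofAdd s)).img A) < ε / 2 := by
      -- Strictness comes from the `α` term unless its weight vanishes, and then from the `β` term.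
      rcases hk1.eq_or_lt with h8 | h8
      · rw [← h8, show (k / n : ℝ) = 1 by linarith]
        linarith
      · have := mul_lt_mul_of_pos_left h5 h8
        have := mul_le_mul_of_nonneg_left h6.le hk0
        linarith
    linarith
  have hstep : ∀ k < n, γ (k + 1) * (γ k)⁻¹ ∈ V := by
    intro k hk
    refine c4 fun A hA => ?_
    rw [AutMeas.imageDist_eq, setDist_congr_right (AutMeas.img_one A)]
    exact (h3 k hk A (.inr (.inr (.inr hA)))).trans_lt hnε
  refine ⟨γ 0 • ξ, a4 _ fun s hs A hA => ?_, γ n • ξ, b4 _ fun s hs A hA => ?_, ?_⟩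
  · have h4 := h1 0 (Nat.zero_le _) α.1 (by simp) s
      (hs.trans ((le_max_left _ _).trans (le_max_right _ _))) A (.inr (.inl hA))
    rw [setDist_self] at h4
    simp only [Nat.cast_zero, zero_div, zero_mul, mul_zero, zero_add] at h4
    linarith
  · have h4 := h1 n le_rfl β.1 (by simp) s
      (hs.trans ((le_max_right _ _).trans (le_max_right _ _))) A (.inr (.inr (.inl hA)))
    rw [setDist_self, div_self hn0.ne'] at h4
    simp only [sub_self, zero_mul, mul_zero, zero_add] at h4
    linarith
  · have hgen : ∀ k, k + 1 ≤ n →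
        γ (k + 1) • ξ ∈ localOrbit (γ 0 • ξ) {x | x.1 ∈ flowBall τ M Ω ε} V := by
      intro k
      have hs : ∀ j < n, γ (j + 1) • ξ ∈ {x : MPErg (Multiplicative ℝ) μ | x.1 ∈ flowBall τ M Ω ε} ∧
          ∃ g ∈ V, g • γ j • ξ = γ (j + 1) • ξ := fun j hj =>
        ⟨hball _ hj, _, hstep j hj, by rw [smul_smul, inv_mul_cancel_right]⟩
      induction k with
      | zero => exact fun h => .single (hs 0 h)
      | succ k ih => exact fun h => .tail (ih (by omega)) (hs _ h)
    obtain ⟨k, rfl⟩ := Nat.exists_eq_succ_of_ne_zero hn0'.ne'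
    exact hgen k le_rfl

end Key

/-! ## Generic points -/

section Generic

variable {G X : Type*} [Group G] [MulAction G X]

theorem localOrbit_mono {x : X} {U U' : Set X} {V V' : Set G} (hU : U ⊆ U') (hV : V ⊆ V') :
    localOrbit x U V ⊆ localOrbit x U' V' :=
  fun y hy => Relation.TransGen.mono
    (fun _ _ h => ⟨hU h.1, h.2.imp fun _ hg => ⟨hV hg.1, hg.2⟩⟩) x y hy

variable [TopologicalSpace X] [ContinuousConstSMul G X]

/-- A chain is finite and its group elements act continuously, so the same elements still work after
a small change of the starting point. -/
theorem eventually_exists_mem_localOrbit {U : Set X} (hU : IsOpen U) (V : Set G) {x y : X}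
    (h : y ∈ localOrbit x U V) :
    ∀ O, IsOpen O → y ∈ O → ∀ᶠ x' in 𝓝 x, ∃ y' ∈ O, y' ∈ localOrbit x' U V := by
  induction h with
  | single h =>
    obtain ⟨hb, g, hg, rfl⟩ := h
    intro O hO hy
    filter_upwards [((hU.inter hO).preimage (continuous_const_smul g)).mem_nhds ⟨hb, hy⟩] with x' hx
    exact ⟨g • x', hx.2, .single ⟨hx.1, g, hg, rfl⟩⟩
  | tail _ h ih =>
    obtain ⟨hc, g, hg, rfl⟩ := h
    intro O hO hy
    filter_upwards [ih _ ((hU.inter hO).preimage (continuous_const_smul g)) ⟨hc, hy⟩] with x' hx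
    obtain ⟨b, hb, hxb⟩ := hx
    exact ⟨g • b, hb.2, .tail hxb ⟨hb.1, g, hg, rfl⟩⟩

theorem isOpen_setOf_localOrbit_inter {U : Set X} (hU : IsOpen U) (V : Set G) {O : Set X}
    (hO : IsOpen O) : IsOpen {x : X | ∃ y ∈ O, y ∈ localOrbit x U V} := by
  refine isOpen_iff_mem_nhds.2 fun x hx => ?_
  obtain ⟨y, hy, hxy⟩ := hx
  exact eventually_exists_mem_localOrbit hU V hxy O hO hy

variable [BaireSpace X] [SecondCountableTopology X] [Nonempty X]

theorem exists_dense_orbit_of_forall_open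
    (h : ∀ W₁ W₂ : Set X, IsOpen W₁ → IsOpen W₂ → W₁.Nonempty → W₂.Nonempty →
      ∃ x ∈ W₁, ∃ g : G, g • x ∈ W₂) : ∃ x : X, Dense (MulAction.orbit G x) := by
  have hB := TopologicalSpace.isBasis_countableBasis X
  have hd : Dense (⋂ O ∈ TopologicalSpace.countableBasis X, {x : X | ∃ g : G, g • x ∈ O}) := by
    refine dense_biInter_of_isOpen (fun O hO => ?_) (TopologicalSpace.countable_countableBasis X)
      fun O hO => ?_
    · have : {x : X | ∃ g : G, g • x ∈ O} = ⋃ g : G, (fun x => g • x) ⁻¹' O := by ext; simp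
      rw [this]
      exact isOpen_iUnion fun g => (hB.isOpen hO).preimage (continuous_const_smul g)
    · refine dense_iff_inter_open.2 fun W hW hne => ?_
      obtain ⟨x, hx, g, hg⟩ := h W O hW (hB.isOpen hO) hne
        (TopologicalSpace.nonempty_of_mem_countableBasis hO)
      exact ⟨x, hx, g, hg⟩
  obtain ⟨x, hx⟩ := hd.nonempty
  refine ⟨x, hB.dense_iff.2 fun O hO _ => ?_⟩
  obtain ⟨g, hg⟩ := mem_iInter₂.1 hx O hO
  exact ⟨g • x, hg, g, rfl⟩

/-- Only countably many basic data `(U', U, O, n)` matter, and each gives a dense open condition on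
`x`. For a point satisfying all of them, local orbits are dense in some neighbourhood `U'` of the
point. -/
theorem exists_isTurbulentPoint_of_forall_open [TopologicalSpace G] [FirstCountableTopology G]
    (h : ∀ (x : X) (U : Set X), IsOpen U → x ∈ U → ∃ U', IsOpen U' ∧ x ∈ U' ∧
      ∀ V : Set G, IsOpen V → 1 ∈ V → ∀ W₁ W₂ : Set X, IsOpen W₁ → IsOpen W₂ → W₁.Nonempty →
        W₂.Nonempty → W₁ ⊆ U' → W₂ ⊆ U' → ∃ x ∈ W₁, ∃ y ∈ W₂, y ∈ localOrbit x U V) :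
    ∃ x : X, IsTurbulentPoint G x := by
  have hB := TopologicalSpace.isBasis_countableBasis X
  have hBc := TopologicalSpace.countable_countableBasis X
  set 𝓑 := TopologicalSpace.countableBasis X
  obtain ⟨v, hv⟩ := (𝓝 (1 : G)).exists_antitone_basis
  have hvo : ∀ n, IsOpen (interior (v n)) ∧ 1 ∈ interior (v n) := fun n =>
    ⟨isOpen_interior, mem_interior_iff_mem_nhds.2 (hv.mem n)⟩
  set good : Set (Set X × Set X) := {p | p.1 ∈ 𝓑 ∧ p.2 ∈ 𝓑 ∧
    ∀ V : Set G, IsOpen V → 1 ∈ V → ∀ W₁ W₂ : Set X, IsOpen W₁ → IsOpen W₂ → W₁.Nonempty →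
        W₂.Nonempty → W₁ ⊆ p.1 → W₂ ⊆ p.1 → ∃ x ∈ W₁, ∃ y ∈ W₂, y ∈ localOrbit x p.2 V}
  have hgood : good.Countable := (hBc.prod hBc).mono fun p hp => mk_mem_prod hp.1 hp.2.1
  set J : Set ((Set X × Set X) × Set X × ℕ) := {j | j.1 ∈ good ∧ j.2.1 ∈ 𝓑 ∧ j.2.1 ⊆ j.1.1}
  have hJ : J.Countable := (hgood.prod (hBc.prod (countable_univ (α := ℕ)))).mono
    fun j hj => mk_mem_prod hj.1 (mk_mem_prod hj.2.1 (mem_univ _))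
  -- The hypothesis concerns only points of `U'`; adding the complement of its closure keeps the
  -- condition open and makes it dense in the whole space.
  have hd : Dense (⋂ j ∈ J, {x : X | ∃ y ∈ j.2.1, y ∈ localOrbit x j.1.2 (interior (v j.2.2))} ∪
      (closure j.1.1)ᶜ) := by
    refine dense_biInter_of_isOpen (fun j hj => ?_) hJ fun j hj => ?_
    · exact (isOpen_setOf_localOrbit_inter (hB.isOpen hj.1.2.1) _ (hB.isOpen hj.2.1)).union
        isClosed_closure.isOpen_compl
    · refine dense_iff_inter_open.2 fun W hW hne => ?_
      rcases (W ∩ j.1.1).eq_empty_or_nonempty with he | hne'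
      · obtain ⟨x, hx⟩ := hne
        refine ⟨x, hx, .inr fun hc => ?_⟩
        have := mem_closure_iff.1 hc W hW hx
        rw [he] at this
        exact not_nonempty_empty this
      · obtain ⟨x, hx, y, hy, hxy⟩ := hj.1.2.2 _ (hvo j.2.2).1 (hvo j.2.2).2 (W ∩ j.1.1) j.2.1
          (hW.inter (hB.isOpen hj.1.1)) (hB.isOpen hj.2.1) hne'
          (TopologicalSpace.nonempty_of_mem_countableBasis hj.2.1) inter_subset_right hj.2.2
        exact ⟨x, hx.1, .inl ⟨y, hy, hxy⟩⟩
  obtain ⟨x, hx⟩ := hd.nonempty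
  refine ⟨x, fun U₀ V hU₀ hxU₀ hV h1V => ?_⟩
  obtain ⟨U, hU, hxU, hUU₀⟩ := hB.exists_subset_of_mem_open hxU₀ hU₀
  obtain ⟨U₁, hU₁, hxU₁, h₁⟩ := h x U (hB.isOpen hU) hxU
  obtain ⟨U', hU', hxU', hU'U₁⟩ := hB.exists_subset_of_mem_open hxU₁ hU₁
  obtain ⟨n, -, hn⟩ := hv.toHasBasis.mem_iff.1 (hV.mem_nhds h1V)
  refine ⟨x, mem_interior.2 ⟨U', fun y hy => ?_, hB.isOpen hU', hxU'⟩⟩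
  refine mem_closure_iff.2 fun O hO hyO => ?_
  obtain ⟨O', hO', hyO', hO'O⟩ := hB.exists_subset_of_mem_open (show y ∈ O ∩ U' from ⟨hyO, hy⟩)
    (hO.inter (hB.isOpen hU'))
  have hj : (((U', U), O', n) : (Set X × Set X) × Set X × ℕ) ∈ J :=
    ⟨⟨hU', hU, fun V' a1 a2 W₁ W₂ a3 a4 a5 a6 a7 a8 => h₁ V' a1 a2 W₁ W₂ a3 a4 a5 a6
      (a7.trans hU'U₁) (a8.trans hU'U₁)⟩, hO', hO'O.trans inter_subset_right⟩
  rcases mem_iInter₂.1 hx _ hj with h2 | h2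
  · obtain ⟨z, hz, hxz⟩ := h2
    exact ⟨z, (hO'O hz).1, localOrbit_mono hUU₀ (interior_subset.trans hn) hxz⟩
  · exact absurd (subset_closure hxU') h2

end Generic

/-! ### Dense orbits and joining local orbits for ergodic flows -/

section GenericFlow

variable {X : Type*} [MeasurableSpace X] {μ : Measure X} [IsProbabilityMeasure μ]
  [StandardBorelSpace X] [NullSingletonClass μ]

instance MPErg.instNonempty : Nonempty (MPErg (Multiplicative ℝ) μ) := by
  obtain ⟨Θ⟩ := nonempty_torusIso μ
  exact ⟨⟨Θ.linearFlow √2 1, Θ.isErgodic_linearFlow one_ne_zero (by simpa using irrational_sqrt_two)⟩⟩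

theorem MPErg.exists_smul_mem {W₁ W₂ : Set (MPErg (Multiplicative ℝ) μ)} (hW₁ : IsOpen W₁)
    (hW₂ : IsOpen W₂) (h₁ : W₁.Nonempty) (h₂ : W₂.Nonempty) :
    ∃ x ∈ W₁, ∃ g : AutMeas μ, g • x ∈ W₂ := by
  obtain ⟨α, hα⟩ := h₁
  obtain ⟨β, hβ⟩ := h₂
  -- With no test sets the ball is the whole space, so `α` and `β` need not be close.
  obtain ⟨x, hx, y, hy, hxy⟩ := exists_mem_localOrbit (τ := α.1) (M := 0) (Ω := ∅) finite_empty
    (by simp) one_pos (by simp [flowBall]) (by simp [flowBall]) hW₁ hW₂ hα hβ isOpen_univ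
    (mem_univ (1 : AutMeas μ))
  have h : ∀ {z}, z ∈ localOrbit x {x | x.1 ∈ flowBall α.1 0 ∅ 1} (univ : Set (AutMeas μ)) →
      ∃ g : AutMeas μ, g • x = z := by
    intro z hz
    induction hz with
    | single h => exact h.2.imp fun _ h => h.2
    | tail _ h ih =>
      obtain ⟨g, rfl⟩ := ih
      obtain ⟨-, g', -, rfl⟩ := h
      exact ⟨g' * g, mul_smul _ _ _⟩
  obtain ⟨g, rfl⟩ := h hxy
  exact ⟨x, hx, g, hy⟩

theorem MPErg.exists_nhd_forall_localOrbit (x : MPErg (Multiplicative ℝ) μ)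
    (U : Set (MPErg (Multiplicative ℝ) μ)) (hU : IsOpen U) (hx : x ∈ U) :
    ∃ U', IsOpen U' ∧ x ∈ U' ∧ ∀ V : Set (AutMeas μ), IsOpen V → 1 ∈ V →
      ∀ W₁ W₂ : Set (MPErg (Multiplicative ℝ) μ), IsOpen W₁ → IsOpen W₂ → W₁.Nonempty →
        W₂.Nonempty → W₁ ⊆ U' → W₂ ⊆ U' → ∃ x ∈ W₁, ∃ y ∈ W₂, y ∈ localOrbit x U V := by
  obtain ⟨M, Ω, ε, hΩ, hm, hε, h⟩ := MPErg.exists_flowBall_subset hU hx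
  refine ⟨Subtype.val ⁻¹' flowBall x.1 M Ω (ε / 2),
    (isOpen_flowBall _ M hΩ hm (by positivity)).preimage continuous_subtype_val,
    mem_flowBall_self _ _ _ (by positivity), fun V hV h1V W₁ W₂ hW₁ hW₂ h₁ h₂ hs₁ hs₂ => ?_⟩
  obtain ⟨α, hα⟩ := h₁
  obtain ⟨β, hβ⟩ := h₂
  obtain ⟨x', hx', y, hy, hxy⟩ := exists_mem_localOrbit hΩ hm hε (hs₁ hα) (hs₂ hβ) hW₁ hW₂ hα hβ
    hV h1V
  exact ⟨x', hx', y, hy, localOrbit_mono (fun z hz => h z hz) subset_rfl hxy⟩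

end GenericFlow

/-! ## Orbits are meagre -/

section Meagre

variable {X : Type*} [MeasurableSpace X] {μ : Measure X} [IsProbabilityMeasure μ]
  [StandardBorelSpace X] [NullSingletonClass μ]

theorem exists_measurableSet_measure_ne_zero_ne_one (μ : Measure X) [IsProbabilityMeasure μ]
    [NullSingletonClass μ] : ∃ A, MeasurableSet A ∧ μ A ≠ 0 ∧ μ A ≠ 1 := by
  obtain ⟨S, -, hS, -⟩ := exists_ae_iso μ (μ.prod uniform01)
  have hm : MeasurableSet ((univ : Set X) ×ˢ Iic (1 / 2 : ℝ)) :=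
    MeasurableSet.univ.prod measurableSet_Iic
  refine ⟨S ⁻¹' (univ ×ˢ Iic (1 / 2)), hS.measurable hm, ?_⟩
  rw [hS.measure_preimage hm.nullMeasurableSet, Measure.prod_prod, measure_univ, one_mul,
    uniform01_Iic (by norm_num)]
  constructor <;> norm_num

/-- If `α_s(A) → A`, then both `α_{r+s}(A) → A` and `α_{r+s}(A) → α_r(A)`, so `A` is invariant; a
set of measure strictly between `0` and `1` contradicts ergodicity. -/
theorem MPErg.exists_not_tendsto (α : MPErg (Multiplicative ℝ) μ) :
    ∃ A, MeasurableSet A ∧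
      ¬ Filter.Tendsto (fun s : ℝ => setDist μ ((α.1 (.ofAdd s)).img A) A) Filter.atTop (𝓝 0) := by
  by_contra! hc
  obtain ⟨A, hA, h0, h1⟩ := exists_measurableSet_measure_ne_zero_ne_one μ
  refine (α.2 A hA fun r => ?_).elim h0 h1
  rw [AutMeas.imageDist_eq, setDist_congr_right (AutMeas.img_one A)]
  have h2 := (hc A hA).comp (Filter.tendsto_atTop_add_const_left _ r.toAdd Filter.tendsto_id)
  have h3 := (hc A hA).add h2
  rw [add_zero] at h3
  refine le_antisymm (ge_of_tendsto' h3 fun s => ?_) (setDist_nonneg _ _)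
  have h4 : setDist μ ((α.1 r).img A) ((α.1 (.ofAdd (r.toAdd + s))).img A) =
      setDist μ ((α.1 (.ofAdd s)).img A) A := by
    rw [ofAdd_add, ofAdd_toAdd, α.1.map_mul, setDist_congr_right (AutMeas.img_mul _ _ A),
      AutMeas.setDist_img _ hA (AutMeas.measurableSet_img _ hA), setDist_comm]
  rw [← h4]
  exact setDist_triangle _ _ _

/-- The set is closed. Near any flow there are ergodic flows with a prescribed large near-period;
taking this period in `S` makes `C` almost fixed at a time of `S`. -/
theorem MPErg.isNowhereDense_of_unbounded {C : Set X} (hC : MeasurableSet C) {ε : ℝ} (hε : 0 < ε)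
    {S : Set ℝ} (hS : ∀ L, ∃ s ∈ S, L ≤ s) :
    IsNowhereDense {β : MPErg (Multiplicative ℝ) μ |
      ∀ s ∈ S, ε ≤ setDist μ ((β.1 (.ofAdd s)).img C) C} := by
  have hcl : IsClosed {β : MPErg (Multiplicative ℝ) μ |
      ∀ s ∈ S, ε ≤ setDist μ ((β.1 (.ofAdd s)).img C) C} := by
    have h1 : ∀ s : ℝ, Continuous fun β : MPErg (Multiplicative ℝ) μ =>
        setDist μ ((β.1 (.ofAdd s)).img C) C := fun s => by
      have := AutMeas.continuous_setDist_img (F := fun β : MPErg (Multiplicative ℝ) μ =>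
        β.1 (.ofAdd s)) (G := fun _ => 1) ((MPAct.continuous_eval_const _).comp
          continuous_subtype_val) continuous_const hC hC
      simpa only [setDist_congr_right (AutMeas.img_one C)] using this
    have h2 : {β : MPErg (Multiplicative ℝ) μ |
        ∀ s ∈ S, ε ≤ setDist μ ((β.1 (.ofAdd s)).img C) C} =
        ⋂ s ∈ S, {β | ε ≤ setDist μ ((β.1 (.ofAdd s)).img C) C} := by ext; simp
    rw [h2]
    exact isClosed_biInter fun s _ => isClosed_le continuous_const (h1 s)
  refine hcl.isNowhereDense_iff.2 (eq_empty_iff_forall_notMem.2 fun β hβ => ?_)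
  obtain ⟨M, Ω, δ, hΩ, hm, hδ, h⟩ := MPErg.exists_flowBall_subset isOpen_interior hβ
  -- No interpolation is needed here: both flows are `β`, and only the conjugator `γ 0` is used.
  obtain ⟨L₀, hL₀⟩ := exists_conj_approx β.1 β.1 (finite_singleton β.1) (hΩ.union
    (finite_singleton C)) (by rintro A (hA | rfl); exacts [hm A hA, hC]) M
    (show 0 < min (δ / 2) (ε / 2) by positivity) one_pos
  obtain ⟨s, hs, hsL⟩ := hS L₀
  obtain ⟨ξ, γ, h1, h2, -⟩ := hL₀ s hsL
  have hmem : γ 0 • ξ ∈ interior {β : MPErg (Multiplicative ℝ) μ |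
      ∀ s ∈ S, ε ≤ setDist μ ((β.1 (.ofAdd s)).img C) C} := by
    refine h _ fun r hr A hA => ?_
    have h4 := h1 0 (Nat.zero_le _) β.1 rfl r hr A (.inl hA)
    rw [setDist_self, mul_zero, mul_zero, zero_add, zero_add] at h4
    have h5 := min_le_left (δ / 2) (ε / 2)
    linarith
  have h3 := interior_subset hmem s hs
  have h4 := h2 0 (Nat.zero_le _) C (.inr rfl)
  have h5 := min_le_right (δ / 2) (ε / 2)
  linarith

theorem MPErg.isMeagre_orbit (α : MPErg (Multiplicative ℝ) μ) :
    IsMeagre (MulAction.orbit (AutMeas μ) α) := by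
  obtain ⟨A, hA, hnt⟩ := α.exists_not_tendsto
  obtain ⟨ε, hε, hS⟩ : ∃ ε > 0, ∃ᶠ s : ℝ in Filter.atTop,
      ε ≤ setDist μ ((α.1 (.ofAdd s)).img A) A := by
    by_contra! hc
    refine hnt (tendsto_order.2 ⟨fun a ha => .of_forall fun s => ha.trans_le (setDist_nonneg _ _),
      fun ε hε => ?_⟩)
    filter_upwards [hc ε hε] with s hs
    exact hs
  obtain ⟨C, hCm, hC⟩ := exists_countable_setDist_dense μ
  have hS' : ∀ L : ℝ, ∃ s ∈ {s : ℝ | ε ≤ setDist μ ((α.1 (.ofAdd s)).img A) A}, L ≤ s := by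
    intro L
    obtain ⟨s, hs, hs'⟩ := Filter.frequently_atTop.1 hS L
    exact ⟨s, hs', hs⟩
  refine (isMeagre_iUnion fun n => (MPErg.isNowhereDense_of_unbounded (μ := μ) (hCm n) (half_pos hε)
    hS').isMeagre).mono ?_
  rintro _ ⟨γ, rfl⟩
  -- The witness `γ(A)` depends on the conjugator; replacing it by a member of the countable family
  -- costs `ε / 4` twice and leaves `ε / 2`.
  obtain ⟨n, hn⟩ := hC (γ.img A) (γ.measurableSet_img hA) (ε / 4) (by positivity)
  refine mem_iUnion.2 ⟨n, fun s hs => ?_⟩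
  have hs' : ε ≤ setDist μ ((α.1 (.ofAdd s)).img A) A := hs
  set T : AutMeas μ := (γ • α).1 (.ofAdd s) with hT
  have h1 : setDist μ (T.img (γ.img A)) (γ.img A) = setDist μ ((α.1 (.ofAdd s)).img A) A := by
    have h2 : T = γ * α.1 (.ofAdd s) * γ⁻¹ := rfl
    rw [h2, AutMeas.setDist_img_conj _ _ (γ.measurableSet_img hA) (γ.measurableSet_img hA)]
    exact setDist_congr (AutMeas.img_ae_congr _ (γ.img_inv_img A)) (γ.img_inv_img A)
  have h2 := abs_setDist_sub_le (μ := μ) (T.img (γ.img A)) (γ.img A) (T.img (C n)) (C n)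
  rw [AutMeas.setDist_img _ (γ.measurableSet_img hA) (hCm n), h1] at h2
  have h3 := (abs_le.1 h2).2
  change ε / 2 ≤ setDist μ (T.img (C n)) (C n)
  linarith

end Meagre

theorem mainTheorem3 {X : Type*} [MeasurableSpace X] [StandardBorelSpace X]
    (μ : Measure X) [IsProbabilityMeasure μ] [NullSingletonClass μ] :
    IsGenericallyTurbulent (AutMeas μ) (MPErg (Multiplicative ℝ) μ) where
  isPolishGSpace :=
    { isTopologicalGroup := inferInstance
      polish_group := AutMeas.polishSpace
      polish_space :=
        have := AutMeas.polishSpace (μ := μ)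
        MPErg.polishSpace
      continuous_smul := inferInstance }
  exists_dense_orbit :=
    have := AutMeas.polishSpace (μ := μ)
    have := MPErg.polishSpace (G := Multiplicative ℝ) (μ := μ)
    exists_dense_orbit_of_forall_open fun _ _ => MPErg.exists_smul_mem
  isMeagre_orbit := MPErg.isMeagre_orbit
  exists_turbulent :=
    have := AutMeas.polishSpace (μ := μ)
    have := MPErg.polishSpace (G := Multiplicative ℝ) (μ := μ)
    exists_isTurbulentPoint_of_forall_open MPErg.exists_nhd_forall_localOrbit
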